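/- Let $(M,\omega)$ be a compact Hermitian manifold with smooth boundary $\partial M$, of complex dimension $n\ge 2$ (holomorphic coordinates, smooth up to the boundary, exist near every point of $M$), and let $\chi$ be a smooth real $(1,1)$-form on $M$. For a real function $v$ let $\lambda[v]=(\lambda_1,\dots,\lambda_n)$ be the eigenvalues of $\chi+\sqrt{-1}\,\partial\bar\partial v$ with respect to $\omega$. Call $v$ admissible if all sums $\lambda_{i_1}+\dots+\lambda_{i_{n-1}}$ with $i_1<\dots<i_{n-1}$ are positive at every point of $M$, and put $$\mathcal M(v)=\prod_{1\le i_1<\dots<i_{n-1}\le n}(\lambda_{i_1}+\dots+\lambda_{i_{n-1}}).$$ Let $\underline u\in C^\infty(M)$ be admissible. Let $\psi\in C^\infty(M)$ be a positive function with $\mathcal M(\underline u)\ge\psi$ on $M$, and let $u\in C^4(M)$ be an admissible solution of $$\mathcal M(u)=\psi \ \text{ in } M,\qquad u=\underline u\ \text{ on } \partial M .$$ At each point of $\partial M$ let $\lambda'_1,\dots,\lambda'_{n-1}$ be the eigenvalues of $g=\chi+\sqrt{-1}\,\partial\bar\partial u$ restricted to the holomorphic tangent bundle $T^{1,0}\partial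 M = T^{1,0}M\cap (T\partial M\otimes\mathbb C)$, with respect to the restriction of $\omega$. Then $$\lambda'_1+\dots+\lambda'_{n-1}\ \ge\ c_0\qquad\text{on } \partial M,$$ where $c_0>0$ is a uniform constant depending only on $(M,\omega)$, $\chi$, $\underline u$ and a positive lower bound of $\psi$. That is, for given $(M,\omega)$, $\chi$, $\underline u$ and $\sigma>0$ there is one $c_0>0$ that works for all such $\psi$ with $\psi\ge\sigma$ and all such $u$. -/

import Mathlib

open Set
open scoped Manifold ContDiff Matrix

noncomputable section

/-- `J` acts on the (real) tangent spaces of a smooth manifold with boundary of real dimension `2n`.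
`IsHolomorphicChart J U z` says that `z = (z¹, …, zⁿ) : U → ℂⁿ`, with `U` open in `M`, is a system of
holomorphic coordinates: a diffeomorphism onto its image, smooth up to the boundary, whose
differential turns `J` into multiplication by `√-1`.  The part of `∂M` in `U` goes to a smooth real
hypersurface of `ℂⁿ`, which need not be flat. -/
structure IsHolomorphicChart {n : ℕ} [NeZero n] {M : Type*} [TopologicalSpace M]
    [ChartedSpace (EuclideanHalfSpace (2 * n)) M]
    (J : ∀ p : M, TangentSpace (𝓡∂ (2 * n)) p →L[ℝ] TangentSpace (𝓡∂ (2 * n)) p)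
    (U : Set M) (z : M → (Fin n → ℂ)) : Prop where
  isOpen : IsOpen U
  isEmbedding : Topology.IsEmbedding (U.domRestrict z)
  contMDiffOn : ContMDiffOn (𝓡∂ (2 * n)) 𝓘(ℝ, Fin n → ℂ) ∞ z U
  isInvertible : ∀ q ∈ U, (mfderiv (𝓡∂ (2 * n)) 𝓘(ℝ, Fin n → ℂ) z q).IsInvertible
  map_J : ∀ q ∈ U, ∀ v : TangentSpace (𝓡∂ (2 * n)) q,
    let w : Fin n → ℂ := mfderiv (𝓡∂ (2 * n)) 𝓘(ℝ, Fin n → ℂ) z q v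
    mfderiv (𝓡∂ (2 * n)) 𝓘(ℝ, Fin n → ℂ) z q (J q v) = Complex.I • w

/-- A complex structure (of complex dimension `n`, smooth up to the boundary) on a smooth manifold
with boundary of real dimension `2n`: holomorphic coordinates exist near every point, boundary points
included.  Since all of them induce the same `J`, the coordinate changes are holomorphic; `J² = -1`
and the smoothness of `J` are automatic. -/
structure ComplexStructure (n : ℕ) [NeZero n] (M : Type*) [TopologicalSpace M]
    [ChartedSpace (EuclideanHalfSpace (2 * n)) M] where
  J : ∀ p : M, TangentSpace (𝓡∂ (2 * n)) p →L[ℝ] TangentSpace (𝓡∂ (2 * n)) p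
  exists_chart : ∀ p : M, ∃ (U : Set M) (z : M → (Fin n → ℂ)), p ∈ U ∧ IsHolomorphicChart J U z

section

variable {n : ℕ} [NeZero n] {M : Type*} [TopologicalSpace M]
  [ChartedSpace (EuclideanHalfSpace (2 * n)) M]

/-- A smooth real `(1,1)`-form: a smooth alternating `2`-form invariant under `J`. -/
structure RealOneOneForm [IsManifold (𝓡∂ (2 * n)) ∞ M] (X : ComplexStructure n M) where
  toFun : ∀ p : M, TangentSpace (𝓡∂ (2 * n)) p →L[ℝ] TangentSpace (𝓡∂ (2 * n)) p →L[ℝ] ℝ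
  alternating : ∀ (p : M) (v : TangentSpace (𝓡∂ (2 * n)) p), toFun p v v = 0
  invariant : ∀ (p : M) (v w : TangentSpace (𝓡∂ (2 * n)) p),
    toFun p (X.J p v) (X.J p w) = toFun p v w
  contMDiff : ContMDiff (𝓡∂ (2 * n))
    ((𝓡∂ (2 * n)).prod 𝓘(ℝ, EuclideanSpace ℝ (Fin (2 * n)) →L[ℝ]
      EuclideanSpace ℝ (Fin (2 * n)) →L[ℝ] ℝ)) ∞
    (fun p ↦ Bundle.TotalSpace.mk' (EuclideanSpace ℝ (Fin (2 * n)) →L[ℝ]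
      EuclideanSpace ℝ (Fin (2 * n)) →L[ℝ] ℝ)
      (E := fun p : M ↦ TangentSpace (𝓡∂ (2 * n)) p →L[ℝ] TangentSpace (𝓡∂ (2 * n)) p →L[ℝ] ℝ)
      p (toFun p))

/-- A Hermitian metric, given by its fundamental form `ω`, a positive real `(1,1)`-form. -/
structure HermitianMetric [IsManifold (𝓡∂ (2 * n)) ∞ M] (X : ComplexStructure n M)
    extends RealOneOneForm X where
  pos : ∀ (p : M) (v : TangentSpace (𝓡∂ (2 * n)) p), v ≠ 0 → 0 < toFun p v (X.J p v)

/-- The real tangent vector at `q` whose image under `dz` is `v ∈ ℂⁿ`.  Thus `∂/∂xʲ` is the vector of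
`Pi.single j 1`, and `∂/∂yʲ` is the vector of `Pi.single j √-1`. -/
def coordVec (z : M → (Fin n → ℂ)) (q : M) (v : Fin n → ℂ) : TangentSpace (𝓡∂ (2 * n)) q :=
  (mfderiv (𝓡∂ (2 * n)) 𝓘(ℝ, Fin n → ℂ) z q).inverse v

/-- The derivative of `f` along the coordinate vector field of `v ∈ ℂⁿ`. -/
def coordDeriv (z : M → (Fin n → ℂ)) (v : Fin n → ℂ) (f : M → ℂ) (q : M) : ℂ :=
  mfderiv (𝓡∂ (2 * n)) 𝓘(ℝ, ℂ) f q (coordVec z q v)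

/-- `∂f/∂zʲ`. -/
def del (z : M → (Fin n → ℂ)) (j : Fin n) (f : M → ℂ) (q : M) : ℂ :=
  (coordDeriv z (Pi.single j 1) f q - Complex.I * coordDeriv z (Pi.single j Complex.I) f q) / 2

/-- `∂f/∂z̄ᵏ`. -/
def delBar (z : M → (Fin n → ℂ)) (k : Fin n) (f : M → ℂ) (q : M) : ℂ :=
  (coordDeriv z (Pi.single k 1) f q + Complex.I * coordDeriv z (Pi.single k Complex.I) f q) / 2

/-- The complex Hessian `(u_{j k̄})`, the coefficients of `√-1 ∂∂̄u = √-1 u_{j k̄} dzʲ ∧ dz̄ᵏ`. -/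
def complexHessian (z : M → (Fin n → ℂ)) (u : M → ℝ) (q : M) : Matrix (Fin n) (Fin n) ℂ :=
  Matrix.of fun j k ↦ del z j (delBar z k (fun x ↦ (u x : ℂ))) q

/-- The coefficients `(α_{j k̄})` of a real `(1,1)`-form `α = √-1 α_{j k̄} dzʲ ∧ dz̄ᵏ`, that is
`α_{j k̄} = (α(∂/∂xʲ, ∂/∂yᵏ) - √-1 α(∂/∂xʲ, ∂/∂xᵏ)) / 2`. -/
def coeff [IsManifold (𝓡∂ (2 * n)) ∞ M] {X : ComplexStructure n M} (z : M → (Fin n → ℂ))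
    (α : RealOneOneForm X) (q : M) : Matrix (Fin n) (Fin n) ℂ :=
  Matrix.of fun j k ↦
    ((α.toFun q (coordVec z q (Pi.single j 1)) (coordVec z q (Pi.single k Complex.I)) : ℂ)
      - Complex.I *
        (α.toFun q (coordVec z q (Pi.single j 1)) (coordVec z q (Pi.single k 1)) : ℂ)) / 2

/-- The coefficients `g_{j k̄} = χ_{j k̄} + u_{j k̄}` of `g = χ + √-1 ∂∂̄u`. -/
def gCoeff [IsManifold (𝓡∂ (2 * n)) ∞ M] {X : ComplexStructure n M} (z : M → (Fin n → ℂ))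
    (χ : RealOneOneForm X) (u : M → ℝ) (q : M) : Matrix (Fin n) (Fin n) ℂ :=
  coeff z χ q + complexHessian z u q

end

/-- The eigenvalues, with multiplicity, of a Hermitian matrix `G = (g_{j k̄})` with respect to a
positive definite one `W = (ω_{j k̄})`, i.e. of the endomorphism `gⁱⱼ = ω^{i k̄} g_{j k̄}` (whose
matrix is the transpose of `G W⁻¹`).  They are real. -/
def relEigenvalues {m : ℕ} (W G : Matrix (Fin m) (Fin m) ℂ) : Multiset ℝ :=
  (G * W⁻¹).charpoly.roots.map Complex.re

/-- The sums `λ_{i₁} + ⋯ + λ_{i_p}` over `i₁ < ⋯ < i_p`. -/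
def pSums (p : ℕ) (l : Multiset ℝ) : Multiset ℝ :=
  (l.powersetCard p).map Multiset.sum

section

variable {n : ℕ} [NeZero n] {M : Type*} [TopologicalSpace M]
  [ChartedSpace (EuclideanHalfSpace (2 * n)) M] [IsManifold (𝓡∂ (2 * n)) ∞ M]
  {X : ComplexStructure n M}

/-- The eigenvalues `λ` of `g = χ + √-1 ∂∂̄u` with respect to the metric `ω` at `q`, computed in the holomorphic
coordinates `z` (they do not depend on `z`). -/
def eigenvaluesAt (metric : HermitianMetric X) (χ : RealOneOneForm X) (u : M → ℝ)
    (z : M → (Fin n → ℂ)) (q : M) : Multiset ℝ :=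
  relEigenvalues (coeff z metric.toRealOneOneForm q) (gCoeff z χ u q)

/-- `u` is admissible: `λ` lies in the cone `𝒫_p` (all sums of `p` eigenvalues are positive) at each
point of `M`, boundary points included. -/
def IsAdmissible (p : ℕ) (metric : HermitianMetric X) (χ : RealOneOneForm X) (u : M → ℝ) : Prop :=
  ∀ (U : Set M) (z : M → (Fin n → ℂ)), IsHolomorphicChart X.J U z → ∀ q ∈ U,
    ∀ s ∈ pSums p (eigenvaluesAt metric χ u z q), 0 < s

/-- `ℳ_p(u) = ∏_{i₁ < ⋯ < i_p} (λ_{i₁} + ⋯ + λ_{i_p})` at `q`. -/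
def maOperator (p : ℕ) (metric : HermitianMetric X) (χ : RealOneOneForm X) (u : M → ℝ)
    (z : M → (Fin n → ℂ)) (q : M) : ℝ :=
  (pSums p (eigenvaluesAt metric χ u z q)).prod

/-- `ℳ_p(u) = ψ` on `M`. -/
def IsSolution (p : ℕ) (metric : HermitianMetric X) (χ : RealOneOneForm X) (ψ u : M → ℝ) : Prop :=
  ∀ (U : Set M) (z : M → (Fin n → ℂ)), IsHolomorphicChart X.J U z → ∀ q ∈ U,
    maOperator p metric χ u z q = ψ q

/-- `ℳ_p(v) ≥ ψ` on `M`. -/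
def IsSubsolution (p : ℕ) (metric : HermitianMetric X) (χ : RealOneOneForm X) (ψ v : M → ℝ) : Prop :=
  ∀ (U : Set M) (z : M → (Fin n → ℂ)), IsHolomorphicChart X.J U z → ∀ q ∈ U,
    ψ q ≤ maOperator p metric χ v z q

/-- `v ∈ T_p(∂M)`, for `p ∈ ∂M`: in the preferred (smooth) chart of `M` at `p`, the boundary is the
hyperplane where the coordinate of index `0` vanishes. -/
def IsBoundaryTangent (p : M) (v : TangentSpace (𝓡∂ (2 * n)) p) : Prop :=
  let w : EuclideanSpace ℝ (Fin (2 * n)) :=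
    mfderiv (𝓡∂ (2 * n)) 𝓘(ℝ, EuclideanSpace ℝ (Fin (2 * n))) (extChartAt (𝓡∂ (2 * n)) p) p v
  w 0 = 0

/-- The rows of `Ξ` are a basis `ξ₁, …, ξ_{n-1}` of `T^{1,0}_p(∂M) = T^{1,0}_p M ∩ (T_p(∂M) ⊗ ℂ)` in
the holomorphic coordinates `z`: `ξ_a = Ξ_{a j} ∂/∂zʲ` is tangent to `∂M` if and only if its real and
imaginary parts are, i.e. `v` and `J v` are tangent to `∂M`, with `v = coordVec z p (Ξ a)`. -/
def IsTangentialFrame (X : ComplexStructure n M) (z : M → (Fin n → ℂ)) (p : M)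
    (Ξ : Matrix (Fin (n - 1)) (Fin n) ℂ) : Prop :=
  LinearIndependent ℂ (fun a ↦ Ξ a) ∧
    ∀ a, IsBoundaryTangent p (coordVec z p (Ξ a)) ∧
      IsBoundaryTangent p (X.J p (coordVec z p (Ξ a)))

/-- The eigenvalues `λ'` of `g = χ + √-1 ∂∂̄u` restricted to `T^{1,0}_p(∂M)`, with respect to the
restriction of `ω`, computed in the basis `Ξ` (they do not depend on `Ξ` and `z`):
`g(ξ_a, ξ̄_b) = Ξ_{a j} g_{j k̄} conj Ξ_{b k}`. -/
def tangentialEigenvalues (metric : HermitianMetric X) (χ : RealOneOneForm X) (u : M → ℝ)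
    (z : M → (Fin n → ℂ)) (p : M) (Ξ : Matrix (Fin (n - 1)) (Fin n) ℂ) : Multiset ℝ :=
  relEigenvalues (Ξ * coeff z metric.toRealOneOneForm p * Ξᴴ) (Ξ * gCoeff z χ u p * Ξᴴ)

end

end

noncomputable section

open Filter Topology VectorField

/-! Write `w = u - uSub` and let `ρ ≥ 0` be a local defining function of the boundary. The trace
over the complex hyperplane `ker ∂ρ` makes sense on a whole chart, not only on the boundary; call it
`P` (`tangentTrace`). At a boundary point `dw = t dρ` for some real `t`. The function `w - tρ`
vanishes on the boundary and has zero differential at that point, so its complex Hessian vanishes on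
the holomorphic tangent space. Hence the sum to be bounded is `P(g_uSub) + t P(√-1∂∂̄ρ)`
(`IsDominatedSolution.sum_tangentialEigenvalues`). The first term is positive by admissibility, and
`t ≥ 0` by the comparison principle. Two situations remain.

If `P(√-1∂∂̄ρ) ≥ 0` at the centre `p₀` of the chart, an upper bound for `t` suffices, since near
`p₀` the second term is then no worse than a small negative multiple of `t`. The bound of `t` comes
from a bound of `w` and a linear barrier for the trace operator.

If `κ = -P(√-1∂∂̄ρ) > 0`, put `η = P(g_uSub)/κ`; the claim becomes `t ≤ η - ε`. It follows from `w ≤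
b` near the point, where `b = (η - ε)ρ + Bρr + Aρ² + Er²` and `r` is the squared coordinate distance
to the point. At an interior negative minimum of `b - w` the complex Hessian of `b - w` is
nonnegative. Applying `P`, which kills every term with a factor `∂ρ`, the term `(η - ε)P(√-1∂∂̄ρ) =
-P(g_uSub) + εκ` cancels `P(g_uSub)`, and `A`, `B` absorb the rest, so `P(g_u) ≤ εκ`. Applying the
full trace gives `tr g_u ≤ K` with `K` independent of `ε` and `u`.

The decisive algebraic fact is `prod_pSums_le`: `ℳ ≤ P(g) ((n - 1) tr g)^(n - 1)`. It holds because
`P(g)` is a weighted mean of the factors `tr g - λ_i` of `ℳ`, hence at least the smallest of them.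
Together with `ℳ(u) ≥ σ` it contradicts the two estimates once `ε` is small. No gradient or second
order estimate of `u` is needed.

Two global inputs use the components of `M` that meet the boundary. The comparison principle `u ≥
uSub` uses the concavity of the logarithm of `ℳ`, which is a determinant of `tr(g)ω - g`, together
with the strong minimum principle. The bound of `w` from above uses only `tr g_u ≥ 0`: if it failed,
the functions `1 - w/max w` would be nearly supersolutions, positive near the boundary, and
positivity would propagate to the maximum point of `w`, where they vanish. -/

/-! ### Derivatives along line segments in a domain with boundary -/

theorem hasDerivAt_slice {E : Type*} [NormedAddCommGroup E] [NormedSpace ℝ E] {f : E → ℝ}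
    {R : Set E} {x e : E} (hR : UniqueDiffOn ℝ R) (hf : ContDiffWithinAt ℝ 2 f R x)
    (he : ∀ᶠ t : ℝ in 𝓝 0, x + t • e ∈ R) :
    (∀ᶠ t : ℝ in 𝓝 0,
      HasDerivAt (fun t : ℝ ↦ f (x + t • e)) (fderivWithin ℝ f R (x + t • e) e) t) ∧
    HasDerivAt (fun t : ℝ ↦ fderivWithin ℝ f R (x + t • e) e)
      (fderivWithin ℝ (fderivWithin ℝ f R) R x e e) 0 := by
  have hx : x ∈ R := by simpa using he.self_of_nhds
  have hl : ∀ t : ℝ, HasDerivAt (fun t : ℝ ↦ x + t • e) e t := fun t ↦ by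
    simpa using ((hasDerivAt_id t).smul_const e).const_add x
  have hcont : Tendsto (fun t : ℝ ↦ x + t • e) (𝓝 0) (𝓝[R] x) := by
    refine tendsto_nhdsWithin_iff.2 ⟨?_, he⟩
    simpa using (hl 0).continuousAt.tendsto
  constructor
  · have h1 := hf.eventually (by simp)
    rw [insert_eq_of_mem hx] at h1
    filter_upwards [hcont h1, he.eventually_nhds] with t ht1 ht2
    have ht1 : ContDiffWithinAt ℝ 2 f R (x + t • e) := ht1
    have h2 := (ht1.differentiableWithinAt (by simp)).hasFDerivWithinAt
    have h3 := h2.comp_hasDerivWithinAt_of_eq t (s := {s : ℝ | x + s • e ∈ R})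
      (f := fun s : ℝ ↦ x + s • e) (hl t).hasDerivWithinAt (fun s hs ↦ hs) rfl
    exact h3.hasDerivAt ht2
  · have h1 := ((hf.fderivWithin_right (m := 1) hR (by norm_num) hx).differentiableWithinAt
      (by simp)).hasFDerivWithinAt
    have h3 := h1.comp_hasDerivWithinAt_of_eq (0 : ℝ) (s := {s : ℝ | x + s • e ∈ R})
      (f := fun s : ℝ ↦ x + s • e) (hl 0).hasDerivWithinAt (fun s hs ↦ hs) (by simp)
    have h4 := (h3.hasDerivAt he).clm_apply (hasDerivAt_const (0 : ℝ) e)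
    simpa using h4

theorem snd_fderivWithin_nonneg_of_isMin {E : Type*} [NormedAddCommGroup E] [NormedSpace ℝ E]
    {f : E → ℝ} {R : Set E} {x e : E} (hR : UniqueDiffOn ℝ R) (hf : ContDiffWithinAt ℝ 2 f R x)
    (he : ∀ᶠ t : ℝ in 𝓝 0, x + t • e ∈ R) (hmin : ∀ᶠ t : ℝ in 𝓝 0, f x ≤ f (x + t • e)) :
    0 ≤ fderivWithin ℝ (fderivWithin ℝ f R) R x e e := by
  obtain ⟨h1, h2⟩ := hasDerivAt_slice hR hf he
  set g := fun t : ℝ ↦ f (x + t • e)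
  have hd : deriv g =ᶠ[𝓝 0] fun t ↦ fderivWithin ℝ f R (x + t • e) e := by
    filter_upwards [h1] with t ht using ht.deriv
  have hdd : deriv (deriv g) 0 = fderivWithin ℝ (fderivWithin ℝ f R) R x e e := by
    rw [hd.deriv_eq, h2.deriv]
  have hlm : IsLocalMin g 0 := by
    filter_upwards [hmin] with t ht
    simpa [g] using ht
  -- A negative second derivative would make `0` a local maximum too, so `g` would be constant near
  -- `0` and the second derivative would be zero.
  by_contra! hneg
  have hmax := isLocalMax_of_deriv_deriv_neg (hdd ▸ hneg) hlm.deriv_eq_zero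
    h1.self_of_nhds.continuousAt
  have hconst : g =ᶠ[𝓝 0] fun _ ↦ g 0 := by
    filter_upwards [hlm, hmax] with t a b using le_antisymm b a
  have : deriv (deriv g) 0 = 0 := by
    rw [(hconst.deriv).deriv_eq]; simp
  linarith

/-- Meant for `R` a closed half space and a line inside its bounding hyperplane: the line stays in
`R` on both sides of `x` although `x` is not interior to `R`. -/
theorem snd_fderivWithin_eq_zero_of_slice {E : Type*} [NormedAddCommGroup E] [NormedSpace ℝ E]
    {f : E → ℝ} {R : Set E} {x e : E} (hR : UniqueDiffOn ℝ R) (hf : ContDiffWithinAt ℝ 2 f R x)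
    (he : ∀ᶠ t : ℝ in 𝓝 0, x + t • e ∈ R) (h0 : ∀ᶠ t : ℝ in 𝓝 0, f (x + t • e) = 0) :
    fderivWithin ℝ f R x e = 0 ∧ fderivWithin ℝ (fderivWithin ℝ f R) R x e e = 0 := by
  obtain ⟨h1, h2⟩ := hasDerivAt_slice hR hf he
  have hg : (fun t : ℝ ↦ f (x + t • e)) =ᶠ[𝓝 0] fun _ ↦ 0 := h0
  have hd : (fun t : ℝ ↦ fderivWithin ℝ f R (x + t • e) e) =ᶠ[𝓝 0] fun _ ↦ 0 := by
    filter_upwards [h1, hg.deriv] with t ht h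
    rw [← ht.deriv, h]; simp
  refine ⟨by simpa using hd.self_of_nhds, ?_⟩
  rw [← h2.deriv, hd.deriv_eq]; simp

/-! ### Derivatives along holomorphic coordinate fields and their expression in real charts -/

section Calculus

variable {n : ℕ} [NeZero n] {M : Type*} [TopologicalSpace M]
  [ChartedSpace (EuclideanHalfSpace (2 * n)) M]

/-- The derivative of a real function `f` along the coordinate vector field of `v ∈ ℂⁿ`. -/
def realDeriv (z : M → (Fin n → ℂ)) (v : Fin n → ℂ) (f : M → ℝ) (q : M) : ℝ :=
  mfderiv (𝓡∂ (2 * n)) 𝓘(ℝ, ℝ) f q (coordVec z q v)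

/-- The iterated derivative along two coordinate vector fields. -/
def realHess (z : M → (Fin n → ℂ)) (f : M → ℝ) (v w : Fin n → ℂ) (q : M) : ℝ :=
  realDeriv z v (realDeriv z w f) q

variable {J : ∀ p : M, TangentSpace (𝓡∂ (2 * n)) p →L[ℝ] TangentSpace (𝓡∂ (2 * n)) p}
  {U : Set M} {z : M → (Fin n → ℂ)}

theorem IsHolomorphicChart.contMDiffAt (h : IsHolomorphicChart J U z) {q : M} (hq : q ∈ U) :
    ContMDiffAt (𝓡∂ (2 * n)) 𝓘(ℝ, Fin n → ℂ) ∞ z q :=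
  (h.contMDiffOn q hq).contMDiffAt (h.isOpen.mem_nhds hq)

theorem IsHolomorphicChart.mono (h : IsHolomorphicChart J U z) {V : Set M} (hV : IsOpen V)
    (hVU : V ⊆ U) : IsHolomorphicChart J V z where
  isOpen := hV
  isEmbedding := by
    have := h.isEmbedding.comp (Topology.IsEmbedding.inclusion hVU)
    exact this
  contMDiffOn := h.contMDiffOn.mono hVU
  isInvertible q hq := h.isInvertible q (hVU hq)
  map_J q hq := h.map_J q (hVU hq)

theorem IsHolomorphicChart.mfderiv_coordVec (h : IsHolomorphicChart J U z) {q : M} (hq : q ∈ U)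
    (v : Fin n → ℂ) : mfderiv (𝓡∂ (2 * n)) 𝓘(ℝ, Fin n → ℂ) z q (coordVec z q v) = v := by
  obtain ⟨e, he⟩ := h.isInvertible q hq
  unfold coordVec
  rw [← he, ContinuousLinearMap.inverse_equiv]
  exact e.apply_symm_apply _

theorem IsHolomorphicChart.coordVec_mfderiv (h : IsHolomorphicChart J U z) {q : M} (hq : q ∈ U)
    (v : TangentSpace (𝓡∂ (2 * n)) q) :
    coordVec z q (mfderiv (𝓡∂ (2 * n)) 𝓘(ℝ, Fin n → ℂ) z q v) = v := by
  obtain ⟨e, he⟩ := h.isInvertible q hq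
  unfold coordVec
  rw [← he, ContinuousLinearMap.inverse_equiv]
  exact e.symm_apply_apply _

theorem IsHolomorphicChart.coordVec_I (h : IsHolomorphicChart J U z) {q : M} (hq : q ∈ U)
    (v : Fin n → ℂ) : coordVec z q (Complex.I • v) = J q (coordVec z q v) := by
  rw [← h.coordVec_mfderiv hq (J q (coordVec z q v))]
  congr 1
  have := h.map_J q hq (coordVec z q v)
  simp only [h.mfderiv_coordVec hq] at this
  exact this.symm

theorem coordVec_add (z : M → (Fin n → ℂ)) (q : M) (v w : Fin n → ℂ) :
    coordVec z q (v + w) = coordVec z q v + coordVec z q w := by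
  unfold coordVec; exact map_add _ _ _

theorem coordVec_smul (z : M → (Fin n → ℂ)) (q : M) (c : ℝ) (v : Fin n → ℂ) :
    coordVec z q (c • v) = c • coordVec z q v := by
  unfold coordVec; exact map_smul _ _ _

theorem realDeriv_add_vec (z : M → (Fin n → ℂ)) (q : M) (v w : Fin n → ℂ) (f : M → ℝ) :
    realDeriv z (v + w) f q = realDeriv z v f q + realDeriv z w f q := by
  unfold realDeriv; rw [coordVec_add]; exact map_add _ _ _

theorem realDeriv_smul_vec (z : M → (Fin n → ℂ)) (q : M) (c : ℝ) (v : Fin n → ℂ) (f : M → ℝ) :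
    realDeriv z (c • v) f q = c * realDeriv z v f q := by
  unfold realDeriv; rw [coordVec_smul]; exact map_smul _ _ _

theorem realDeriv_congr {f g : M → ℝ} {q : M} (h : f =ᶠ[𝓝 q] g) (v : Fin n → ℂ) :
    realDeriv z v f q = realDeriv z v g q := by
  unfold realDeriv; rw [h.mfderiv_eq]; rfl

theorem ContinuousLinearMap.apply_inverse_comp {E F G : Type*}
    [AddCommGroup E] [Module ℝ E] [TopologicalSpace E] [AddCommGroup F] [Module ℝ F]
    [TopologicalSpace F] [AddCommGroup G] [Module ℝ G] [TopologicalSpace G]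
    {A : F →L[ℝ] G} {B : E →L[ℝ] F} (hA : A.IsInvertible) (hB : B.IsInvertible) (v : G) :
    B ((A.comp B).inverse v) = A.inverse v := by
  obtain ⟨e, rfl⟩ := hA
  obtain ⟨e', rfl⟩ := hB
  rw [show (e : F →L[ℝ] G).comp (e' : E →L[ℝ] F) = (e'.trans e : E ≃L[ℝ] G) from rfl]
  simp [ContinuousLinearMap.inverse_equiv]

theorem ContMDiffAt.contDiffWithinAt_comp_extChartAt_symm {F : Type*}
    [NormedAddCommGroup F] [NormedSpace ℝ F] {f : M → F} {k : WithTop ℕ∞} {q : M}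
    (hf : ContMDiffAt (𝓡∂ (2 * n)) 𝓘(ℝ, F) k f q) :
    ContDiffWithinAt ℝ k (f ∘ (extChartAt (𝓡∂ (2 * n)) q).symm) (range (𝓡∂ (2 * n)))
      (extChartAt (𝓡∂ (2 * n)) q q) :=
  (contMDiffAt_iff.1 hf).2

section

variable [IsManifold (𝓡∂ (2 * n)) ∞ M]

/-- The coordinate field is the pullback by `z` of a constant field on `ℂⁿ`. -/
theorem IsHolomorphicChart.contMDiffAt_coordVec (h : IsHolomorphicChart J U z) {q : M}
    (hq : q ∈ U) (v : Fin n → ℂ) :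
    ContMDiffAt (𝓡∂ (2 * n)) (𝓡∂ (2 * n)).tangent ∞
      (fun q ↦ (⟨q, coordVec z q v⟩ : TangentBundle (𝓡∂ (2 * n)) M)) q := by
  have hV : ContMDiffAt 𝓘(ℝ, Fin n → ℂ) 𝓘(ℝ, Fin n → ℂ).tangent ∞
      (fun y ↦ (⟨y, v⟩ : TangentBundle 𝓘(ℝ, Fin n → ℂ) (Fin n → ℂ))) (z q) :=
    contMDiffAt_vectorSpace_iff_contDiffAt.2 contDiffAt_const
  exact ContMDiffAt.mpullback_vectorField_preimage hV (h.contMDiffAt hq) (h.isInvertible q hq)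
    (by simp)

theorem IsHolomorphicChart.contMDiffOn_realDeriv (h : IsHolomorphicChart J U z) {f : M → ℝ}
    {k m : ℕ∞} (hf : ContMDiffOn (𝓡∂ (2 * n)) 𝓘(ℝ, ℝ) m f U) (hkm : k + 1 ≤ m)
    (v : Fin n → ℂ) : ContMDiffOn (𝓡∂ (2 * n)) 𝓘(ℝ, ℝ) k (realDeriv z v f) U := by
  have hkm' : ((k : ℕ∞) : WithTop ℕ∞) + 1 ≤ (m : WithTop ℕ∞) := by exact_mod_cast hkm
  have h1 := hf.contMDiffOn_tangentMapWithin hkm' h.isOpen.uniqueMDiffOn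
  have h2 : ContMDiffOn (𝓡∂ (2 * n)) (𝓡∂ (2 * n)).tangent k
      (fun q ↦ (⟨q, coordVec z q v⟩ : TangentBundle (𝓡∂ (2 * n)) M)) U :=
    fun q hq ↦ ((h.contMDiffAt_coordVec hq v).of_le (by exact_mod_cast le_top)).contMDiffWithinAt
  have h3 := h1.comp h2 (fun q hq ↦ hq)
  have h4 := (contMDiff_snd_tangentBundle_modelSpace ℝ 𝓘(ℝ, ℝ) (n := k)).comp_contMDiffOn h3
  refine h4.congr fun q hq ↦ ?_
  simp only [Function.comp, tangentMapWithin, realDeriv]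
  rw [mfderivWithin_of_isOpen h.isOpen hq]

theorem fderivWithin_comp_extChartAt_symm {F : Type*} [NormedAddCommGroup F] [NormedSpace ℝ F]
    {f : M → F} {q₀ : M} {x : EuclideanSpace ℝ (Fin (2 * n))}
    (hx : x ∈ (extChartAt (𝓡∂ (2 * n)) q₀).target)
    (hf : MDifferentiableAt (𝓡∂ (2 * n)) 𝓘(ℝ, F) f ((extChartAt (𝓡∂ (2 * n)) q₀).symm x)) :
    fderivWithin ℝ (f ∘ (extChartAt (𝓡∂ (2 * n)) q₀).symm) (range (𝓡∂ (2 * n))) x =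
      (mfderiv (𝓡∂ (2 * n)) 𝓘(ℝ, F) f ((extChartAt (𝓡∂ (2 * n)) q₀).symm x)).comp
        (mfderivWithin 𝓘(ℝ, EuclideanSpace ℝ (Fin (2 * n))) (𝓡∂ (2 * n))
          (extChartAt (𝓡∂ (2 * n)) q₀).symm (range (𝓡∂ (2 * n))) x) := by
  have : IsManifold (𝓡∂ (2 * n)) 1 M := IsManifold.of_le (n := ∞) (by simp)
  have hx' := extChartAt_target_subset_range q₀ hx
  have hu : UniqueMDiffWithinAt 𝓘(ℝ, EuclideanSpace ℝ (Fin (2 * n))) (range (𝓡∂ (2 * n))) x :=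
    ((𝓡∂ (2 * n)).uniqueDiffOn x hx').uniqueMDiffWithinAt
  have h := mfderiv_comp_mfderivWithin x hf (mdifferentiableWithinAt_extChartAt_symm hx) hu
  rw [← mfderivWithin_eq_fderivWithin]
  exact h

theorem realDeriv_eq_fderivWithin (h : IsHolomorphicChart J U z) {f : M → ℝ} {q₀ : M}
    {x : EuclideanSpace ℝ (Fin (2 * n))} (hx : x ∈ (extChartAt (𝓡∂ (2 * n)) q₀).target)
    (hxU : (extChartAt (𝓡∂ (2 * n)) q₀).symm x ∈ U)
    (hf : MDifferentiableAt (𝓡∂ (2 * n)) 𝓘(ℝ, ℝ) f ((extChartAt (𝓡∂ (2 * n)) q₀).symm x))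
    (v : Fin n → ℂ) :
    realDeriv z v f ((extChartAt (𝓡∂ (2 * n)) q₀).symm x) =
      fderivWithin ℝ (f ∘ (extChartAt (𝓡∂ (2 * n)) q₀).symm) (range (𝓡∂ (2 * n))) x
        ((fderivWithin ℝ (z ∘ (extChartAt (𝓡∂ (2 * n)) q₀).symm)
          (range (𝓡∂ (2 * n))) x).inverse v) := by
  have : IsManifold (𝓡∂ (2 * n)) 1 M := IsManifold.of_le (n := ∞) (by simp)
  rw [fderivWithin_comp_extChartAt_symm hx hf,
    fderivWithin_comp_extChartAt_symm hx ((h.contMDiffAt hxU).mdifferentiableAt (by simp))]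
  unfold realDeriv coordVec
  exact congrArg _ (ContinuousLinearMap.apply_inverse_comp (h.isInvertible _ hxU)
    (isInvertible_mfderivWithin_extChartAt_symm hx) v).symm


theorem IsHolomorphicChart.isInvertible_fderivWithin (h : IsHolomorphicChart J U z) {q₀ : M}
    {x : EuclideanSpace ℝ (Fin (2 * n))} (hx : x ∈ (extChartAt (𝓡∂ (2 * n)) q₀).target)
    (hxU : (extChartAt (𝓡∂ (2 * n)) q₀).symm x ∈ U) :
    (fderivWithin ℝ (z ∘ (extChartAt (𝓡∂ (2 * n)) q₀).symm)
      (range (𝓡∂ (2 * n))) x).IsInvertible := by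
  have : IsManifold (𝓡∂ (2 * n)) 1 M := IsManifold.of_le (n := ∞) (by simp)
  rw [fderivWithin_comp_extChartAt_symm hx ((h.contMDiffAt hxU).mdifferentiableAt (by simp))]
  exact (h.isInvertible _ hxU).comp (isInvertible_mfderivWithin_extChartAt_symm hx)

/-- The second derivative along coordinate vector fields, in a real chart of the manifold. -/
theorem realHess_eq_fderivWithin (h : IsHolomorphicChart J U z) {f : M → ℝ} {q : M}
    (hq : q ∈ U) (hf : ContMDiffOn (𝓡∂ (2 * n)) 𝓘(ℝ, ℝ) 2 f U) (v w : Fin n → ℂ) :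
    let φ := extChartAt (𝓡∂ (2 * n)) q
    let R := range (𝓡∂ (2 * n))
    let f' := f ∘ φ.symm
    let L := fderivWithin ℝ (z ∘ φ.symm) R (φ q)
    realHess z f v w q =
      fderivWithin ℝ (fderivWithin ℝ f' R) R (φ q) (L.inverse v) (L.inverse w) -
      fderivWithin ℝ f' R (φ q) (L.inverse
        (fderivWithin ℝ (fderivWithin ℝ (z ∘ φ.symm) R) R (φ q) (L.inverse v) (L.inverse w))) := by
  intro φ R f' L
  have : IsManifold (𝓡∂ (2 * n)) 1 M := IsManifold.of_le (n := ∞) (by simp)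
  set Z := z ∘ φ.symm with hZ
  have hxt : φ q ∈ φ.target := mem_extChartAt_target q
  have hxR : φ q ∈ R := extChartAt_target_subset_range q hxt
  have hsq : φ.symm (φ q) = q := extChartAt_to_inv q
  have hfq := (hf q hq).contMDiffAt (h.isOpen.mem_nhds hq)
  have huR : UniqueDiffOn ℝ R := (𝓡∂ (2 * n)).uniqueDiffOn
  have hf2 : ContDiffWithinAt ℝ 2 f' R (φ q) := by
    exact hfq.contDiffWithinAt_comp_extChartAt_symm
  have hZ2 : ContDiffWithinAt ℝ ∞ Z R (φ q) := by
    exact (h.contMDiffAt hq).contDiffWithinAt_comp_extChartAt_symm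
  have hdf : DifferentiableWithinAt ℝ (fderivWithin ℝ f' R) R (φ q) :=
    (hf2.fderivWithin_right (m := 1) huR (by norm_num) hxR).differentiableWithinAt (by simp)
  have hdZ : DifferentiableWithinAt ℝ (fderivWithin ℝ Z R) R (φ q) :=
    (hZ2.fderivWithin_right (m := 1) huR (by norm_cast) hxR).differentiableWithinAt (by simp)
  have hLinv : L.IsInvertible := h.isInvertible_fderivWithin hxt (by rw [hsq]; exact hq)
  -- the coordinate vector field
  set V : EuclideanSpace ℝ (Fin (2 * n)) → EuclideanSpace ℝ (Fin (2 * n)) :=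
    fun x ↦ (fderivWithin ℝ Z R x).inverse w with hV
  have hVd : DifferentiableWithinAt ℝ V R (φ q) := by
    have h1 : DifferentiableAt ℝ ContinuousLinearMap.inverse L := by
      obtain ⟨e, he⟩ := hLinv
      rw [← he]
      exact (contDiffAt_map_inverse (n := 1) e).differentiableAt (by simp)
    have h2 : DifferentiableWithinAt ℝ (fun x ↦ (fderivWithin ℝ Z R x).inverse) R (φ q) :=
      h1.comp_differentiableWithinAt (φ q) hdZ
    exact h2.clm_apply (differentiableWithinAt_const w)
  have hnhds : ∀ᶠ x in 𝓝[R] (φ q), x ∈ φ.target ∧ φ.symm x ∈ U := by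
    refine Filter.Eventually.and (extChartAt_target_mem_nhdsWithin q) ?_
    have : Tendsto φ.symm (𝓝[R] (φ q)) (𝓝 q) := by
      have := (continuousAt_extChartAt_symm (I := 𝓡∂ (2 * n)) q).tendsto
      rw [extChartAt_to_inv] at this
      exact this.mono_left nhdsWithin_le_nhds
    exact this (h.isOpen.mem_nhds hq)
  have hVZ : (fun x ↦ fderivWithin ℝ Z R x (V x)) =ᶠ[𝓝[R] (φ q)] fun _ ↦ w := by
    filter_upwards [hnhds] with x hx
    obtain ⟨e, he⟩ := h.isInvertible_fderivWithin hx.1 hx.2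
    simp only [hV, hZ]
    rw [← he, ContinuousLinearMap.inverse_equiv]
    exact e.apply_symm_apply _
  have hLL : ∀ y, L (L.inverse y) = y := by
    intro y
    obtain ⟨e, he⟩ := hLinv
    rw [← he, ContinuousLinearMap.inverse_equiv]
    exact e.apply_symm_apply _
  have hLL' : ∀ y, L.inverse (L y) = y := by
    intro y
    obtain ⟨e, he⟩ := hLinv
    rw [← he, ContinuousLinearMap.inverse_equiv]
    exact e.symm_apply_apply _
  -- Differentiate the identity `DZ · V = w`: the derivative of the coordinate field is expressed by
  -- the second derivative of the chart change, as with Christoffel symbols.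
  have hDV : fderivWithin ℝ V R (φ q) (L.inverse v) = - L.inverse
      (fderivWithin ℝ (fderivWithin ℝ Z R) R (φ q) (L.inverse v) (L.inverse w)) := by
    have h1 := hVZ.fderivWithin_eq (𝕜 := ℝ) (hVZ.self_of_nhdsWithin hxR)
    rw [fderivWithin_clm_apply (huR _ hxR) hdZ hVd] at h1
    have h2 := DFunLike.congr_fun h1 (L.inverse v)
    simp only [fderivWithin_fun_const, add_apply,
      ContinuousLinearMap.comp_apply, ContinuousLinearMap.flip_apply] at h2
    rw [← hLL' (fderivWithin ℝ V R (φ q) (L.inverse v)), ← map_neg]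
    congr 1
    exact eq_neg_of_add_eq_zero_left h2
  have hmd : ∀ {g : M → ℝ} {k : WithTop ℕ∞} (_ : ContMDiffOn (𝓡∂ (2 * n)) 𝓘(ℝ, ℝ) k g U)
      (_ : k ≠ 0) {y : M} (_ : y ∈ U), MDifferentiableAt (𝓡∂ (2 * n)) 𝓘(ℝ, ℝ) g y :=
    fun hg hk y hy ↦ ((hg _ hy).contMDiffAt (h.isOpen.mem_nhds hy)).mdifferentiableAt hk
  have hD1 : ContMDiffOn (𝓡∂ (2 * n)) 𝓘(ℝ, ℝ) (1 : ℕ∞) (realDeriv z w f) U :=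
    h.contMDiffOn_realDeriv (m := 2) hf (by norm_num) w
  have key := realDeriv_eq_fderivWithin h (f := realDeriv z w f) hxt (by rw [hsq]; exact hq)
    (hmd hD1 (by simp) (by rw [hsq]; exact hq)) v
  rw [hsq] at key
  have hcongr : (realDeriv z w f) ∘ φ.symm =ᶠ[𝓝[R] (φ q)]
      fun x ↦ fderivWithin ℝ f' R x (V x) := by
    filter_upwards [hnhds] with x hx
    exact realDeriv_eq_fderivWithin h hx.1 hx.2 (hmd hf (by simp) hx.2) w
  unfold realHess
  rw [key, hcongr.fderivWithin_eq (hcongr.self_of_nhdsWithin hxR),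
    fderivWithin_clm_apply (huR _ hxR) hdf hVd]
  simp only [add_apply, ContinuousLinearMap.comp_apply,
    ContinuousLinearMap.flip_apply]
  rw [add_comm, sub_eq_add_neg, ← map_neg]
  congr 2

theorem realHess_comm (h : IsHolomorphicChart J U z) {f : M → ℝ} {q : M}
    (hq : q ∈ U) (hf : ContMDiffOn (𝓡∂ (2 * n)) 𝓘(ℝ, ℝ) 2 f U) (v w : Fin n → ℂ) :
    realHess z f v w q = realHess z f w v q := by
  have hxt := mem_extChartAt_target (I := 𝓡∂ (2 * n)) q
  have hxR := extChartAt_target_subset_range q hxt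
  have hfq := (hf q hq).contMDiffAt (h.isOpen.mem_nhds hq)
  have hf2 : ContDiffWithinAt ℝ 2 (f ∘ (extChartAt (𝓡∂ (2 * n)) q).symm) (range (𝓡∂ (2 * n)))
      (extChartAt (𝓡∂ (2 * n)) q q) := by
    exact hfq.contDiffWithinAt_comp_extChartAt_symm
  have hZ2 : ContDiffWithinAt ℝ 2 (z ∘ (extChartAt (𝓡∂ (2 * n)) q).symm) (range (𝓡∂ (2 * n)))
      (extChartAt (𝓡∂ (2 * n)) q q) := by
    exact ((h.contMDiffAt hq).of_le (m := 2)
      (by norm_cast)).contDiffWithinAt_comp_extChartAt_symm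
  -- The half space is the closure of its interior, so second derivatives are symmetric at boundary
  -- points as well.
  have hcl := (𝓡∂ (2 * n)).range_subset_closure_interior hxR
  rw [realHess_eq_fderivWithin h hq hf, realHess_eq_fderivWithin h hq hf,
    (hf2.isSymmSndFDerivWithinAt (by simp) (𝓡∂ (2 * n)).uniqueDiffOn hcl hxR).eq,
    (hZ2.isSymmSndFDerivWithinAt (by simp) (𝓡∂ (2 * n)).uniqueDiffOn hcl hxR).eq]

end

end Calculus

/-! ### Sum, product and chain rules -/

section Rules

variable {n : ℕ} [NeZero n] {M : Type*} [TopologicalSpace M]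
  [ChartedSpace (EuclideanHalfSpace (2 * n)) M]
  {J : ∀ p : M, TangentSpace (𝓡∂ (2 * n)) p →L[ℝ] TangentSpace (𝓡∂ (2 * n)) p}
  {U : Set M} {z : M → (Fin n → ℂ)} {f g : M → ℝ} {q : M}

theorem IsHolomorphicChart.mdifferentiableAt {F : Type*} [NormedAddCommGroup F] [NormedSpace ℝ F]
    (h : IsHolomorphicChart J U z) {f : M → F} {k : WithTop ℕ∞}
    (hf : ContMDiffOn (𝓡∂ (2 * n)) 𝓘(ℝ, F) k f U) (hk : k ≠ 0) (hq : q ∈ U) :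
    MDifferentiableAt (𝓡∂ (2 * n)) 𝓘(ℝ, F) f q :=
  ((hf _ hq).contMDiffAt (h.isOpen.mem_nhds hq)).mdifferentiableAt hk

theorem realDeriv_comp {φ : ℝ → ℝ} (hφ : DifferentiableAt ℝ φ (f q))
    (hf : MDifferentiableAt (𝓡∂ (2 * n)) 𝓘(ℝ, ℝ) f q) (v : Fin n → ℂ) :
    realDeriv z v (fun x ↦ φ (f x)) q = deriv φ (f q) * realDeriv z v f q := by
  have h := HasMFDerivAt.comp q (hφ.hasFDerivAt.hasMFDerivAt) hf.hasMFDerivAt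
  unfold realDeriv
  rw [show (fun x ↦ φ (f x)) = φ ∘ f from rfl, h.mfderiv]
  have : ∀ t : ℝ, fderiv ℝ φ (f q) t = deriv φ (f q) * t := fun t ↦ by
    rw [← fderiv_apply_one_eq_deriv, mul_comm, ← smul_eq_mul, ← map_smul]; simp
  exact this _

theorem realDeriv_add (hf : MDifferentiableAt (𝓡∂ (2 * n)) 𝓘(ℝ, ℝ) f q)
    (hg : MDifferentiableAt (𝓡∂ (2 * n)) 𝓘(ℝ, ℝ) g q) (v : Fin n → ℂ) :
    realDeriv z v (fun x ↦ f x + g x) q = realDeriv z v f q + realDeriv z v g q := by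
  have h := HasMFDerivAt.add hf.hasMFDerivAt hg.hasMFDerivAt
  unfold realDeriv
  rw [show (fun x ↦ f x + g x) = f + g from rfl, h.mfderiv]
  rfl

theorem realDeriv_mul (hf : MDifferentiableAt (𝓡∂ (2 * n)) 𝓘(ℝ, ℝ) f q)
    (hg : MDifferentiableAt (𝓡∂ (2 * n)) 𝓘(ℝ, ℝ) g q) (v : Fin n → ℂ) :
    realDeriv z v (fun x ↦ f x * g x) q = f q * realDeriv z v g q + g q * realDeriv z v f q := by
  have h := HasMFDerivAt.mul hf.hasMFDerivAt hg.hasMFDerivAt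
  unfold realDeriv
  rw [show (fun x ↦ f x * g x) = f * g from rfl, h.mfderiv]
  rfl

theorem realDeriv_const (c : ℝ) (v : Fin n → ℂ) :
    realDeriv z v (fun _ : M ↦ c) q = 0 := by
  unfold realDeriv
  rw [mfderiv_const]; rfl

theorem realDeriv_const_mul (c : ℝ) (hf : MDifferentiableAt (𝓡∂ (2 * n)) 𝓘(ℝ, ℝ) f q)
    (v : Fin n → ℂ) : realDeriv z v (fun x ↦ c * f x) q = c * realDeriv z v f q := by
  have := realDeriv_comp (z := z) (φ := fun t ↦ c * t) (by fun_prop) hf v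
  rw [this]
  congr 1
  simp

theorem realHess_add_left (z : M → (Fin n → ℂ)) (f : M → ℝ) (v v' w : Fin n → ℂ) (q : M) :
    realHess z f (v + v') w q = realHess z f v w q + realHess z f v' w q :=
  realDeriv_add_vec z q v v' _

theorem realHess_smul_left (z : M → (Fin n → ℂ)) (f : M → ℝ) (c : ℝ) (v w : Fin n → ℂ) (q : M) :
    realHess z f (c • v) w q = c * realHess z f v w q :=
  realDeriv_smul_vec z q c v _

variable [IsManifold (𝓡∂ (2 * n)) ∞ M]

theorem IsHolomorphicChart.mdifferentiableAt_realDeriv (h : IsHolomorphicChart J U z)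
    (hf : ContMDiffOn (𝓡∂ (2 * n)) 𝓘(ℝ, ℝ) 2 f U) (hq : q ∈ U) (v : Fin n → ℂ) :
    MDifferentiableAt (𝓡∂ (2 * n)) 𝓘(ℝ, ℝ) (realDeriv z v f) q :=
  h.mdifferentiableAt (k := (1 : ℕ∞))
    (h.contMDiffOn_realDeriv (m := 2) hf (by norm_num) v) (by simp) hq

theorem realHess_add (h : IsHolomorphicChart J U z)
    (hf : ContMDiffOn (𝓡∂ (2 * n)) 𝓘(ℝ, ℝ) 2 f U)
    (hg : ContMDiffOn (𝓡∂ (2 * n)) 𝓘(ℝ, ℝ) 2 g U) (hq : q ∈ U) (v w : Fin n → ℂ) :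
    realHess z (fun x ↦ f x + g x) v w q = realHess z f v w q + realHess z g v w q := by
  unfold realHess
  have : realDeriv z w (fun x ↦ f x + g x) =ᶠ[𝓝 q]
      fun x ↦ realDeriv z w f x + realDeriv z w g x := by
    filter_upwards [h.isOpen.mem_nhds hq] with x hx
    exact realDeriv_add (h.mdifferentiableAt hf (by simp) hx)
      (h.mdifferentiableAt hg (by simp) hx) w
  rw [realDeriv_congr this, realDeriv_add (h.mdifferentiableAt_realDeriv hf hq w)
    (h.mdifferentiableAt_realDeriv hg hq w)]

theorem realHess_const_mul (h : IsHolomorphicChart J U z) (c : ℝ)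
    (hf : ContMDiffOn (𝓡∂ (2 * n)) 𝓘(ℝ, ℝ) 2 f U) (hq : q ∈ U) (v w : Fin n → ℂ) :
    realHess z (fun x ↦ c * f x) v w q = c * realHess z f v w q := by
  unfold realHess
  have : realDeriv z w (fun x ↦ c * f x) =ᶠ[𝓝 q] fun x ↦ c * realDeriv z w f x := by
    filter_upwards [h.isOpen.mem_nhds hq] with x hx
    exact realDeriv_const_mul c (h.mdifferentiableAt hf (by simp) hx) w
  rw [realDeriv_congr this, realDeriv_const_mul c (h.mdifferentiableAt_realDeriv hf hq w)]

theorem realHess_mul (h : IsHolomorphicChart J U z)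
    (hf : ContMDiffOn (𝓡∂ (2 * n)) 𝓘(ℝ, ℝ) 2 f U)
    (hg : ContMDiffOn (𝓡∂ (2 * n)) 𝓘(ℝ, ℝ) 2 g U) (hq : q ∈ U) (v w : Fin n → ℂ) :
    realHess z (fun x ↦ f x * g x) v w q =
      f q * realHess z g v w q + g q * realHess z f v w q +
      (realDeriv z v f q * realDeriv z w g q + realDeriv z v g q * realDeriv z w f q) := by
  unfold realHess
  have hfd : ∀ {x}, x ∈ U → MDifferentiableAt (𝓡∂ (2 * n)) 𝓘(ℝ, ℝ) f x :=
    fun hx ↦ h.mdifferentiableAt hf (by simp) hx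
  have hgd : ∀ {x}, x ∈ U → MDifferentiableAt (𝓡∂ (2 * n)) 𝓘(ℝ, ℝ) g x :=
    fun hx ↦ h.mdifferentiableAt hg (by simp) hx
  have hf1 := h.mdifferentiableAt_realDeriv hf hq w
  have hg1 := h.mdifferentiableAt_realDeriv hg hq w
  have : realDeriv z w (fun x ↦ f x * g x) =ᶠ[𝓝 q]
      fun x ↦ f x * realDeriv z w g x + g x * realDeriv z w f x := by
    filter_upwards [h.isOpen.mem_nhds hq] with x hx
    exact realDeriv_mul (hfd hx) (hgd hx) w
  rw [realDeriv_congr this, realDeriv_add (f := fun x ↦ f x * realDeriv z w g x)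
    (g := fun x ↦ g x * realDeriv z w f x) ((hfd hq).mul hg1) ((hgd hq).mul hf1),
    realDeriv_mul (hfd hq) hg1, realDeriv_mul (hgd hq) hf1]
  ring

theorem realHess_comp (h : IsHolomorphicChart J U z) {φ : ℝ → ℝ} (hφ : ContDiff ℝ 2 φ)
    (hf : ContMDiffOn (𝓡∂ (2 * n)) 𝓘(ℝ, ℝ) 2 f U) (hq : q ∈ U) (v w : Fin n → ℂ) :
    realHess z (fun x ↦ φ (f x)) v w q = deriv φ (f q) * realHess z f v w q +
      deriv (deriv φ) (f q) * (realDeriv z v f q * realDeriv z w f q) := by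
  unfold realHess
  have hfd : ∀ {x}, x ∈ U → MDifferentiableAt (𝓡∂ (2 * n)) 𝓘(ℝ, ℝ) f x :=
    fun hx ↦ h.mdifferentiableAt hf (by simp) hx
  have hf1 := h.mdifferentiableAt_realDeriv hf hq w
  have hφ' : Differentiable ℝ φ := hφ.differentiable (by simp)
  have hφ'' : Differentiable ℝ (deriv φ) := by
    have : ContDiff ℝ (1 + 1) φ := by norm_num; exact hφ
    exact (contDiff_succ_iff_deriv.1 this).2.2.differentiable (by simp)
  have : realDeriv z w (fun x ↦ φ (f x)) =ᶠ[𝓝 q]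
      fun x ↦ deriv φ (f x) * realDeriv z w f x := by
    filter_upwards [h.isOpen.mem_nhds hq] with x hx
    exact realDeriv_comp (hφ' _) (hfd hx) w
  have h1 : MDifferentiableAt (𝓡∂ (2 * n)) 𝓘(ℝ, ℝ) (fun x ↦ deriv φ (f x)) q :=
    (hφ'' _).mdifferentiableAt.comp q (hfd hq)
  rw [realDeriv_congr this, realDeriv_mul h1 hf1, realDeriv_comp (hφ'' _) (hfd hq)]
  ring

/-- The second derivatives along coordinate vector fields, as a bilinear form. -/
def hessForm (h : IsHolomorphicChart J U z) (hf : ContMDiffOn (𝓡∂ (2 * n)) 𝓘(ℝ, ℝ) 2 f U)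
    (hq : q ∈ U) : LinearMap.BilinForm ℝ (Fin n → ℂ) :=
  LinearMap.mk₂ ℝ (fun v w ↦ realHess z f v w q) (fun v v' w ↦ realHess_add_left z f v v' w q)
    (fun c v w ↦ realHess_smul_left z f c v w q)
    (fun v w w' ↦ by
      simp only [realHess_comm h hq hf v]; exact realHess_add_left z f w w' v q)
    (fun c v w ↦ by
      simp only [realHess_comm h hq hf v]; exact realHess_smul_left z f c w v q)

@[simp] theorem hessForm_apply (h : IsHolomorphicChart J U z)
    (hf : ContMDiffOn (𝓡∂ (2 * n)) 𝓘(ℝ, ℝ) 2 f U) (hq : q ∈ U) (v w : Fin n → ℂ) :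
    hessForm h hf hq v w = realHess z f v w q := rfl

end Rules

/-! ### The Hermitian matrix of a real bilinear form -/

section Levi

variable {n : ℕ}

/-- The sesquilinear form `B(v, w) + B(iv, iw) + i (B(v, iw) - B(iv, w))` of a real bilinear form. -/
def sesqForm (B : LinearMap.BilinForm ℝ (Fin n → ℂ)) :
    (Fin n → ℂ) →ₗ[ℂ] (Fin n → ℂ) →ₛₗ[starRingEnd ℂ] ℂ :=
  LinearMap.mk₂'ₛₗ (RingHom.id ℂ) (starRingEnd ℂ)
    (fun v w ↦ ((B v w + B (Complex.I • v) (Complex.I • w) : ℝ) : ℂ) +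
      Complex.I * ((B v (Complex.I • w) - B (Complex.I • v) w : ℝ) : ℂ))
    (fun v v' w ↦ by simp only [smul_add, map_add, LinearMap.add_apply]; push_cast; ring)
    (fun c v w ↦ by
      have h1 : ∀ v : Fin n → ℂ, c • v = c.re • v + c.im • (Complex.I • v) := fun v ↦ by
        ext j; simp only [Pi.smul_apply, Pi.add_apply, smul_eq_mul, Complex.real_smul]
        nth_rewrite 1 [← Complex.re_add_im c]; ring
      have h2 : Complex.I • c • v = c.re • (Complex.I • v) - c.im • v := by
        ext j; simp only [Pi.smul_apply, Pi.sub_apply, smul_eq_mul, Complex.real_smul]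
        nth_rewrite 1 [← Complex.re_add_im c]
        linear_combination (c.im * v j) * Complex.I_mul_I
      rw [h2, h1 v]
      simp only [map_add, map_sub, map_smul, LinearMap.add_apply, LinearMap.sub_apply,
        LinearMap.smul_apply, smul_eq_mul, RingHom.id_apply]
      push_cast
      linear_combination (-(c.im : ℂ) *
        (B v (Complex.I • w) - B (Complex.I • v) w)) * Complex.I_mul_I +
        (B v w + B (Complex.I • v) (Complex.I • w) +
        Complex.I * (B v (Complex.I • w) - B (Complex.I • v) w)) * Complex.re_add_im c)
    (fun v w w' ↦ by simp only [smul_add, map_add]; push_cast; ring)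
    (fun c v w ↦ by
      have h1 : ∀ v : Fin n → ℂ, c • v = c.re • v + c.im • (Complex.I • v) := fun v ↦ by
        ext j; simp only [Pi.smul_apply, Pi.add_apply, smul_eq_mul, Complex.real_smul]
        nth_rewrite 1 [← Complex.re_add_im c]; ring
      have h2 : Complex.I • c • w = c.re • (Complex.I • w) - c.im • w := by
        ext j; simp only [Pi.smul_apply, Pi.sub_apply, smul_eq_mul, Complex.real_smul]
        nth_rewrite 1 [← Complex.re_add_im c]
        linear_combination (c.im * w j) * Complex.I_mul_I
      have h3 : (starRingEnd ℂ) c = c.re - c.im * Complex.I := by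
        apply Complex.ext <;> simp
      rw [h2, h1 w, h3]
      simp only [map_add, map_sub, map_smul, smul_eq_mul]
      push_cast
      linear_combination ((c.im : ℂ) *
        (B v (Complex.I • w) - B (Complex.I • v) w)) * Complex.I_mul_I)

theorem sesqForm_apply (B : LinearMap.BilinForm ℝ (Fin n → ℂ)) (v w : Fin n → ℂ) :
    sesqForm B v w = ((B v w + B (Complex.I • v) (Complex.I • w) : ℝ) : ℂ) +
      Complex.I * ((B v (Complex.I • w) - B (Complex.I • v) w : ℝ) : ℂ) := rfl

/-- The matrix of the `J`-invariant part of a real bilinear form. -/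
def leviMatrix (B : LinearMap.BilinForm ℝ (Fin n → ℂ)) : Matrix (Fin n) (Fin n) ℂ :=
  Matrix.of fun j k ↦ sesqForm B (Pi.single j 1) (Pi.single k 1) / 4

theorem dotProduct_leviMatrix (B : LinearMap.BilinForm ℝ (Fin n → ℂ)) (v w : Fin n → ℂ) :
    v ⬝ᵥ (leviMatrix B *ᵥ star w) = sesqForm B v w / 4 := by
  have hv : v = ∑ j, v j • Pi.single j (1 : ℂ) := by
    conv_lhs => rw [pi_eq_sum_univ' v]
  have hw : w = ∑ j, w j • Pi.single j (1 : ℂ) := by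
    conv_lhs => rw [pi_eq_sum_univ' w]
  conv_rhs => rw [hv, hw]
  simp only [map_sum, LinearMap.sum_apply, map_smulₛₗ, LinearMap.smul_apply, dotProduct,
    Matrix.mulVec, leviMatrix, Matrix.of_apply, Finset.mul_sum, Finset.sum_div, smul_eq_mul,
    RingHom.id_apply, Pi.star_apply]
  rw [Finset.sum_comm]
  refine Finset.sum_congr rfl fun j _ ↦ Finset.sum_congr rfl fun k _ ↦ ?_
  simp only [Complex.star_def]
  ring

/-- By symmetry the imaginary part cancels on the diagonal, and what remains is an average of `B`
over `v` and `√-1 v`. Positivity of complex Hessians is read off from real second derivatives in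
this way. -/
theorem quadForm_leviMatrix {B : LinearMap.BilinForm ℝ (Fin n → ℂ)} (hB : ∀ v w, B v w = B w v)
    (v : Fin n → ℂ) : v ⬝ᵥ (leviMatrix B *ᵥ star v) =
      (((B v v + B (Complex.I • v) (Complex.I • v)) / 4 : ℝ) : ℂ) := by
  rw [dotProduct_leviMatrix, sesqForm_apply, hB v (Complex.I • v)]
  simp

theorem isHermitian_leviMatrix {B : LinearMap.BilinForm ℝ (Fin n → ℂ)}
    (hB : ∀ v w, B v w = B w v) : (leviMatrix B).IsHermitian := by
  ext j k
  simp only [leviMatrix, Matrix.conjTranspose_apply, Matrix.of_apply, sesqForm_apply]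
  rw [hB (Pi.single k 1), hB (Complex.I • Pi.single k 1), hB (Pi.single k 1),
    hB (Complex.I • Pi.single k 1)]
  simp only [Complex.star_def, map_div₀, map_add, map_mul, Complex.conj_ofReal, Complex.conj_I]
  rw [show (starRingEnd ℂ) 4 = 4 from Complex.conj_ofNat 4]
  push_cast; ring

end Levi

/-! ### Calculus of the squared distance in `ℂⁿ` -/

section SqDist

variable {n : ℕ}

theorem contDiff_sum_normSq (y : Fin n → ℂ) {k : WithTop ℕ∞} :
    ContDiff ℝ k (fun w : Fin n → ℂ ↦ ∑ j, Complex.normSq (w j - y j)) := by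
  have : (fun w : Fin n → ℂ ↦ ∑ j, Complex.normSq (w j - y j)) =
      fun w ↦ ∑ j, ((w j - y j).re ^ 2 + (w j - y j).im ^ 2) := by
    ext w; simp [Complex.normSq_apply, pow_two]
  rw [this]
  refine ContDiff.sum fun j _ ↦ ?_
  have h1 : ContDiff ℝ k fun w : Fin n → ℂ ↦ w j - y j :=
    (contDiff_apply ℝ ℂ j).sub contDiff_const
  exact ((Complex.reCLM.contDiff.comp h1).pow 2).add ((Complex.imCLM.contDiff.comp h1).pow 2)

theorem fderiv_sum_normSq (y w v : Fin n → ℂ) :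
    fderiv ℝ (fun w : Fin n → ℂ ↦ ∑ j, Complex.normSq (w j - y j)) w v =
      ∑ j, 2 * ((w j - y j).re * (v j).re + (w j - y j).im * (v j).im) := by
  have : (fun w : Fin n → ℂ ↦ ∑ j, Complex.normSq (w j - y j)) =
      fun w ↦ ∑ j, ((w j - y j).re ^ 2 + (w j - y j).im ^ 2) := by
    ext w; simp [Complex.normSq_apply, pow_two]
  rw [this]
  have h1 : ∀ j : Fin n, HasFDerivAt (fun w : Fin n → ℂ ↦ w j - y j)
      (ContinuousLinearMap.proj j : (Fin n → ℂ) →L[ℝ] ℂ) w := fun j ↦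
    (hasFDerivAt_apply j w).sub_const _
  have h2 := HasFDerivAt.fun_sum (u := Finset.univ) fun j _ ↦
    ((Complex.reCLM.hasFDerivAt.comp w (h1 j)).pow 2).add
      ((Complex.imCLM.hasFDerivAt.comp w (h1 j)).pow 2)
  have h3 := DFunLike.congr_fun h2.fderiv v
  refine h3.trans ?_
  rw [sum_apply]
  refine Finset.sum_congr rfl fun j _ ↦ ?_
  simp
  ring

end SqDist

/-! ### The complex Hessian and its rules -/

section ComplexHessian

variable {n : ℕ} [NeZero n] {M : Type*} [TopologicalSpace M]
  [ChartedSpace (EuclideanHalfSpace (2 * n)) M]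
  {J : ∀ p : M, TangentSpace (𝓡∂ (2 * n)) p →L[ℝ] TangentSpace (𝓡∂ (2 * n)) p}
  {U : Set M} {z : M → (Fin n → ℂ)} {f g : M → ℝ} {q : M}

/-- The components `∂f/∂zʲ` of a real function `f`. -/
def complexGrad (z : M → (Fin n → ℂ)) (f : M → ℝ) (q : M) : Fin n → ℂ :=
  fun j ↦ (realDeriv z (Pi.single j 1) f q - Complex.I * realDeriv z (Pi.single j Complex.I) f q) / 2

theorem hasMFDerivAt_const_mul_ofReal (c : ℂ)
    (hf : MDifferentiableAt (𝓡∂ (2 * n)) 𝓘(ℝ, ℝ) f q) :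
    HasMFDerivAt (𝓡∂ (2 * n)) 𝓘(ℝ, ℂ) (fun x ↦ c * (f x : ℂ)) q
      ((c • Complex.ofRealCLM).comp (mfderiv (𝓡∂ (2 * n)) 𝓘(ℝ, ℝ) f q : _ →L[ℝ] ℝ)) :=
  HasMFDerivAt.comp (g := (c • Complex.ofRealCLM : ℝ →L[ℝ] ℂ)) q
    (c • Complex.ofRealCLM).hasFDerivAt.hasMFDerivAt hf.hasMFDerivAt

theorem coordDeriv_ofReal (hf : MDifferentiableAt (𝓡∂ (2 * n)) 𝓘(ℝ, ℝ) f q) (v : Fin n → ℂ) :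
    coordDeriv z v (fun x ↦ (f x : ℂ)) q = realDeriv z v f q := by
  have h := hasMFDerivAt_const_mul_ofReal 1 hf
  unfold coordDeriv
  rw [show (fun x ↦ (f x : ℂ)) = fun x ↦ 1 * (f x : ℂ) by simp, h.mfderiv, one_smul]; rfl

theorem coordDeriv_add_mul (c d : ℂ) (hf : MDifferentiableAt (𝓡∂ (2 * n)) 𝓘(ℝ, ℝ) f q)
    (hg : MDifferentiableAt (𝓡∂ (2 * n)) 𝓘(ℝ, ℝ) g q) (v : Fin n → ℂ) :
    coordDeriv z v (fun x ↦ c * (f x : ℂ) + d * (g x : ℂ)) q =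
      c * realDeriv z v f q + d * realDeriv z v g q := by
  have h := (hasMFDerivAt_const_mul_ofReal c hf).add (hasMFDerivAt_const_mul_ofReal d hg)
  unfold coordDeriv
  rw [show (fun x ↦ c * (f x : ℂ) + d * (g x : ℂ)) =
    (fun x ↦ c * (f x : ℂ)) + (fun x ↦ d * (g x : ℂ)) from rfl, h.mfderiv]
  rfl

theorem coordDeriv_congr {F G : M → ℂ} (h : F =ᶠ[𝓝 q] G) (v : Fin n → ℂ) :
    coordDeriv z v F q = coordDeriv z v G q := by
  unfold coordDeriv; rw [h.mfderiv_eq]; rfl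

/-- `|z - y|²`. -/
def sqDist (z : M → (Fin n → ℂ)) (y : Fin n → ℂ) (x : M) : ℝ := ∑ j, Complex.normSq (z x j - y j)

theorem IsHolomorphicChart.contMDiffOn_comp {F : Type*} [NormedAddCommGroup F] [NormedSpace ℝ F]
    (h : IsHolomorphicChart J U z) {Φ : (Fin n → ℂ) → F} {k : ℕ∞} (hΦ : ContDiff ℝ k Φ) :
    ContMDiffOn (𝓡∂ (2 * n)) 𝓘(ℝ, F) k (fun x ↦ Φ (z x)) U :=
  hΦ.contMDiff.comp_contMDiffOn (h.contMDiffOn.of_le (by exact_mod_cast le_top))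

theorem realDeriv_comp_coord (h : IsHolomorphicChart J U z) (hq : q ∈ U)
    {Φ : (Fin n → ℂ) → ℝ} (hΦ : DifferentiableAt ℝ Φ (z q)) (v : Fin n → ℂ) :
    realDeriv z v (fun x ↦ Φ (z x)) q = fderiv ℝ Φ (z q) v := by
  have h1 := HasMFDerivAt.comp q hΦ.hasFDerivAt.hasMFDerivAt
    (((h.contMDiffAt hq).mdifferentiableAt (by simp)).hasMFDerivAt)
  unfold realDeriv
  rw [show (fun x ↦ Φ (z x)) = Φ ∘ z from rfl, h1.mfderiv]
  exact congrArg (fderiv ℝ Φ (z q)) (h.mfderiv_coordVec hq v)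

theorem IsHolomorphicChart.contMDiffOn_sqDist (h : IsHolomorphicChart J U z) (y : Fin n → ℂ)
    {k : ℕ∞} : ContMDiffOn (𝓡∂ (2 * n)) 𝓘(ℝ, ℝ) k (sqDist z y) U :=
  h.contMDiffOn_comp (contDiff_sum_normSq y)

theorem realDeriv_sqDist (h : IsHolomorphicChart J U z) (hq : q ∈ U) (y v : Fin n → ℂ) :
    realDeriv z v (sqDist z y) q =
      ∑ j, 2 * ((z q j - y j).re * (v j).re + (z q j - y j).im * (v j).im) := by
  rw [← fderiv_sum_normSq]
  exact realDeriv_comp_coord h hq ((contDiff_sum_normSq y (k := 1)).differentiable (by simp) _) v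

theorem realHess_sqDist (h : IsHolomorphicChart J U z) (hq : q ∈ U) (y v w : Fin n → ℂ) :
    realHess z (sqDist z y) v w q =
      ∑ j, 2 * ((v j).re * (w j).re + (v j).im * (w j).im) := by
  unfold realHess
  set Ψ : (Fin n → ℂ) →L[ℝ] ℝ := ∑ j, (2 * (w j).re) •
    (Complex.reCLM.comp (ContinuousLinearMap.proj j : (Fin n → ℂ) →L[ℝ] ℂ)) +
    ∑ j, (2 * (w j).im) •
    (Complex.imCLM.comp (ContinuousLinearMap.proj j : (Fin n → ℂ) →L[ℝ] ℂ)) with hΨ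
  have hΨa : ∀ x, Ψ x = ∑ j, 2 * ((x j).re * (w j).re + (x j).im * (w j).im) := by
    intro x
    simp only [hΨ, add_apply, sum_apply, ← Finset.sum_add_distrib]
    refine Finset.sum_congr rfl fun j _ ↦ ?_
    simp; ring
  have h1 : realDeriv z w (sqDist z y) =ᶠ[𝓝 q] fun x ↦ (fun u ↦ Ψ (u - y)) (z x) := by
    filter_upwards [h.isOpen.mem_nhds hq] with x hx
    rw [realDeriv_sqDist h hx]
    exact (hΨa _).symm
  have h2 : HasFDerivAt (fun u ↦ Ψ (u - y)) Ψ (z q) :=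
    Ψ.hasFDerivAt.comp (z q) ((hasFDerivAt_id _).sub_const y)
  rw [realDeriv_congr h1, realDeriv_comp_coord h hq h2.differentiableAt, h2.fderiv, hΨa]

theorem complexGrad_sqDist (h : IsHolomorphicChart J U z) (hq : q ∈ U) (y : Fin n → ℂ) :
    complexGrad z (sqDist z y) q = star (z q - y) := by
  ext j
  simp only [complexGrad, realDeriv_sqDist h hq, Pi.single_apply, apply_ite Complex.re,
    apply_ite Complex.im]
  simp
  apply Complex.ext <;> simp <;> ring

variable [IsManifold (𝓡∂ (2 * n)) ∞ M]

/-- Replaces iterated Wirtinger derivatives by real second derivatives, for which symmetry and the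
formula in a real chart are available. -/
theorem complexHessian_eq_leviMatrix (h : IsHolomorphicChart J U z)
    (hf : ContMDiffOn (𝓡∂ (2 * n)) 𝓘(ℝ, ℝ) 2 f U) (hq : q ∈ U) :
    complexHessian z f q = leviMatrix (hessForm h hf hq) := by
  ext j k
  have hI : ∀ k : Fin n, (Complex.I • Pi.single k (1 : ℂ) : Fin n → ℂ) = Pi.single k Complex.I :=
    fun k ↦ by rw [← Pi.single_smul]; simp
  have h1 : delBar z k (fun x ↦ (f x : ℂ)) =ᶠ[𝓝 q] fun x ↦
      (1 / 2 : ℂ) * (realDeriv z (Pi.single k 1) f x : ℂ) +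
      (Complex.I / 2) * (realDeriv z (Pi.single k Complex.I) f x : ℂ) := by
    filter_upwards [h.isOpen.mem_nhds hq] with x hx
    have hfx := h.mdifferentiableAt hf (by simp) hx
    simp only [delBar, coordDeriv_ofReal hfx]
    ring
  have h2 := h.mdifferentiableAt_realDeriv hf hq
  simp only [complexHessian, leviMatrix, sesqForm_apply, Matrix.of_apply, del, hI, hessForm_apply,
    coordDeriv_congr h1, coordDeriv_add_mul _ _ (h2 _) (h2 _), realHess]
  push_cast
  linear_combination (-(1 / 4 : ℂ) *
    (realDeriv z (Pi.single j Complex.I) (realDeriv z (Pi.single k Complex.I) f) q : ℂ)) *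
      Complex.I_mul_I

theorem complexHessian_apply (h : IsHolomorphicChart J U z)
    (hf : ContMDiffOn (𝓡∂ (2 * n)) 𝓘(ℝ, ℝ) 2 f U) (hq : q ∈ U) (j k : Fin n) :
    complexHessian z f q j k =
      (((realHess z f (Pi.single j 1) (Pi.single k 1) q +
        realHess z f (Pi.single j Complex.I) (Pi.single k Complex.I) q : ℝ) : ℂ) +
      Complex.I * ((realHess z f (Pi.single j 1) (Pi.single k Complex.I) q -
        realHess z f (Pi.single j Complex.I) (Pi.single k 1) q : ℝ) : ℂ)) / 4 := by
  have hI : ∀ k : Fin n, (Complex.I • Pi.single k (1 : ℂ) : Fin n → ℂ) = Pi.single k Complex.I :=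
    fun k ↦ by rw [← Pi.single_smul]; simp
  rw [complexHessian_eq_leviMatrix h hf hq]
  simp only [leviMatrix, sesqForm_apply, Matrix.of_apply, hI, hessForm_apply]

theorem isHermitian_complexHessian (h : IsHolomorphicChart J U z)
    (hf : ContMDiffOn (𝓡∂ (2 * n)) 𝓘(ℝ, ℝ) 2 f U) (hq : q ∈ U) :
    (complexHessian z f q).IsHermitian := by
  rw [complexHessian_eq_leviMatrix h hf hq]
  exact isHermitian_leviMatrix fun v w ↦ realHess_comm h hq hf v w

theorem quadForm_complexHessian (h : IsHolomorphicChart J U z)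
    (hf : ContMDiffOn (𝓡∂ (2 * n)) 𝓘(ℝ, ℝ) 2 f U) (hq : q ∈ U) (v : Fin n → ℂ) :
    v ⬝ᵥ (complexHessian z f q *ᵥ star v) =
      (((realHess z f v v q + realHess z f (Complex.I • v) (Complex.I • v) q) / 4 : ℝ) : ℂ) := by
  rw [complexHessian_eq_leviMatrix h hf hq]
  exact quadForm_leviMatrix (fun v w ↦ realHess_comm h hq hf v w) v

theorem complexHessian_add (h : IsHolomorphicChart J U z)
    (hf : ContMDiffOn (𝓡∂ (2 * n)) 𝓘(ℝ, ℝ) 2 f U)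
    (hg : ContMDiffOn (𝓡∂ (2 * n)) 𝓘(ℝ, ℝ) 2 g U) (hq : q ∈ U) :
    complexHessian z (fun x ↦ f x + g x) q = complexHessian z f q + complexHessian z g q := by
  ext j k
  have hfg : ContMDiffOn (𝓡∂ (2 * n)) 𝓘(ℝ, ℝ) 2 (fun x ↦ f x + g x) U := hf.add hg
  rw [Matrix.add_apply, complexHessian_apply h hf hq, complexHessian_apply h hg hq,
    complexHessian_apply h hfg hq]
  simp only [realHess_add h hf hg hq]
  push_cast; ring

theorem complexHessian_const_mul (h : IsHolomorphicChart J U z) (c : ℝ)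
    (hf : ContMDiffOn (𝓡∂ (2 * n)) 𝓘(ℝ, ℝ) 2 f U) (hq : q ∈ U) :
    complexHessian z (fun x ↦ c * f x) q = (c : ℂ) • complexHessian z f q := by
  ext j k
  have hcf : ContMDiffOn (𝓡∂ (2 * n)) 𝓘(ℝ, ℝ) 2 (fun x ↦ c * f x) U := contMDiffOn_const.mul hf
  rw [Matrix.smul_apply, complexHessian_apply h hf hq, complexHessian_apply h hcf hq]
  simp only [realHess_const_mul h c hf hq, smul_eq_mul]
  push_cast; ring

theorem complexHessian_sub (h : IsHolomorphicChart J U z)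
    (hf : ContMDiffOn (𝓡∂ (2 * n)) 𝓘(ℝ, ℝ) 2 f U)
    (hg : ContMDiffOn (𝓡∂ (2 * n)) 𝓘(ℝ, ℝ) 2 g U) (hq : q ∈ U) :
    complexHessian z (fun x ↦ f x - g x) q = complexHessian z f q - complexHessian z g q := by
  have : (fun x ↦ f x - g x) = fun x ↦ f x + (-1) * g x := by ext x; ring
  have hcg : ContMDiffOn (𝓡∂ (2 * n)) 𝓘(ℝ, ℝ) 2 (fun x ↦ (-1) * g x) U := contMDiffOn_const.mul hg
  rw [this, complexHessian_add h hf hcg hq,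
    complexHessian_const_mul h (-1) hg hq, sub_eq_add_neg]
  simp

theorem complexHessian_mul (h : IsHolomorphicChart J U z)
    (hf : ContMDiffOn (𝓡∂ (2 * n)) 𝓘(ℝ, ℝ) 2 f U)
    (hg : ContMDiffOn (𝓡∂ (2 * n)) 𝓘(ℝ, ℝ) 2 g U) (hq : q ∈ U) :
    complexHessian z (fun x ↦ f x * g x) q =
      (f q : ℂ) • complexHessian z g q + (g q : ℂ) • complexHessian z f q +
      (Matrix.vecMulVec (complexGrad z f q) (star (complexGrad z g q)) +
        Matrix.vecMulVec (complexGrad z g q) (star (complexGrad z f q))) := by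
  ext j k
  have hs : (starRingEnd ℂ) 2 = 2 := Complex.conj_ofNat 2
  have hfg : ContMDiffOn (𝓡∂ (2 * n)) 𝓘(ℝ, ℝ) 2 (fun x ↦ f x * g x) U := hf.mul hg
  simp only [Matrix.add_apply, Matrix.smul_apply, complexHessian_apply h hf hq,
    complexHessian_apply h hg hq, complexHessian_apply h hfg hq,
    realHess_mul h hf hg hq, smul_eq_mul, Matrix.vecMulVec_apply, complexGrad, Pi.star_apply,
    Complex.star_def, map_div₀, map_sub, map_mul, Complex.conj_ofReal, Complex.conj_I, hs]
  push_cast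
  linear_combination ((1 / 4 : ℂ) * (realDeriv z (Pi.single j Complex.I) f q *
    realDeriv z (Pi.single k Complex.I) g q + realDeriv z (Pi.single j Complex.I) g q *
    realDeriv z (Pi.single k Complex.I) f q)) * Complex.I_mul_I

theorem complexHessian_comp (h : IsHolomorphicChart J U z) {φ : ℝ → ℝ} (hφ : ContDiff ℝ 2 φ)
    (hf : ContMDiffOn (𝓡∂ (2 * n)) 𝓘(ℝ, ℝ) 2 f U) (hq : q ∈ U) :
    complexHessian z (fun x ↦ φ (f x)) q =
      ((deriv φ (f q) : ℝ) : ℂ) • complexHessian z f q + ((deriv (deriv φ) (f q) : ℝ) : ℂ) •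
        Matrix.vecMulVec (complexGrad z f q) (star (complexGrad z f q)) := by
  ext j k
  have hs : (starRingEnd ℂ) 2 = 2 := Complex.conj_ofNat 2
  have hφf : ContMDiffOn (𝓡∂ (2 * n)) 𝓘(ℝ, ℝ) 2 (fun x ↦ φ (f x)) U :=
    hφ.contMDiff.comp_contMDiffOn hf
  simp only [Matrix.add_apply, Matrix.smul_apply, complexHessian_apply h hf hq,
    complexHessian_apply h hφf hq,
    realHess_comp h hφ hf hq, smul_eq_mul, Matrix.vecMulVec_apply, complexGrad, Pi.star_apply,
    Complex.star_def, map_div₀, map_sub, map_mul, Complex.conj_ofReal, Complex.conj_I, hs]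
  push_cast
  linear_combination ((1 / 4 : ℂ) * (deriv (deriv φ) (f q) : ℝ) *
    (realDeriv z (Pi.single j Complex.I) f q *
    realDeriv z (Pi.single k Complex.I) f q)) * Complex.I_mul_I

theorem complexHessian_sqDist (h : IsHolomorphicChart J U z) (hq : q ∈ U) (y : Fin n → ℂ) :
    complexHessian z (sqDist z y) q = 1 := by
  ext j k
  rw [complexHessian_apply h (h.contMDiffOn_sqDist y) hq]
  simp only [realHess_sqDist h hq]
  rcases eq_or_ne j k with rfl | hjk
  · simp [Pi.single_apply, apply_ite]
    norm_num
  · simp [Pi.single_apply, apply_ite, hjk, hjk.symm]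

end ComplexHessian

open scoped ComplexOrder

/-! ### Interior minima, and functions vanishing on the boundary -/

section Boundary

variable {n : ℕ} [NeZero n] {M : Type*} [TopologicalSpace M]
  [ChartedSpace (EuclideanHalfSpace (2 * n)) M]
  {J : ∀ p : M, TangentSpace (𝓡∂ (2 * n)) p →L[ℝ] TangentSpace (𝓡∂ (2 * n)) p}
  {U : Set M} {z : M → (Fin n → ℂ)} {f g : M → ℝ} {q : M}

theorem IsHolomorphicChart.mfderiv_eq_fderivWithin (h : IsHolomorphicChart J U z) (hq : q ∈ U) :
    mfderiv (𝓡∂ (2 * n)) 𝓘(ℝ, Fin n → ℂ) z q =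
      fderivWithin ℝ (z ∘ (extChartAt (𝓡∂ (2 * n)) q).symm) (range (𝓡∂ (2 * n)))
        (extChartAt (𝓡∂ (2 * n)) q q) :=
   ((h.contMDiffAt hq).mdifferentiableAt (by simp)).mfderiv

theorem realDeriv_eq_fderivWithin_self (h : IsHolomorphicChart J U z) (hq : q ∈ U)
    (hf : MDifferentiableAt (𝓡∂ (2 * n)) 𝓘(ℝ, ℝ) f q) (v : Fin n → ℂ) :
    realDeriv z v f q =
      fderivWithin ℝ (f ∘ (extChartAt (𝓡∂ (2 * n)) q).symm) (range (𝓡∂ (2 * n)))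
        (extChartAt (𝓡∂ (2 * n)) q q)
        ((fderivWithin ℝ (z ∘ (extChartAt (𝓡∂ (2 * n)) q).symm) (range (𝓡∂ (2 * n)))
        (extChartAt (𝓡∂ (2 * n)) q q)).inverse v) := by
  unfold realDeriv coordVec
  rw [h.mfderiv_eq_fderivWithin hq, hf.mfderiv]
  rfl

theorem zero_le_extChartAt (p q : M) : 0 ≤ extChartAt (𝓡∂ (2 * n)) p q 0 := by
  have : extChartAt (𝓡∂ (2 * n)) p q ∈ range (𝓡∂ (2 * n)) := by
    simp [extChartAt, OpenPartialHomeomorph.extend]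
  rw [range_modelWithCornersEuclideanHalfSpace] at this
  exact this

theorem tendsto_extChartAt_symm_slice (q : M) (e : EuclideanSpace ℝ (Fin (2 * n))) :
    Tendsto (fun t : ℝ ↦ (extChartAt (𝓡∂ (2 * n)) q).symm (extChartAt (𝓡∂ (2 * n)) q q + t • e))
      (𝓝 0) (𝓝 q) := by
  have h1 := (continuousAt_extChartAt_symm (I := 𝓡∂ (2 * n)) q).tendsto
  rw [extChartAt_to_inv] at h1
  refine h1.comp ?_
  have : Continuous fun t : ℝ ↦ extChartAt (𝓡∂ (2 * n)) q q + t • e := by fun_prop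
  simpa using this.tendsto 0

variable [IsManifold (𝓡∂ (2 * n)) ∞ M]

theorem isBoundaryTangent_coordVec_iff (h : IsHolomorphicChart J U z) (hq : q ∈ U)
    (v : Fin n → ℂ) : IsBoundaryTangent q (coordVec z q v) ↔
      (fderivWithin ℝ (z ∘ (extChartAt (𝓡∂ (2 * n)) q).symm) (range (𝓡∂ (2 * n)))
        (extChartAt (𝓡∂ (2 * n)) q q)).inverse v 0 = 0 := by
  have : IsManifold (𝓡∂ (2 * n)) 1 M := IsManifold.of_le (n := ∞) (by simp)
  unfold IsBoundaryTangent coordVec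
  rw [h.mfderiv_eq_fderivWithin hq, mfderiv_extChartAt_self]
  rfl

theorem isInteriorPoint_iff_extChartAt {p : M}
    (hq : q ∈ (extChartAt (𝓡∂ (2 * n)) p).source) :
    (𝓡∂ (2 * n)).IsInteriorPoint q ↔ 0 < extChartAt (𝓡∂ (2 * n)) p q 0 := by
  have hq' : q ∈ (chartAt (EuclideanHalfSpace (2 * n)) p).source := by simpa using hq
  rw [(𝓡∂ (2 * n)).isInteriorPoint_iff_of_mem_atlas (n := ∞) (by simp) (chart_mem_atlas _ p) hq']
  have h2 := interior_range_modelWithCornersEuclideanHalfSpace (2 * n)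
  change extChartAt (𝓡∂ (2 * n)) p q ∈ interior (extChartAt (𝓡∂ (2 * n)) p).target ↔ _
  constructor
  · intro h
    have h3 := interior_mono (extChartAt_target_subset_range p) h
    rw [h2] at h3
    exact h3
  · intro h
    have : extChartAt (𝓡∂ (2 * n)) p q ∈ interior (range (𝓡∂ (2 * n))) := by
      rw [h2]; exact h
    exact (chartAt (EuclideanHalfSpace (2 * n)) p).mem_interior_extend_target
      ((chartAt (EuclideanHalfSpace (2 * n)) p).map_source hq') this

theorem mem_boundary_iff_extChartAt {p : M}
    (hq : q ∈ (extChartAt (𝓡∂ (2 * n)) p).source) :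
    q ∈ (𝓡∂ (2 * n)).boundary M ↔ extChartAt (𝓡∂ (2 * n)) p q 0 = 0 := by
  rw [← (𝓡∂ (2 * n)).compl_interior, mem_compl_iff]
  change ¬ (𝓡∂ (2 * n)).IsInteriorPoint q ↔ _
  rw [isInteriorPoint_iff_extChartAt hq]
  have := zero_le_extChartAt (n := n) p q
  constructor
  · intro h; linarith
  · intro h; linarith

/-- At an interior local minimum the complex Hessian is nonnegative. -/
theorem posSemidef_complexHessian_of_isLocalMin (h : IsHolomorphicChart J U z)
    (hf : ContMDiffOn (𝓡∂ (2 * n)) 𝓘(ℝ, ℝ) 2 f U) (hq : q ∈ U)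
    (hqi : (𝓡∂ (2 * n)).IsInteriorPoint q) (hmin : IsLocalMin f q) :
    (complexHessian z f q).PosSemidef := by
  have hR : range (𝓡∂ (2 * n)) ∈ 𝓝 (extChartAt (𝓡∂ (2 * n)) q q) :=
    mem_interior_iff_mem_nhds.1 (ModelWithCorners.isInteriorPoint_iff.1 hqi |>
      interior_mono (extChartAt_target_subset_range q))
  set φ := extChartAt (𝓡∂ (2 * n)) q with hφ
  have hsq : φ.symm (φ q) = q := extChartAt_to_inv q
  have hfq := (hf q hq).contMDiffAt (h.isOpen.mem_nhds hq)
  have hf2 : ContDiffWithinAt ℝ 2 (f ∘ φ.symm) (range (𝓡∂ (2 * n))) (φ q) :=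
    hfq.contDiffWithinAt_comp_extChartAt_symm
  have hmin' : IsLocalMin (f ∘ φ.symm) (φ q) := by
    have h1 := (continuousAt_extChartAt_symm (I := 𝓡∂ (2 * n)) q).tendsto
    rw [extChartAt_to_inv] at h1
    have := h1.eventually hmin
    change ∀ᶠ x in 𝓝 (φ q), f (φ.symm (φ q)) ≤ f (φ.symm x)
    rw [hsq]
    exact this
  have hd : fderivWithin ℝ (f ∘ φ.symm) (range (𝓡∂ (2 * n))) (φ q) = 0 := by
    rw [fderivWithin_of_mem_nhds hR]
    exact hmin'.fderiv_eq_zero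
  -- The differential is zero at the minimum, so the first order term of the chart formula drops
  -- out.
  have key : ∀ v, 0 ≤ realHess z f v v q := by
    intro v
    rw [realHess_eq_fderivWithin h hq hf]
    simp only [← hφ, hd, zero_apply, sub_zero]
    refine snd_fderivWithin_nonneg_of_isMin (𝓡∂ (2 * n)).uniqueDiffOn hf2 ?_ ?_
    all_goals
      set e := (fderivWithin ℝ (z ∘ φ.symm) (range (𝓡∂ (2 * n))) (φ q)).inverse v
      have hc : Tendsto (fun t : ℝ ↦ φ q + t • e) (𝓝 0) (𝓝 (φ q)) := by
        have : Continuous fun t : ℝ ↦ φ q + t • e := by fun_prop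
        simpa using this.tendsto 0
    · exact hc hR
    · exact hc.eventually hmin'
  refine Matrix.PosSemidef.of_dotProduct_mulVec_nonneg (isHermitian_complexHessian h hf hq)
    fun x ↦ ?_
  have := quadForm_complexHessian h hf hq (star x)
  rw [star_star] at this
  rw [this, Complex.zero_le_real]
  have h1 := key (star x)
  have h2 := key (Complex.I • star x)
  positivity

/-- A function vanishing on the boundary has zero tangential derivatives there; if its
differential is zero, then so are its second tangential derivatives. -/
theorem realDeriv_eq_zero_of_boundary (h : IsHolomorphicChart J U z)
    (hf : ContMDiffOn (𝓡∂ (2 * n)) 𝓘(ℝ, ℝ) 2 f U) (hq : q ∈ U)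
    (hqb : q ∈ (𝓡∂ (2 * n)).boundary M)
    (hf0 : ∀ᶠ x in 𝓝 q, x ∈ (𝓡∂ (2 * n)).boundary M → f x = 0) {v : Fin n → ℂ}
    (hv : IsBoundaryTangent q (coordVec z q v)) :
    realDeriv z v f q = 0 ∧ ((∀ w, realDeriv z w f q = 0) → realHess z f v v q = 0) := by
  rw [isBoundaryTangent_coordVec_iff h hq] at hv
  rw [realDeriv_eq_fderivWithin_self h hq (h.mdifferentiableAt hf (by simp) hq),
    realHess_eq_fderivWithin h hq hf]
  set φ := extChartAt (𝓡∂ (2 * n)) q with hφ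
  set L := fderivWithin ℝ (z ∘ φ.symm) (range (𝓡∂ (2 * n))) (φ q) with hL
  have hfq := (hf q hq).contMDiffAt (h.isOpen.mem_nhds hq)
  have hx0 : φ q 0 = 0 := (mem_boundary_iff_extChartAt (mem_extChartAt_source q)).1 hqb
  -- Both `φ q` and the direction have zero coordinate of index `0`, so the whole line lies in the
  -- boundary hyperplane, on which `f` vanishes near `q`.
  have hRt : ∀ t : ℝ, φ q + t • L.inverse v ∈ range (𝓡∂ (2 * n)) := by
    intro t
    rw [range_modelWithCornersEuclideanHalfSpace]
    simp [hx0, hv]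
  have ht : ∀ᶠ t : ℝ in 𝓝 0, φ q + t • L.inverse v ∈ φ.target := by
    have hc : Tendsto (fun t : ℝ ↦ φ q + t • L.inverse v) (𝓝 0)
        (𝓝[range (𝓡∂ (2 * n))] (φ q)) := by
      refine tendsto_nhdsWithin_iff.2 ⟨?_, Eventually.of_forall hRt⟩
      have : Continuous fun t : ℝ ↦ φ q + t • L.inverse v := by fun_prop
      simpa using this.tendsto 0
    exact hc (extChartAt_target_mem_nhdsWithin q)
  have h0 : ∀ᶠ t : ℝ in 𝓝 0, (f ∘ φ.symm) (φ q + t • L.inverse v) = 0 := by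
    filter_upwards [ht, (tendsto_extChartAt_symm_slice q (L.inverse v)).eventually hf0] with t h1 h2
    apply h2
    rw [mem_boundary_iff_extChartAt (φ.map_target h1), ← hφ, φ.right_inv h1]
    simp [hx0, hv]
  obtain ⟨h1, h2⟩ := snd_fderivWithin_eq_zero_of_slice (𝓡∂ (2 * n)).uniqueDiffOn
    hfq.contDiffWithinAt_comp_extChartAt_symm (Eventually.of_forall hRt) h0
  refine ⟨h1, fun hd ↦ ?_⟩
  rw [h2, zero_sub, neg_eq_zero]
  have h3 := hd (fderivWithin ℝ (fderivWithin ℝ (z ∘ φ.symm) (range (𝓡∂ (2 * n))))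
    (range (𝓡∂ (2 * n))) (φ q) (L.inverse v) (L.inverse v))
  rw [realDeriv_eq_fderivWithin_self h hq (h.mdifferentiableAt hf (by simp) hq)] at h3
  exact h3

end Boundary

/-- Polarisation: the values at `e_j + e_k` and `e_j + √-1 e_k` determine the entries, without
assuming the matrices Hermitian. -/
theorem Matrix.ext_of_quadForm {n : ℕ} {F G : Matrix (Fin n) (Fin n) ℂ}
    (hFG : ∀ v : Fin n → ℂ, v ⬝ᵥ (F *ᵥ star v) = v ⬝ᵥ (G *ᵥ star v)) : F = G := by
  have h1 : ∀ (j k : Fin n) (c : ℂ) (F : Matrix (Fin n) (Fin n) ℂ),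
      (Pi.single j 1 + c • Pi.single k 1 : Fin n → ℂ) ⬝ᵥ
        (F *ᵥ star (Pi.single j 1 + c • Pi.single k 1 : Fin n → ℂ)) =
      F j j + star c * F j k + c * F k j + c * star c * F k k := by
    intro j k c F
    have : ∀ i : Fin n, star (Pi.single i (1 : ℂ) : Fin n → ℂ) = Pi.single i 1 := fun i ↦ by
      rw [← Pi.single_star, star_one]
    simp only [star_add, star_smul, this, Matrix.mulVec_add, Matrix.mulVec_smul, dotProduct_add,
      add_dotProduct, smul_dotProduct, dotProduct_smul, Matrix.mulVec_single_one,
      single_one_dotProduct, Matrix.col_apply, smul_eq_mul]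
    ring
  ext j k
  have hd : ∀ i, F i i = G i i := fun i ↦ by
    have := h1 i i 0 F
    have h2 := h1 i i 0 G
    rw [hFG, h2] at this
    simpa using this.symm
  have h2 := h1 j k 1 F
  have h3 := h1 j k Complex.I F
  rw [hFG, h1 j k] at h2 h3
  simp only [hd, star_one, Complex.star_def, Complex.conj_I] at h2 h3
  linear_combination (-1 / 2 : ℂ) * h2 - (Complex.I / 2) * h3 + 
    (1 / 2 * (F j k - G j k) - 1 / 2 * (F k j - G k j)) * Complex.I_mul_I

/-! ### Change of holomorphic coordinates -/

section ChangeOfChart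

variable {n : ℕ} [NeZero n] {M : Type*} [TopologicalSpace M]
  [ChartedSpace (EuclideanHalfSpace (2 * n)) M]
  {J : ∀ p : M, TangentSpace (𝓡∂ (2 * n)) p →L[ℝ] TangentSpace (𝓡∂ (2 * n)) p}
  {U U₀ : Set M} {z z₀ : M → (Fin n → ℂ)} {f g : M → ℝ} {q : M}

/-- The differential of a coordinate change, applied to a coordinate vector. -/
def coordChange (z₀ z : M → (Fin n → ℂ)) (q : M) (v : Fin n → ℂ) : Fin n → ℂ :=
  mfderiv (𝓡∂ (2 * n)) 𝓘(ℝ, Fin n → ℂ) z q (coordVec z₀ q v)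

theorem coordVec_coordChange (h : IsHolomorphicChart J U z) (hq : q ∈ U) (v : Fin n → ℂ) :
    coordVec z q (coordChange z₀ z q v) = coordVec z₀ q v :=
  h.coordVec_mfderiv hq _

theorem coordChange_coordChange (h : IsHolomorphicChart J U z) (hq : q ∈ U)
    (h₀ : IsHolomorphicChart J U₀ z₀) (hq₀ : q ∈ U₀) (v : Fin n → ℂ) :
    coordChange z₀ z q (coordChange z z₀ q v) = v := by
  rw [coordChange, coordVec_coordChange h₀ hq₀]
  exact h.mfderiv_coordVec hq v

theorem coordChange_add (v w : Fin n → ℂ) :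
    coordChange z₀ z q (v + w) = coordChange z₀ z q v + coordChange z₀ z q w := by
  unfold coordChange
  rw [coordVec_add]
  exact map_add _ _ _

theorem coordChange_I (h : IsHolomorphicChart J U z) (hq : q ∈ U)
    (h₀ : IsHolomorphicChart J U₀ z₀) (hq₀ : q ∈ U₀) (v : Fin n → ℂ) :
    coordChange z₀ z q (Complex.I • v) = Complex.I • coordChange z₀ z q v := by
  unfold coordChange
  rw [h₀.coordVec_I hq₀]
  exact h.map_J q hq _

theorem coordChange_smul (h : IsHolomorphicChart J U z) (hq : q ∈ U)
    (h₀ : IsHolomorphicChart J U₀ z₀) (hq₀ : q ∈ U₀) (c : ℂ) (v : Fin n → ℂ) :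
    coordChange z₀ z q (c • v) = c • coordChange z₀ z q v := by
  have hr : ∀ (a : ℝ) (v : Fin n → ℂ), coordChange z₀ z q (a • v) = a • coordChange z₀ z q v := by
    intro a v
    unfold coordChange
    rw [coordVec_smul]
    exact map_smul _ _ _
  have h1 : ∀ v : Fin n → ℂ, c • v = c.re • v + c.im • (Complex.I • v) := fun v ↦ by
    ext j; simp only [Pi.smul_apply, Pi.add_apply, smul_eq_mul, Complex.real_smul]
    nth_rewrite 1 [← Complex.re_add_im c]; ring
  rw [h1, coordChange_add, hr, hr, coordChange_I h hq h₀ hq₀, ← h1]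

/-- The complex Jacobian matrix, transposed, of a coordinate change. -/
def jacobianT (z₀ z : M → (Fin n → ℂ)) (q : M) : Matrix (Fin n) (Fin n) ℂ :=
  Matrix.of fun j ↦ coordChange z₀ z q (Pi.single j 1)

theorem vecMul_jacobianT (h : IsHolomorphicChart J U z) (hq : q ∈ U)
    (h₀ : IsHolomorphicChart J U₀ z₀) (hq₀ : q ∈ U₀) (v : Fin n → ℂ) :
    v ᵥ* jacobianT z₀ z q = coordChange z₀ z q v := by
  let A : (Fin n → ℂ) →ₗ[ℂ] (Fin n → ℂ) :=
    { toFun := coordChange z₀ z q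
      map_add' := coordChange_add
      map_smul' := coordChange_smul h hq h₀ hq₀ }
  have : A v = ∑ j, v j • A (Pi.single j 1) := by
    conv_lhs => rw [pi_eq_sum_univ' v]
    simp
  change _ = A v
  rw [this, Matrix.vecMul_eq_sum]
  rfl

theorem quadForm_jacobianT (h : IsHolomorphicChart J U z) (hq : q ∈ U)
    (h₀ : IsHolomorphicChart J U₀ z₀) (hq₀ : q ∈ U₀) (F : Matrix (Fin n) (Fin n) ℂ)
    (v : Fin n → ℂ) :
    v ⬝ᵥ ((jacobianT z₀ z q * F * (jacobianT z₀ z q)ᴴ) *ᵥ star v) =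
      coordChange z₀ z q v ⬝ᵥ (F *ᵥ star (coordChange z₀ z q v)) := by
  rw [← vecMul_jacobianT h hq h₀ hq₀, Matrix.star_vecMul, ← Matrix.mulVec_mulVec,
    ← Matrix.mulVec_mulVec, Matrix.dotProduct_mulVec]

variable [IsManifold (𝓡∂ (2 * n)) ∞ M]

/-- The components of holomorphic coordinates are pluriharmonic. -/
theorem realHess_coord_pluriharmonic (h : IsHolomorphicChart J U z) (hq : q ∈ U)
    (h₀ : IsHolomorphicChart J U z₀) (c : ℂ) (j : Fin n) (v : Fin n → ℂ) :
    realHess z₀ (fun x ↦ (c * z x j).re) v v q +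
      realHess z₀ (fun x ↦ (c * z x j).re) (Complex.I • v) (Complex.I • v) q = 0 := by
  have hd : ∀ (c : ℂ) (v : Fin n → ℂ) (x : M), x ∈ U →
      realDeriv z₀ v (fun x ↦ (c * z x j).re) x = (c * coordChange z₀ z x v j).re := by
    intro c v x hx
    let Φ : (Fin n → ℂ) →L[ℝ] ℝ := Complex.reCLM.comp ((c • ContinuousLinearMap.id ℝ ℂ).comp
      (ContinuousLinearMap.proj j : (Fin n → ℂ) →L[ℝ] ℂ))
    have h1 := HasMFDerivAt.comp x Φ.hasFDerivAt.hasMFDerivAt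
      (((h.contMDiffAt hx).mdifferentiableAt (by simp)).hasMFDerivAt)
    unfold realDeriv
    rw [show (fun x ↦ (c * z x j).re) = Φ ∘ z by ext x; simp [Φ], h1.mfderiv]
    change Φ (coordChange z₀ z x v) = _
    simp [Φ]
  have hC : ∀ c : ℂ, ContMDiffOn (𝓡∂ (2 * n)) 𝓘(ℝ, ℝ) 2 (fun x ↦ (c * z x j).re) U := by
    intro c
    refine h.contMDiffOn_comp (Φ := fun w ↦ (c * w j).re) (k := 2) ?_
    exact Complex.reCLM.contDiff.comp (contDiff_const.mul (contDiff_apply ℝ ℂ j))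
  -- Cauchy–Riemann: the differential of the coordinate change is complex linear, so a derivative
  -- along `√-1 v` is a derivative along `v` with `c` replaced by `c√-1`. Used twice, it produces
  -- the factor `-1`.
  have key : ∀ (c : ℂ), realDeriv z₀ (Complex.I • v) (fun x ↦ (c * z x j).re) =ᶠ[𝓝 q]
      realDeriv z₀ v (fun x ↦ (c * Complex.I * z x j).re) := by
    intro c
    filter_upwards [h.isOpen.mem_nhds hq] with x hx
    rw [hd _ _ x hx, hd _ _ x hx, coordChange_I h hx h₀ hx, Pi.smul_apply, smul_eq_mul, mul_assoc]
  have h1 : realHess z₀ (fun x ↦ (c * z x j).re) (Complex.I • v) (Complex.I • v) q =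
      realHess z₀ (fun x ↦ (c * Complex.I * Complex.I * z x j).re) v v q := by
    unfold realHess
    rw [realDeriv_congr (key c)]
    change realHess z₀ _ _ _ q = _
    rw [realHess_comm h₀ hq (hC _)]
    unfold realHess
    rw [realDeriv_congr (key _)]
  have h2 : (fun x ↦ (c * Complex.I * Complex.I * z x j).re) =
      fun x ↦ (-1) * (c * z x j).re := by
    ext x
    rw [mul_assoc c, Complex.I_mul_I]
    simp
  rw [h1, h2, realHess_const_mul h₀ (-1) (hC c) hq]
  ring

/-- In a fixed real chart both sides have the same second order part in `f` and differ only by first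
order terms coming from the charts `z` and `z₀`. The functions `Re(c zʲ)` are pluriharmonic in `z₀`
and have zero second derivatives in `z`; testing on them shows that the first order terms agree
after averaging over `v` and `√-1 v`. No smoothness of a transition map on an open set of `ℂⁿ` is
used, so boundary points need no separate treatment. -/
theorem realHess_coordChange (h : IsHolomorphicChart J U z) (hq : q ∈ U)
    (h₀ : IsHolomorphicChart J U z₀) (hf : ContMDiffOn (𝓡∂ (2 * n)) 𝓘(ℝ, ℝ) 2 f U)
    (v : Fin n → ℂ) :
    realHess z₀ f v v q + realHess z₀ f (Complex.I • v) (Complex.I • v) q =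
    realHess z f (coordChange z₀ z q v) (coordChange z₀ z q v) q +
      realHess z f (Complex.I • coordChange z₀ z q v) (Complex.I • coordChange z₀ z q v) q := by
  set φ := extChartAt (𝓡∂ (2 * n)) q with hφ
  set R := range (𝓡∂ (2 * n)) with hR
  set L := fderivWithin ℝ (z ∘ φ.symm) R (φ q) with hL
  set L₀ := fderivWithin ℝ (z₀ ∘ φ.symm) R (φ q) with hL₀
  have hi : ∀ v, L.inverse (coordChange z₀ z q v) = L₀.inverse v := by
    intro v
    have := coordVec_coordChange h hq (z₀ := z₀) v
    unfold coordVec at this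
    rw [h.mfderiv_eq_fderivWithin hq, h₀.mfderiv_eq_fderivWithin hq] at this
    exact this
  rw [← coordChange_I h hq h₀ hq]
  have e₀ := fun (f : M → ℝ) (hf : ContMDiffOn (𝓡∂ (2 * n)) 𝓘(ℝ, ℝ) 2 f U) v ↦
    realHess_eq_fderivWithin h₀ hq hf v v
  have e := fun (f : M → ℝ) (hf : ContMDiffOn (𝓡∂ (2 * n)) 𝓘(ℝ, ℝ) 2 f U) v ↦
    realHess_eq_fderivWithin h hq hf (coordChange z₀ z q v) (coordChange z₀ z q v)
  simp only [← hφ, ← hL, ← hL₀, ← hR, hi] at e e₀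
  set T₀ := fun v ↦ fderivWithin ℝ (fderivWithin ℝ (z₀ ∘ φ.symm) R) R (φ q) (L₀.inverse v)
    (L₀.inverse v)
  set T := fun v ↦ fderivWithin ℝ (fderivWithin ℝ (z ∘ φ.symm) R) R (φ q) (L₀.inverse v)
    (L₀.inverse v)
  have hcoord : ∀ (c : ℂ) (j : Fin n) (y : EuclideanSpace ℝ (Fin (2 * n))),
      fderivWithin ℝ ((fun x ↦ (c * z x j).re) ∘ φ.symm) R (φ q) y = (c * L y j).re := by
    intro c j y
    let Φ : (Fin n → ℂ) →L[ℝ] ℝ := Complex.reCLM.comp ((c • ContinuousLinearMap.id ℝ ℂ).comp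
      (ContinuousLinearMap.proj j : (Fin n → ℂ) →L[ℝ] ℂ))
    have hxR : φ q ∈ R := extChartAt_target_subset_range q (mem_extChartAt_target q)
    have h1 : DifferentiableWithinAt ℝ (z ∘ φ.symm) R (φ q) :=
      ((h.contMDiffAt hq).contDiffWithinAt_comp_extChartAt_symm).differentiableWithinAt (by simp)
    have h2 := (Φ.hasFDerivAt.comp_hasFDerivWithinAt (φ q) h1.hasFDerivWithinAt).fderivWithin
      ((𝓡∂ (2 * n)).uniqueDiffOn _ hxR)
    have h3 : ((fun x ↦ (c * z x j).re) ∘ φ.symm) = Φ ∘ (z ∘ φ.symm) := by ext x; simp [Φ]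
    rw [h3, h2]
    simp [Φ, hL]
  have hC : ∀ (c : ℂ) (j : Fin n),
      ContMDiffOn (𝓡∂ (2 * n)) 𝓘(ℝ, ℝ) 2 (fun x ↦ (c * z x j).re) U := by
    intro c j
    refine h.contMDiffOn_comp (Φ := fun w ↦ (c * w j).re) (k := 2) ?_
    exact Complex.reCLM.contDiff.comp (contDiff_const.mul (contDiff_apply ℝ ℂ j))
  have hcc : ∀ (v w : Fin n → ℂ) (h' : IsHolomorphicChart J U z) (c : ℂ) (j : Fin n),
      realHess z (fun x ↦ (c * z x j).re) v w q = 0 := by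
    intro v w h' c j
    unfold realHess
    let Φ : (Fin n → ℂ) →L[ℝ] ℝ := Complex.reCLM.comp ((c • ContinuousLinearMap.id ℝ ℂ).comp
      (ContinuousLinearMap.proj j : (Fin n → ℂ) →L[ℝ] ℂ))
    have : realDeriv z w (fun x ↦ (c * z x j).re) =ᶠ[𝓝 q] fun _ ↦ Φ w := by
      filter_upwards [h.isOpen.mem_nhds hq] with x hx
      rw [show (fun x ↦ (c * z x j).re) = fun x ↦ Φ (z x) by ext x; simp [Φ],
        realDeriv_comp_coord h hx Φ.differentiableAt, ContinuousLinearMap.fderiv]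
    rw [realDeriv_congr this, realDeriv_const]
  have hT : L.inverse (T v + T (Complex.I • v)) = L₀.inverse (T₀ v + T₀ (Complex.I • v)) := by
    have hLL : ∀ y, L (L.inverse y) = y ∧ ∀ y, L.inverse (L y) = y := by
      intro y
      obtain ⟨e, he⟩ := h.isInvertible_fderivWithin (mem_extChartAt_target q)
        (by rw [extChartAt_to_inv]; exact hq)
      rw [hL, ← he, ContinuousLinearMap.inverse_equiv]
      exact ⟨e.apply_symm_apply _, e.symm_apply_apply⟩
    have hinj : Function.Injective L := Function.LeftInverse.injective (hLL 0).2
    apply hinj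
    ext j
    -- The choices `c = 1` and `c = -√-1` will recover the real and imaginary parts of the
    -- components.
    have hre : ∀ c : ℂ, (c * L (L.inverse (T v + T (Complex.I • v))) j).re =
        (c * L (L₀.inverse (T₀ v + T₀ (Complex.I • v))) j).re := by
      intro c
      rw [← hcoord, ← hcoord, map_add, map_add, map_add, map_add]
      have a1 := e₀ _ (hC c j) v
      have a2 := e₀ _ (hC c j) (Complex.I • v)
      have b1 := e _ (hC c j) v
      have b2 := e _ (hC c j) (Complex.I • v)
      rw [hcc _ _ h] at b1 b2
      have p := realHess_coord_pluriharmonic h hq h₀ c j v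
      linarith
    apply Complex.ext
    · simpa using hre 1
    · simpa using hre (-Complex.I)
  have hT' := congrArg (fderivWithin ℝ (f ∘ φ.symm) R (φ q)) hT
  simp only [map_add] at hT'
  rw [e₀ f hf, e₀ f hf, e f hf, e f hf]
  linarith

theorem complexHessian_coordChange (h : IsHolomorphicChart J U z) (hq : q ∈ U)
    (h₀ : IsHolomorphicChart J U z₀) (hf : ContMDiffOn (𝓡∂ (2 * n)) 𝓘(ℝ, ℝ) 2 f U) :
    complexHessian z₀ f q =
      jacobianT z₀ z q * complexHessian z f q * (jacobianT z₀ z q)ᴴ := by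
  refine Matrix.ext_of_quadForm fun v ↦ ?_
  rw [quadForm_jacobianT h hq h₀ hq, quadForm_complexHessian h₀ hf hq,
    quadForm_complexHessian h hf hq, realHess_coordChange h hq h₀ hf]

end ChangeOfChart

theorem coordVec_I_I {n : ℕ} [NeZero n] {M : Type*} [TopologicalSpace M]
    [ChartedSpace (EuclideanHalfSpace (2 * n)) M] (z : M → (Fin n → ℂ)) (q : M) (v : Fin n → ℂ) :
    coordVec z q (Complex.I • Complex.I • v) = - coordVec z q v := by
  rw [smul_smul, Complex.I_mul_I, show (-1 : ℂ) • v = (-1 : ℝ) • v by simp, coordVec_smul]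
  simp

/-! ### Coefficients of real `(1,1)`-forms -/

section Coefficients

variable {n : ℕ} [NeZero n] {M : Type*} [TopologicalSpace M]
  [ChartedSpace (EuclideanHalfSpace (2 * n)) M] [IsManifold (𝓡∂ (2 * n)) ∞ M]
  {X : ComplexStructure n M}
  {U : Set M} {z z₀ : M → (Fin n → ℂ)} {f g : M → ℝ} {q : M}

/-- The bilinear form `α(v, Jw)` in holomorphic coordinates. -/
def coeffForm (z : M → (Fin n → ℂ)) (α : RealOneOneForm X) (q : M) :
    LinearMap.BilinForm ℝ (Fin n → ℂ) :=
  LinearMap.mk₂ ℝ (fun v w ↦ α.toFun q (coordVec z q v) (coordVec z q (Complex.I • w)))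
    (fun v v' w ↦ by rw [coordVec_add, map_add]; rfl)
    (fun c v w ↦ by rw [coordVec_smul, map_smul]; rfl)
    (fun v w w' ↦ by rw [smul_add, coordVec_add, map_add])
    (fun c v w ↦ by rw [smul_comm, coordVec_smul, map_smul])

theorem coeffForm_apply (z : M → (Fin n → ℂ)) (α : RealOneOneForm X) (q : M) (v w : Fin n → ℂ) :
    coeffForm z α q v w = α.toFun q (coordVec z q v) (coordVec z q (Complex.I • w)) := rfl

theorem RealOneOneForm.skew (α : RealOneOneForm X) (p : M)
    (v w : TangentSpace (𝓡∂ (2 * n)) p) : α.toFun p v w = - α.toFun p w v := by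
  have h := α.alternating p (v + w)
  simp only [map_add, add_apply, α.alternating, zero_add, add_zero] at h
  linarith

theorem coeffForm_comm (h : IsHolomorphicChart X.J U z) (hq : q ∈ U) (α : RealOneOneForm X)
    (v w : Fin n → ℂ) : coeffForm z α q v w = coeffForm z α q w v := by
  rw [coeffForm_apply, coeffForm_apply, ← α.invariant q (coordVec z q v), ← h.coordVec_I hq,
    ← h.coordVec_I hq, coordVec_I_I, map_neg, α.skew, neg_neg]

theorem coeff_eq_leviMatrix (h : IsHolomorphicChart X.J U z) (hq : q ∈ U)
    (α : RealOneOneForm X) : coeff z α q = leviMatrix (coeffForm z α q) := by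
  ext j k
  have hI : ∀ k : Fin n, (Complex.I • Pi.single k (1 : ℂ) : Fin n → ℂ) = Pi.single k Complex.I :=
    fun k ↦ by rw [← Pi.single_smul]; simp
  have h1 : ∀ v w : Fin n → ℂ, α.toFun q (coordVec z q (Complex.I • v))
      (coordVec z q (Complex.I • w)) = α.toFun q (coordVec z q v) (coordVec z q w) := by
    intro v w
    rw [h.coordVec_I hq, h.coordVec_I hq, α.invariant]
  simp only [coeff, leviMatrix, sesqForm_apply, Matrix.of_apply, coeffForm_apply, h1, ← hI]
  rw [coordVec_I_I, map_neg]
  push_cast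
  ring

theorem isHermitian_coeff (h : IsHolomorphicChart X.J U z) (hq : q ∈ U)
    (α : RealOneOneForm X) : (coeff z α q).IsHermitian := by
  rw [coeff_eq_leviMatrix h hq]
  exact isHermitian_leviMatrix (coeffForm_comm h hq α)

theorem quadForm_coeff (h : IsHolomorphicChart X.J U z) (hq : q ∈ U)
    (α : RealOneOneForm X) (v : Fin n → ℂ) : v ⬝ᵥ (coeff z α q *ᵥ star v) =
      ((α.toFun q (coordVec z q v) (X.J q (coordVec z q v)) / 2 : ℝ) : ℂ) := by
  rw [coeff_eq_leviMatrix h hq, quadForm_leviMatrix (coeffForm_comm h hq α)]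
  congr 1
  rw [coeffForm_apply, coeffForm_apply, h.coordVec_I hq (Complex.I • v), h.coordVec_I hq v,
    α.invariant]
  ring

theorem posDef_coeff (h : IsHolomorphicChart X.J U z) (hq : q ∈ U) (metric : HermitianMetric X) :
    (coeff z metric.toRealOneOneForm q).PosDef := by
  refine Matrix.PosDef.of_dotProduct_mulVec_pos (isHermitian_coeff h hq _) fun x hx ↦ ?_
  have h1 := quadForm_coeff h hq metric.toRealOneOneForm (star x)
  rw [star_star] at h1
  rw [h1, Complex.zero_lt_real]
  have h2 : coordVec z q (star x) ≠ 0 := by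
    intro h0
    have := h.mfderiv_coordVec hq (star x)
    rw [h0, map_zero] at this
    exact hx (star_eq_zero.1 this.symm)
  have := metric.pos q _ h2
  linarith

theorem coeff_coordChange (h : IsHolomorphicChart X.J U z) (hq : q ∈ U)
    (h₀ : IsHolomorphicChart X.J U z₀) (α : RealOneOneForm X) :
    coeff z₀ α q = jacobianT z₀ z q * coeff z α q * (jacobianT z₀ z q)ᴴ := by
  refine Matrix.ext_of_quadForm fun v ↦ ?_
  rw [quadForm_jacobianT h hq h₀ hq, quadForm_coeff h₀ hq, quadForm_coeff h hq,
    coordVec_coordChange h hq]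

theorem gCoeff_coordChange (h : IsHolomorphicChart X.J U z) (hq : q ∈ U)
    (h₀ : IsHolomorphicChart X.J U z₀) (χ : RealOneOneForm X)
    (hf : ContMDiffOn (𝓡∂ (2 * n)) 𝓘(ℝ, ℝ) 2 f U) :
    gCoeff z₀ χ f q = jacobianT z₀ z q * gCoeff z χ f q * (jacobianT z₀ z q)ᴴ := by
  unfold gCoeff
  rw [coeff_coordChange h hq h₀, complexHessian_coordChange h hq h₀ hf, Matrix.mul_add,
    Matrix.add_mul]

theorem isHermitian_gCoeff (h : IsHolomorphicChart X.J U z) (hq : q ∈ U)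
    (χ : RealOneOneForm X) (hf : ContMDiffOn (𝓡∂ (2 * n)) 𝓘(ℝ, ℝ) 2 f U) :
    (gCoeff z χ f q).IsHermitian :=
  (isHermitian_coeff h hq χ).add (isHermitian_complexHessian h hf hq)

theorem contMDiffOn_form_apply (h : IsHolomorphicChart X.J U z) (α : RealOneOneForm X)
    (v w : Fin n → ℂ) :
    ContMDiffOn (𝓡∂ (2 * n)) 𝓘(ℝ, ℝ) ∞
      (fun q ↦ α.toFun q (coordVec z q v) (coordVec z q w)) U := by
  intro q hq
  have h1 : ContMDiffWithinAt (𝓡∂ (2 * n)) ((𝓡∂ (2 * n)).prod 𝓘(ℝ, ℝ)) ∞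
      (fun m ↦ Bundle.TotalSpace.mk' ℝ (E := Bundle.Trivial M ℝ) m
        (α.toFun m (coordVec z m v) (coordVec z m w))) U q := by
    apply ContMDiffWithinAt.clm_bundle_apply₂ (F₁ := EuclideanSpace ℝ (Fin (2 * n)))
      (F₂ := EuclideanSpace ℝ (Fin (2 * n)))
    · exact α.contMDiff.contMDiffAt.contMDiffWithinAt
    · exact (h.contMDiffAt_coordVec hq v).contMDiffWithinAt
    · exact (h.contMDiffAt_coordVec hq w).contMDiffWithinAt
  simp only [Bundle.contMDiffWithinAt_totalSpace] at h1
  exact h1.2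

end Coefficients

/-! ### Matrix functions with `C²` entries -/

section SmoothMatrix

variable {n : ℕ} [NeZero n] {M : Type*} [TopologicalSpace M]
  [ChartedSpace (EuclideanHalfSpace (2 * n)) M] {U : Set M}

section Scalar

variable {a b : M → ℂ}

theorem contMDiffOn_ofReal {a : M → ℝ} (ha : ContMDiffOn (𝓡∂ (2 * n)) 𝓘(ℝ, ℝ) 2 a U) :
    ContMDiffOn (𝓡∂ (2 * n)) 𝓘(ℝ, ℂ) 2 (fun q ↦ (a q : ℂ)) U :=
  Complex.ofRealCLM.contDiff.contMDiff.comp_contMDiffOn ha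

theorem ContMDiffOn.complex_re (ha : ContMDiffOn (𝓡∂ (2 * n)) 𝓘(ℝ, ℂ) 2 a U) :
    ContMDiffOn (𝓡∂ (2 * n)) 𝓘(ℝ, ℝ) 2 (fun q ↦ (a q).re) U :=
  Complex.reCLM.contDiff.contMDiff.comp_contMDiffOn ha

theorem ContMDiffOn.complex_star (ha : ContMDiffOn (𝓡∂ (2 * n)) 𝓘(ℝ, ℂ) 2 a U) :
    ContMDiffOn (𝓡∂ (2 * n)) 𝓘(ℝ, ℂ) 2 (fun q ↦ star (a q)) U :=
  (Complex.conjCLE : ℂ →L[ℝ] ℂ).contDiff.contMDiff.comp_contMDiffOn ha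

theorem ContMDiffOn.complex_mul (ha : ContMDiffOn (𝓡∂ (2 * n)) 𝓘(ℝ, ℂ) 2 a U)
    (hb : ContMDiffOn (𝓡∂ (2 * n)) 𝓘(ℝ, ℂ) 2 b U) :
    ContMDiffOn (𝓡∂ (2 * n)) 𝓘(ℝ, ℂ) 2 (fun q ↦ a q * b q) U :=
  (contDiff_mul (𝕜 := ℝ) (𝔸 := ℂ)).contMDiff.comp_contMDiffOn (ha.prodMk_space hb)

theorem ContMDiffOn.complex_inv (ha : ContMDiffOn (𝓡∂ (2 * n)) 𝓘(ℝ, ℂ) 2 a U)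
    (h0 : ∀ q ∈ U, a q ≠ 0) :
    ContMDiffOn (𝓡∂ (2 * n)) 𝓘(ℝ, ℂ) 2 (fun q ↦ (a q)⁻¹) U := fun q hq ↦
  ((contDiffAt_inv ℝ (h0 q hq)).contMDiffAt).comp_contMDiffWithinAt q (ha q hq)

theorem contMDiffOn_complex_sum {ι : Type*} (s : Finset ι) {a : ι → M → ℂ}
    (ha : ∀ i ∈ s, ContMDiffOn (𝓡∂ (2 * n)) 𝓘(ℝ, ℂ) 2 (a i) U) :
    ContMDiffOn (𝓡∂ (2 * n)) 𝓘(ℝ, ℂ) 2 (fun q ↦ ∑ i ∈ s, a i q) U := by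
  classical
  induction s using Finset.induction_on with
  | empty => simpa using contMDiffOn_const
  | insert i s hi ih =>
    simp only [Finset.sum_insert hi]
    exact (ha i (Finset.mem_insert_self i s)).add
      (ih fun k hk ↦ ha k (Finset.mem_insert_of_mem hk))

theorem contMDiffOn_complex_prod {ι : Type*} (s : Finset ι) {a : ι → M → ℂ}
    (ha : ∀ i ∈ s, ContMDiffOn (𝓡∂ (2 * n)) 𝓘(ℝ, ℂ) 2 (a i) U) :
    ContMDiffOn (𝓡∂ (2 * n)) 𝓘(ℝ, ℂ) 2 (fun q ↦ ∏ i ∈ s, a i q) U := by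
  classical
  induction s using Finset.induction_on with
  | empty => simpa using contMDiffOn_const
  | insert i s hi ih =>
    simp only [Finset.prod_insert hi]
    exact (ha i (Finset.mem_insert_self i s)).complex_mul
      (ih fun k hk ↦ ha k (Finset.mem_insert_of_mem hk))

end Scalar

/-- A matrix valued function whose entries are `C²` on `U`. -/
def IsC2Matrix (n : ℕ) [NeZero n] {M : Type*} [TopologicalSpace M]
    [ChartedSpace (EuclideanHalfSpace (2 * n)) M] {l m : Type*} (U : Set M)
    (F : M → Matrix l m ℂ) : Prop :=
  ∀ i j, ContMDiffOn (𝓡∂ (2 * n)) 𝓘(ℝ, ℂ) 2 (fun q ↦ F q i j) U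

variable {l m r : Type*}

theorem IsC2Matrix.add {F G : M → Matrix l m ℂ} (hF : IsC2Matrix n U F) (hG : IsC2Matrix n U G) :
    IsC2Matrix n U fun q ↦ F q + G q := fun i j ↦ (hF i j).add (hG i j)

theorem IsC2Matrix.sub {F G : M → Matrix l m ℂ} (hF : IsC2Matrix n U F) (hG : IsC2Matrix n U G) :
    IsC2Matrix n U fun q ↦ F q - G q := fun i j ↦ (hF i j).sub (hG i j)

theorem IsC2Matrix.smul {c : M → ℂ} {F : M → Matrix l m ℂ}
    (hc : ContMDiffOn (𝓡∂ (2 * n)) 𝓘(ℝ, ℂ) 2 c U) (hF : IsC2Matrix n U F) :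
    IsC2Matrix n U fun q ↦ c q • F q := fun i j ↦ hc.complex_mul (hF i j)

theorem IsC2Matrix.mul [Fintype m] {F : M → Matrix l m ℂ} {G : M → Matrix m r ℂ}
    (hF : IsC2Matrix n U F) (hG : IsC2Matrix n U G) : IsC2Matrix n U fun q ↦ F q * G q :=
  fun i j ↦ by
    simp only [Matrix.mul_apply]
    exact contMDiffOn_complex_sum _ fun k _ ↦ (hF i k).complex_mul (hG k j)

theorem IsC2Matrix.trace [Fintype m] {F : M → Matrix m m ℂ} (hF : IsC2Matrix n U F) :
    ContMDiffOn (𝓡∂ (2 * n)) 𝓘(ℝ, ℂ) 2 (fun q ↦ (F q).trace) U :=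
  contMDiffOn_complex_sum _ fun k _ ↦ hF k k

theorem IsC2Matrix.det [Fintype m] [DecidableEq m] {F : M → Matrix m m ℂ}
    (hF : IsC2Matrix n U F) :
    ContMDiffOn (𝓡∂ (2 * n)) 𝓘(ℝ, ℂ) 2 (fun q ↦ (F q).det) U := by
  simp only [Matrix.det_apply']
  exact contMDiffOn_complex_sum _ fun σ _ ↦ contMDiffOn_const.complex_mul
    (contMDiffOn_complex_prod _ fun i _ ↦ hF _ _)

theorem IsC2Matrix.inv [Fintype m] [DecidableEq m] {F : M → Matrix m m ℂ}
    (hF : IsC2Matrix n U F) (h0 : ∀ q ∈ U, (F q).det ≠ 0) :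
    IsC2Matrix n U fun q ↦ (F q)⁻¹ := by
  simp only [Matrix.inv_def, Ring.inverse_eq_inv']
  refine IsC2Matrix.smul (hF.det.complex_inv h0) fun i j ↦ ?_
  simp only [Matrix.adjugate_apply]
  refine IsC2Matrix.det fun k l ↦ ?_
  simp only [Matrix.updateRow_apply]
  split_ifs
  · exact contMDiffOn_const
  · exact hF k l

end SmoothMatrix

/-! ### Regularity of the coefficients of the forms -/

section SmoothCoefficients

variable {n : ℕ} [NeZero n] {M : Type*} [TopologicalSpace M]
  [ChartedSpace (EuclideanHalfSpace (2 * n)) M] [IsManifold (𝓡∂ (2 * n)) ∞ M]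
  {X : ComplexStructure n M} {U : Set M} {z : M → (Fin n → ℂ)} {f : M → ℝ}

theorem isC2Matrix_coeff (h : IsHolomorphicChart X.J U z) (α : RealOneOneForm X) :
    IsC2Matrix n U (coeff z α) := by
  intro j k
  simp only [coeff, Matrix.of_apply, div_eq_mul_inv]
  have h1 := fun v w ↦ contMDiffOn_ofReal ((contMDiffOn_form_apply h α v w).of_le
    (m := 2) (by norm_cast))
  exact ((h1 _ _).sub (contMDiffOn_const.complex_mul (h1 _ _))).complex_mul contMDiffOn_const

theorem contMDiffOn_realHess (h : IsHolomorphicChart X.J U z)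
    (hf : ContMDiffOn (𝓡∂ (2 * n)) 𝓘(ℝ, ℝ) 4 f U) (v w : Fin n → ℂ) :
    ContMDiffOn (𝓡∂ (2 * n)) 𝓘(ℝ, ℝ) 2 (realHess z f v w) U := by
  have h1 := h.contMDiffOn_realDeriv (k := 3) (m := 4) hf (by norm_num) w
  exact h.contMDiffOn_realDeriv (k := 2) (m := 3) h1 (by norm_num) v

theorem isC2Matrix_complexHessian (h : IsHolomorphicChart X.J U z)
    (hf : ContMDiffOn (𝓡∂ (2 * n)) 𝓘(ℝ, ℝ) 4 f U) :
    IsC2Matrix n U (complexHessian z f) := by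
  intro j k
  have h1 := fun v w ↦ contMDiffOn_realHess h hf v w
  have h2 := ((contMDiffOn_ofReal ((h1 (Pi.single j 1) (Pi.single k 1)).add
    (h1 (Pi.single j Complex.I) (Pi.single k Complex.I)))).add
    (contMDiffOn_const (c := Complex.I) |>.complex_mul (contMDiffOn_ofReal
      ((h1 (Pi.single j 1) (Pi.single k Complex.I)).sub
        (h1 (Pi.single j Complex.I) (Pi.single k 1)))))).complex_mul
    (contMDiffOn_const (c := (4 : ℂ)⁻¹))
  refine h2.congr fun q hq ↦ ?_
  rw [complexHessian_apply h (hf.of_le (by norm_num)) hq]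
  rfl

theorem isC2Matrix_gCoeff (h : IsHolomorphicChart X.J U z) (χ : RealOneOneForm X)
    (hf : ContMDiffOn (𝓡∂ (2 * n)) 𝓘(ℝ, ℝ) 4 f U) : IsC2Matrix n U (gCoeff z χ f) :=
  (isC2Matrix_coeff h χ).add (isC2Matrix_complexHessian h hf)

theorem contMDiffOn_complexGrad (h : IsHolomorphicChart X.J U z)
    (hf : ContMDiffOn (𝓡∂ (2 * n)) 𝓘(ℝ, ℝ) 3 f U) (j : Fin n) :
    ContMDiffOn (𝓡∂ (2 * n)) 𝓘(ℝ, ℂ) 2 (fun q ↦ complexGrad z f q j) U := by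
  have h1 := fun v ↦ contMDiffOn_ofReal (h.contMDiffOn_realDeriv (k := 2) (m := 3) hf
    (by norm_num) v)
  simp only [complexGrad, div_eq_mul_inv]
  exact ((h1 _).sub (contMDiffOn_const.complex_mul (h1 _))).complex_mul contMDiffOn_const

end SmoothCoefficients

/-! ### Relative eigenvalues, and traces over a complex hyperplane -/

section LinearAlgebra

variable {n : ℕ} {W G F C : Matrix (Fin n) (Fin n) ℂ}

open scoped MatrixOrder Matrix.Norms.L2Operator in
theorem Matrix.PosSemidef.exists_eq_conjTranspose_mul_self (hF : F.PosSemidef) :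
    ∃ B : Matrix (Fin n) (Fin n) ℂ, F = Bᴴ * B :=
  CStarAlgebra.nonneg_iff_eq_star_mul_self.mp hF.nonneg

theorem Matrix.PosSemidef.re_trace_mul_nonneg (hF : F.PosSemidef) (hC : C.PosSemidef) :
    0 ≤ (F * C).trace.re := by
  obtain ⟨B, rfl⟩ := hF.exists_eq_conjTranspose_mul_self
  rw [Matrix.mul_assoc, Matrix.trace_mul_comm]
  exact (Complex.le_def.1 (hC.mul_mul_conjTranspose_same B).trace_nonneg).1

/-- Simultaneous diagonalisation of a positive definite and a Hermitian matrix. -/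
theorem exists_simultaneous_diagonal (hW : W.PosDef) (hG : G.IsHermitian) :
    ∃ (Y Z : Matrix (Fin n) (Fin n) ℂ) (l : Fin n → ℝ), Y * Z = 1 ∧ Z * Y = 1 ∧ W = Y * Yᴴ ∧
      G = Y * Matrix.diagonal (fun i ↦ (l i : ℂ)) * Yᴴ := by
  -- With `W = R Rᴴ`, a unitary `V` diagonalises the Hermitian matrix `R⁻¹ G (R⁻¹)ᴴ`, and `Y = R V`
  -- works.
  obtain ⟨B, hB⟩ := hW.posSemidef.exists_eq_conjTranspose_mul_self
  have hu : IsUnit Bᴴ := by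
    have hWu := hW.isUnit
    rw [Matrix.isUnit_iff_isUnit_det] at hWu ⊢
    rw [hB, Matrix.det_mul] at hWu
    exact isUnit_of_mul_isUnit_left hWu
  have hdet := (Matrix.isUnit_iff_isUnit_det _).1 hu
  set R := Bᴴ with hR
  have hRB : Rᴴ = B := by simp [hR]
  have h1 : R * R⁻¹ = 1 := Matrix.mul_nonsing_inv _ hdet
  have h2 : R⁻¹ * R = 1 := Matrix.nonsing_inv_mul _ hdet
  have h3 : Rᴴ * (R⁻¹)ᴴ = 1 := by rw [← Matrix.conjTranspose_mul, h2, Matrix.conjTranspose_one]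
  have h4 : (R⁻¹)ᴴ * Rᴴ = 1 := by rw [← Matrix.conjTranspose_mul, h1, Matrix.conjTranspose_one]
  have hA : (R⁻¹ * G * (R⁻¹)ᴴ).IsHermitian := Matrix.isHermitian_mul_mul_conjTranspose _ hG
  set V : Matrix (Fin n) (Fin n) ℂ := hA.eigenvectorUnitary.1 with hV
  have hVV : V * Vᴴ = 1 := by
    have := Unitary.coe_mul_star_self hA.eigenvectorUnitary
    simpa [Matrix.star_eq_conjTranspose] using this
  have hVV' : Vᴴ * V = 1 := by
    have := Unitary.coe_star_mul_self hA.eigenvectorUnitary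
    simpa [Matrix.star_eq_conjTranspose] using this
  have hsp : R⁻¹ * G * (R⁻¹)ᴴ = V * Matrix.diagonal (fun i ↦ (hA.eigenvalues i : ℂ)) * Vᴴ := by
    have := hA.spectral_theorem
    rw [Unitary.conjStarAlgAut_apply] at this
    exact this
  refine ⟨R * V, Vᴴ * R⁻¹, hA.eigenvalues, ?_, ?_, ?_, ?_⟩
  · calc R * V * (Vᴴ * R⁻¹) = R * (V * Vᴴ) * R⁻¹ := by simp only [Matrix.mul_assoc]
      _ = 1 := by rw [hVV, Matrix.mul_one, h1]
  · calc Vᴴ * R⁻¹ * (R * V) = Vᴴ * (R⁻¹ * R) * V := by simp only [Matrix.mul_assoc]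
      _ = 1 := by rw [h2, Matrix.mul_one, hVV']
  · calc W = R * (V * Vᴴ) * Rᴴ := by rw [hVV, Matrix.mul_one, hRB, hB]
      _ = _ := by rw [Matrix.conjTranspose_mul]; simp only [Matrix.mul_assoc]
  · calc G = (R * R⁻¹) * G * ((R⁻¹)ᴴ * Rᴴ) := by rw [h1, h4, Matrix.one_mul, Matrix.mul_one]
      _ = R * (R⁻¹ * G * (R⁻¹)ᴴ) * Rᴴ := by simp only [Matrix.mul_assoc]
      _ = R * (V * Matrix.diagonal (fun i ↦ (hA.eigenvalues i : ℂ)) * Vᴴ) * Rᴴ :=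
        congrArg (fun A ↦ R * A * Rᴴ) hsp
      _ = _ := by rw [Matrix.conjTranspose_mul]; simp only [Matrix.mul_assoc]

theorem inv_eq_of_factor {Y Z : Matrix (Fin n) (Fin n) ℂ} (h1 : Y * Z = 1)
    {D D' : Matrix (Fin n) (Fin n) ℂ} (hD : D * D' = 1) :
    (Y * D * Yᴴ)⁻¹ = Zᴴ * D' * Z := by
  refine Matrix.inv_eq_right_inv ?_
  calc Y * D * Yᴴ * (Zᴴ * D' * Z) = Y * D * (Yᴴ * Zᴴ) * D' * Z := by simp only [Matrix.mul_assoc]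
    _ = Y * (D * D') * Z := by
      rw [← Matrix.conjTranspose_mul, mul_eq_one_comm.1 h1, Matrix.conjTranspose_one]
      simp only [Matrix.mul_assoc, Matrix.mul_one]
    _ = 1 := by rw [hD, Matrix.mul_one, h1]

theorem inv_eq_of_factor_one {Y Z : Matrix (Fin n) (Fin n) ℂ} (h1 : Y * Z = 1) :
    (Y * Yᴴ)⁻¹ = Zᴴ * Z := by
  simpa using inv_eq_of_factor h1 (Matrix.mul_one (1 : Matrix (Fin n) (Fin n) ℂ))

theorem trace_factor_mul {Y Z D E : Matrix (Fin n) (Fin n) ℂ} (h2 : Z * Y = 1) :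
    ((Y * D * Yᴴ) * (Zᴴ * E * Z)).trace = (D * E).trace := by
  have h3 : Yᴴ * Zᴴ = 1 := by rw [← Matrix.conjTranspose_mul, h2, Matrix.conjTranspose_one]
  calc ((Y * D * Yᴴ) * (Zᴴ * E * Z)).trace = (Y * (D * (Yᴴ * Zᴴ) * E * Z)).trace := by
        simp only [Matrix.mul_assoc]
    _ = (D * (E * (Z * Y))).trace := by
        rw [Matrix.trace_mul_comm, h3]; simp only [Matrix.mul_assoc, Matrix.mul_one]
    _ = _ := by rw [h2, Matrix.mul_one]

/-- `G W⁻¹` equals `Y D Y⁻¹`, so its characteristic polynomial is that of the diagonal matrix `D`.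
-/
theorem relEigenvalues_factor {Y Z : Matrix (Fin n) (Fin n) ℂ} (h1 : Y * Z = 1) (l : Fin n → ℝ) :
    relEigenvalues (Y * Yᴴ) (Y * Matrix.diagonal (fun i ↦ (l i : ℂ)) * Yᴴ) =
      Finset.univ.val.map l := by
  have h2 := mul_eq_one_comm.1 h1
  have h3 : Yᴴ * Zᴴ = 1 := by rw [← Matrix.conjTranspose_mul, h2, Matrix.conjTranspose_one]
  have : Y * Matrix.diagonal (fun i ↦ (l i : ℂ)) * Yᴴ * (Y * Yᴴ)⁻¹ =
      Y * (Matrix.diagonal (fun i ↦ (l i : ℂ)) * Z) := by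
    rw [inv_eq_of_factor_one h1]
    calc _ = Y * (Matrix.diagonal (fun i ↦ (l i : ℂ)) * ((Yᴴ * Zᴴ) * Z)) := by
          simp only [Matrix.mul_assoc]
      _ = _ := by rw [h3, Matrix.one_mul]
  rw [relEigenvalues, this, Matrix.charpoly_mul_comm, Matrix.mul_assoc, h2, Matrix.mul_one,
    Matrix.charpoly_diagonal]
  have : ∏ i, (Polynomial.X - Polynomial.C (l i : ℂ)) =
      ((Finset.univ.val.map fun i ↦ (l i : ℂ)).map (fun a ↦ Polynomial.X - Polynomial.C a)).prod := by
    rw [Multiset.map_map]; rfl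
  rw [this, Polynomial.roots_multiset_prod_X_sub_C, Multiset.map_map]
  rfl

theorem powersetCard_univ_pred (hn : 1 ≤ n) :
    Finset.powersetCard (n - 1) (Finset.univ : Finset (Fin n)) =
      Finset.univ.image (fun i ↦ ({i} : Finset (Fin n))ᶜ) := by
  ext s
  simp only [Finset.mem_powersetCard, Finset.subset_univ, true_and, Finset.mem_image,
    Finset.mem_univ]
  constructor
  · intro hs
    have : sᶜ.card = 1 := by rw [Finset.card_compl, Fintype.card_fin]; omega
    obtain ⟨i, hi⟩ := Finset.card_eq_one.1 this
    exact ⟨i, by rw [← hi, compl_compl]⟩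
  · rintro ⟨i, rfl⟩
    rw [Finset.card_compl, Fintype.card_fin, Finset.card_singleton]

/-- A set of `n - 1` indices omits exactly one, so the factors of `ℳ` are the numbers `tr - λ_i`.
Everything that follows uses `ℳ` in this form. -/
theorem pSums_pred (hn : 1 ≤ n) (l : Fin n → ℝ) :
    pSums (n - 1) (Finset.univ.val.map l) =
      Finset.univ.val.map (fun i ↦ ∑ j, l j - l i) := by
  have hinj : Function.Injective (fun i : Fin n ↦ ({i} : Finset (Fin n))ᶜ) := fun i j hij ↦
    Finset.singleton_injective (compl_injective hij)
  rw [pSums, Multiset.powersetCard_map, ← Finset.map_val_val_powersetCard,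
    powersetCard_univ_pred hn, Finset.image_val_of_injOn hinj.injOn, Multiset.map_map,
    Multiset.map_map, Multiset.map_map]
  refine Multiset.map_congr rfl fun i _ ↦ ?_
  have := Finset.sum_compl_add_sum ({i} : Finset (Fin n)) l
  rw [Finset.sum_singleton] at this
  change (Multiset.map l ({i} : Finset (Fin n))ᶜ.val).sum = _
  rw [← this, add_sub_cancel_right]
  rfl

/-- The trace of `F` with respect to `W`. -/
def relTrace (W F : Matrix (Fin n) (Fin n) ℂ) : ℝ := (F * W⁻¹).trace.re

/-- The inverse of the restriction of `W` to the hyperplane `{ξ | ∑ ξʲ aⱼ = 0}`. -/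
def tangentInv (W : Matrix (Fin n) (Fin n) ℂ) (a : Fin n → ℂ) : Matrix (Fin n) (Fin n) ℂ :=
  W⁻¹ - (Matrix.vecMulVec a (star a) * W⁻¹).trace⁻¹ •
    (W⁻¹ * Matrix.vecMulVec a (star a) * W⁻¹)

/-- The trace with respect to `W` over the hyperplane `{ξ | ∑ ξʲ aⱼ = 0}`. -/
def tangentTrace (W : Matrix (Fin n) (Fin n) ℂ) (a : Fin n → ℂ)
    (F : Matrix (Fin n) (Fin n) ℂ) : ℝ := (F * tangentInv W a).trace.re

theorem relTrace_add (W F G : Matrix (Fin n) (Fin n) ℂ) :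
    relTrace W (F + G) = relTrace W F + relTrace W G := by
  simp [relTrace, Matrix.add_mul]

theorem relTrace_sub (W F G : Matrix (Fin n) (Fin n) ℂ) :
    relTrace W (F - G) = relTrace W F - relTrace W G := by
  simp [relTrace, Matrix.sub_mul]

theorem relTrace_smul (W F : Matrix (Fin n) (Fin n) ℂ) (c : ℝ) :
    relTrace W ((c : ℂ) • F) = c * relTrace W F := by
  simp [relTrace]

theorem tangentTrace_add (W F G : Matrix (Fin n) (Fin n) ℂ) (a : Fin n → ℂ) :
    tangentTrace W a (F + G) = tangentTrace W a F + tangentTrace W a G := by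
  simp [tangentTrace, Matrix.add_mul]

theorem tangentTrace_sub (W F G : Matrix (Fin n) (Fin n) ℂ) (a : Fin n → ℂ) :
    tangentTrace W a (F - G) = tangentTrace W a F - tangentTrace W a G := by
  simp [tangentTrace, Matrix.sub_mul]

theorem tangentTrace_smul (W F : Matrix (Fin n) (Fin n) ℂ) (a : Fin n → ℂ) (c : ℝ) :
    tangentTrace W a ((c : ℂ) • F) = c * tangentTrace W a F := by
  simp [tangentTrace]

theorem relTrace_nonneg (hW : W.PosDef) (hF : F.PosSemidef) : 0 ≤ relTrace W F :=
  hF.re_trace_mul_nonneg hW.inv.posSemidef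

theorem trace_vecMulVec_mul (a b : Fin n → ℂ) (F : Matrix (Fin n) (Fin n) ℂ) :
    (Matrix.vecMulVec a b * F).trace = b ⬝ᵥ (F *ᵥ a) := by
  rw [Matrix.vecMulVec_mul, Matrix.trace_vecMulVec, dotProduct_comm, ← Matrix.dotProduct_mulVec]

theorem trace_vecMulVec_inv_ne_zero (hW : W.PosDef) {a : Fin n → ℂ} (ha : a ≠ 0) :
    (Matrix.vecMulVec a (star a) * W⁻¹).trace ≠ 0 := by
  rw [trace_vecMulVec_mul]
  exact (hW.inv.dotProduct_mulVec_pos ha).ne'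

theorem relTrace_vecMulVec_pos (hW : W.PosDef) {a : Fin n → ℂ} (ha : a ≠ 0) :
    0 < relTrace W (Matrix.vecMulVec a (star a)) := by
  rw [relTrace, trace_vecMulVec_mul]
  exact (Complex.lt_def.1 (hW.inv.dotProduct_mulVec_pos ha)).1

theorem vecMulVec_mul_mul_vecMulVec (a b c d : Fin n → ℂ) (F : Matrix (Fin n) (Fin n) ℂ) :
    Matrix.vecMulVec a b * F * Matrix.vecMulVec c d =
      (b ⬝ᵥ (F *ᵥ c)) • Matrix.vecMulVec a d := by
  rw [Matrix.vecMulVec_mul, Matrix.vecMulVec_mul_vecMulVec, ← Matrix.dotProduct_mulVec]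
  ext i j
  simp [Matrix.vecMulVec_apply]
  ring

theorem vecMulVec_mul_tangentInv (hW : W.PosDef) {a : Fin n → ℂ} (ha : a ≠ 0) (c : Fin n → ℂ) :
    Matrix.vecMulVec c (star a) * tangentInv W a = 0 := by
  have h0 := trace_vecMulVec_inv_ne_zero hW ha
  rw [tangentInv, Matrix.mul_sub, Matrix.mul_smul, ← Matrix.mul_assoc, ← Matrix.mul_assoc,
    vecMulVec_mul_mul_vecMulVec, Matrix.smul_mul, smul_smul, ← trace_vecMulVec_mul, inv_mul_cancel₀ h0,
    one_smul, sub_self]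

theorem tangentInv_mul_vecMulVec (hW : W.PosDef) {a : Fin n → ℂ} (ha : a ≠ 0) (c : Fin n → ℂ) :
    tangentInv W a * Matrix.vecMulVec a c = 0 := by
  have h0 := trace_vecMulVec_inv_ne_zero hW ha
  rw [tangentInv, Matrix.sub_mul, Matrix.smul_mul, Matrix.mul_assoc, Matrix.mul_assoc W⁻¹,
    ← Matrix.mul_assoc (Matrix.vecMulVec a (star a)),
    vecMulVec_mul_mul_vecMulVec, Matrix.mul_smul, smul_smul, ← trace_vecMulVec_mul, inv_mul_cancel₀ h0,
    one_smul, sub_self]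

/-- With `a = ∂ρ`, this and the next lemma remove the cross terms and the gradient squared from the
Hessians of products with `ρ`. The barrier may therefore contain large multiples of `ρ²` and `ρr`.
-/
theorem tangentTrace_vecMulVec_left (hW : W.PosDef) {a : Fin n → ℂ} (ha : a ≠ 0) (c : Fin n → ℂ) :
    tangentTrace W a (Matrix.vecMulVec a c) = 0 := by
  rw [tangentTrace, Matrix.trace_mul_comm, tangentInv_mul_vecMulVec hW ha]; simp

theorem tangentTrace_vecMulVec_right (hW : W.PosDef) {a : Fin n → ℂ} (ha : a ≠ 0) (c : Fin n → ℂ) :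
    tangentTrace W a (Matrix.vecMulVec c (star a)) = 0 := by
  rw [tangentTrace, vecMulVec_mul_tangentInv hW ha]; simp

theorem isHermitian_tangentInv (hW : W.PosDef) (a : Fin n → ℂ) : (tangentInv W a).IsHermitian := by
  have hR : (Matrix.vecMulVec a (star a)).PosSemidef := Matrix.posSemidef_vecMulVec_self_star a
  have hWi : (W⁻¹)ᴴ = W⁻¹ := hW.inv.isHermitian
  have h1 : star (Matrix.vecMulVec a (star a) * W⁻¹).trace =
      (Matrix.vecMulVec a (star a) * W⁻¹).trace := by
    rw [← Matrix.trace_conjTranspose, Matrix.conjTranspose_mul, hWi, hR.isHermitian.eq,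
      Matrix.trace_mul_comm]
  rw [Matrix.IsHermitian, tangentInv, Matrix.conjTranspose_sub, Matrix.conjTranspose_smul,
    Matrix.conjTranspose_mul, Matrix.conjTranspose_mul, hWi, hR.isHermitian.eq, star_inv₀, h1,
    Matrix.mul_assoc]

/-- With self-adjointness, `S = S W S` exhibits `S = tangentInv W a` as `Sᴴ W S`, hence as positive
semidefinite. -/
theorem tangentInv_mul_mul_self (hW : W.PosDef) {a : Fin n → ℂ} (ha : a ≠ 0) :
    tangentInv W a * W * tangentInv W a = tangentInv W a := by
  have hdet := (Matrix.isUnit_iff_isUnit_det _).1 hW.isUnit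
  conv_lhs => rw [Matrix.mul_assoc]; arg 2; rw [tangentInv]
  rw [Matrix.mul_sub, Matrix.mul_smul, ← Matrix.mul_assoc, ← Matrix.mul_assoc,
    Matrix.mul_nonsing_inv _ hdet, Matrix.one_mul, Matrix.mul_sub, Matrix.mul_one, Matrix.mul_smul,
    ← Matrix.mul_assoc, tangentInv_mul_vecMulVec hW ha, Matrix.zero_mul, smul_zero, sub_zero]

theorem posSemidef_tangentInv (hW : W.PosDef) {a : Fin n → ℂ} (ha : a ≠ 0) :
    (tangentInv W a).PosSemidef := by
  have := hW.posSemidef.conjTranspose_mul_mul_same (tangentInv W a)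
  rwa [(isHermitian_tangentInv hW a).eq, tangentInv_mul_mul_self hW ha] at this

theorem tangentTrace_nonneg (hW : W.PosDef) {a : Fin n → ℂ} (ha : a ≠ 0) (hF : F.PosSemidef) :
    0 ≤ tangentTrace W a F :=
  hF.re_trace_mul_nonneg (posSemidef_tangentInv hW ha)

/-- The trace of `(a - c)(a - c)*` is nonnegative. -/
theorem relTrace_cross_le (hW : W.PosDef) (a c : Fin n → ℂ) :
    relTrace W (Matrix.vecMulVec a (star c) + Matrix.vecMulVec c (star a)) ≤
      relTrace W (Matrix.vecMulVec a (star a)) + relTrace W (Matrix.vecMulVec c (star c)) := by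
  have h := relTrace_nonneg hW (Matrix.posSemidef_vecMulVec_self_star (a - c))
  rw [show Matrix.vecMulVec (a - c) (star (a - c)) =
    Matrix.vecMulVec a (star a) + Matrix.vecMulVec c (star c) -
      (Matrix.vecMulVec a (star c) + Matrix.vecMulVec c (star a)) by
    ext i j; simp [Matrix.vecMulVec_apply]; ring, relTrace_sub, relTrace_add] at h
  linarith

end LinearAlgebra

/-! ### Algebra of `ℳ`: the upper bound by a tangential trace, and concavity -/

section Comparison

variable {n : ℕ} {W G G' : Matrix (Fin n) (Fin n) ℂ}

/-- The smallest `μ i` is at most the weighted mean, and each of the other `n - 1` factors is at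
most the total sum. -/
theorem prod_le_mul_sum_pow {μ c : Fin n → ℝ} (hμ : ∀ i, 0 < μ i) (hc : ∀ i, 0 ≤ c i)
    (hc1 : ∑ i, c i = 1) :
    0 < ∑ i, c i * μ i ∧ ∏ i, μ i ≤ (∑ i, c i * μ i) * (∑ i, μ i) ^ (n - 1) := by
  have hne : (Finset.univ : Finset (Fin n)).Nonempty := by
    by_contra h
    rw [Finset.not_nonempty_iff_eq_empty] at h
    simp [h] at hc1
  obtain ⟨i₀, -, hi₀⟩ := Finset.exists_min_image _ μ hne
  have h1 : μ i₀ ≤ ∑ i, c i * μ i := by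
    calc μ i₀ = ∑ i, c i * μ i₀ := by rw [← Finset.sum_mul, hc1, one_mul]
      _ ≤ _ := Finset.sum_le_sum fun i hi ↦ mul_le_mul_of_nonneg_left (hi₀ i hi) (hc i)
  refine ⟨(hμ i₀).trans_le h1, ?_⟩
  rw [← Finset.mul_prod_erase _ _ (Finset.mem_univ i₀)]
  have h2 : ∏ i ∈ Finset.univ.erase i₀, μ i ≤ (∑ i, μ i) ^ (n - 1) := by
    calc _ ≤ ∏ _i ∈ (Finset.univ : Finset (Fin n)).erase i₀, ∑ i, μ i :=
          Finset.prod_le_prod (fun i _ ↦ (hμ i).le) fun i _ ↦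
            Finset.single_le_sum (f := μ) (fun j _ ↦ (hμ j).le) (Finset.mem_univ i)
      _ = _ := by
        rw [Finset.prod_const, Finset.card_erase_of_mem (Finset.mem_univ _), Finset.card_univ,
          Fintype.card_fin]
  exact mul_le_mul h1 h2 (Finset.prod_nonneg fun i _ ↦ (hμ i).le) ((hμ i₀).le.trans h1)

/-- The upper bound of `ℳ` in terms of the trace over a complex hyperplane. -/
theorem prod_pSums_le (hn : 1 ≤ n) (hW : W.PosDef) (hG : G.IsHermitian) {a : Fin n → ℂ} (ha : a ≠ 0)
    (hpos : ∀ s ∈ pSums (n - 1) (relEigenvalues W G), 0 < s) :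
    0 < tangentTrace W a G ∧ 0 ≤ relTrace W G ∧
      (pSums (n - 1) (relEigenvalues W G)).prod ≤
        tangentTrace W a G * (((n : ℝ) - 1) * relTrace W G) ^ (n - 1) := by
  obtain ⟨Y, Z, l, h1, h2, hWY, hGY⟩ := exists_simultaneous_diagonal hW hG
  have h3 : Yᴴ * Zᴴ = 1 := by rw [← Matrix.conjTranspose_mul, h2, Matrix.conjTranspose_one]
  have h4 : Zᴴ * Yᴴ = 1 := by rw [← Matrix.conjTranspose_mul, h1, Matrix.conjTranspose_one]
  have hr : relEigenvalues W G = Finset.univ.val.map l := by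
    rw [hWY, hGY, relEigenvalues_factor h1]
  rw [hr, pSums_pred hn] at hpos ⊢
  have hμ : ∀ i, 0 < ∑ j, l j - l i := fun i ↦
    hpos _ (Multiset.mem_map_of_mem _ (Finset.mem_univ_val i))
  have hWi : W⁻¹ = Zᴴ * 1 * Z := by rw [hWY, inv_eq_of_factor_one h1, Matrix.mul_one]
  have hτ : relTrace W G = ∑ i, l i := by
    rw [relTrace, hWi]
    conv_lhs => rw [hGY]
    rw [trace_factor_mul h2, Matrix.mul_one, Matrix.trace_diagonal, Complex.re_sum]
    rfl
  have hSE : tangentInv W a = Zᴴ * (Yᴴ * tangentInv W a * Y) * Z := by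
    calc tangentInv W a = (Zᴴ * Yᴴ) * tangentInv W a * (Y * Z) := by
          rw [h4, h1, Matrix.one_mul, Matrix.mul_one]
      _ = _ := by simp only [Matrix.mul_assoc]
  have hP : tangentTrace W a G = ∑ i, l i * ((Yᴴ * tangentInv W a * Y) i i).re := by
    rw [tangentTrace, hSE]
    conv_lhs => rw [hGY]
    rw [trace_factor_mul h2, Matrix.trace, Complex.re_sum, ← hSE]
    refine Finset.sum_congr rfl fun i _ ↦ ?_
    rw [Matrix.diag_apply, Matrix.diagonal_mul, Complex.re_ofReal_mul]
  -- In the basis in which `W` is the identity, this difference is the orthogonal projection onto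
  -- the line normal to the hyperplane. Its diagonal entries `c i` are therefore nonnegative with
  -- sum `1`.
  have hdiff : (1 : Matrix (Fin n) (Fin n) ℂ) - Yᴴ * tangentInv W a * Y =
      Yᴴ * ((Matrix.vecMulVec a (star a) * W⁻¹).trace⁻¹ •
        (W⁻¹ * Matrix.vecMulVec a (star a) * W⁻¹)) * Y := by
    have : (1 : Matrix (Fin n) (Fin n) ℂ) = Yᴴ * W⁻¹ * Y := by
      rw [hWi, Matrix.mul_one]
      calc (1 : Matrix (Fin n) (Fin n) ℂ) = (Yᴴ * Zᴴ) * (Z * Y) := by rw [h3, h2, Matrix.one_mul]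
        _ = _ := by simp only [Matrix.mul_assoc]
    rw [this, ← Matrix.sub_mul, ← Matrix.mul_sub, tangentInv, sub_sub_cancel]
  have htr : 0 < (Matrix.vecMulVec a (star a) * W⁻¹).trace := by
    rw [trace_vecMulVec_mul]
    exact hW.inv.dotProduct_mulVec_pos ha
  have hpsd : ((1 : Matrix (Fin n) (Fin n) ℂ) - Yᴴ * tangentInv W a * Y).PosSemidef := by
    rw [hdiff]
    refine Matrix.PosSemidef.conjTranspose_mul_mul_same (Matrix.PosSemidef.smul ?_ (inv_pos.2 htr).le) _
    have := (Matrix.posSemidef_vecMulVec_self_star a).conjTranspose_mul_mul_same W⁻¹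
    rwa [hW.inv.isHermitian.eq] at this
  have hsum : ∑ i, (((1 : Matrix (Fin n) (Fin n) ℂ) - Yᴴ * tangentInv W a * Y) i i).re = 1 := by
    have hdet := (Matrix.isUnit_iff_isUnit_det _).1 hW.isUnit
    have : ((1 : Matrix (Fin n) (Fin n) ℂ) - Yᴴ * tangentInv W a * Y).trace = 1 := by
      rw [hdiff, Matrix.trace_mul_comm, ← Matrix.mul_assoc, ← hWY, Matrix.mul_smul,
        Matrix.trace_smul, ← Matrix.mul_assoc, ← Matrix.mul_assoc, Matrix.mul_nonsing_inv _ hdet,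
        Matrix.one_mul, smul_eq_mul, inv_mul_cancel₀ htr.ne']
    rw [← Complex.re_sum]
    exact congrArg Complex.re this
  have hc : ∀ i, 0 ≤ (((1 : Matrix (Fin n) (Fin n) ℂ) - Yᴴ * tangentInv W a * Y) i i).re :=
    fun i ↦ (Complex.le_def.1 (hpsd.diag_nonneg (i := i))).1
  set c : Fin n → ℝ := fun i ↦ (((1 : Matrix (Fin n) (Fin n) ℂ) - Yᴴ * tangentInv W a * Y) i i).re
    with hcdef
  have hce : ∀ i, ((Yᴴ * tangentInv W a * Y) i i).re = 1 - c i := fun i ↦ by simp [hcdef]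
  -- Since the weights have sum `1`, `∑ (1 - c i) l i = ∑ c i (∑ l - l i)`: the tangential trace is
  -- a weighted mean of the factors of `ℳ`.
  have hP' : tangentTrace W a G = ∑ i, c i * (∑ j, l j - l i) := by
    rw [hP]
    simp only [hce, mul_sub, Finset.sum_sub_distrib, ← Finset.sum_mul, hsum, mul_one, one_mul]
    simp only [mul_comm]
  have hμs : ∑ i, (∑ j, l j - l i) = ((n : ℝ) - 1) * relTrace W G := by
    rw [hτ, Finset.sum_sub_distrib, Finset.sum_const, Finset.card_univ, Fintype.card_fin]
    simp; ring
  obtain ⟨k1, k2⟩ := prod_le_mul_sum_pow hμ hc hsum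
  rw [← hP'] at k1 k2
  refine ⟨k1, ?_, ?_⟩
  · have hs : 0 ≤ ((n : ℝ) - 1) * relTrace W G := hμs ▸ Finset.sum_nonneg fun i _ ↦ (hμ i).le
    rcases Nat.lt_or_ge 1 n with h | h
    · have : (0 : ℝ) < (n : ℝ) - 1 := by
        have : (1 : ℝ) < n := by exact_mod_cast h
        linarith
      exact nonneg_of_mul_nonneg_right hs this
    -- For `n = 1` the only factor of `ℳ` is an empty sum, which is not positive.
    · obtain rfl : n = 1 := le_antisymm h hn
      have := hμ 0
      simp at this
  · rw [← hμs]
    exact k2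

theorem posDef_factor {Y Z D : Matrix (Fin n) (Fin n) ℂ} (h1 : Y * Z = 1) (hD : D.PosDef) :
    (Y * D * Yᴴ).PosDef := by
  have : IsUnit Y := IsUnit.of_mul_eq_one Z h1
  exact (Matrix.IsUnit.posDef_star_right_conjugate_iff this).2 hD

/-- The (traced) adjugate form `tr(G) W - G`. -/
def traceSub (W G : Matrix (Fin n) (Fin n) ℂ) : Matrix (Fin n) (Fin n) ℂ :=
  (G * W⁻¹).trace • W - G

/-- The coefficients of the linearised operator at `G`, up to a positive factor. -/
def linearizedCoeff (W G : Matrix (Fin n) (Fin n) ℂ) : Matrix (Fin n) (Fin n) ℂ :=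
  ((traceSub W G)⁻¹ * W).trace • W⁻¹ - (traceSub W G)⁻¹

theorem traceSub_factor {Y Z : Matrix (Fin n) (Fin n) ℂ} (h1 : Y * Z = 1) (l : Fin n → ℝ) :
    traceSub (Y * Yᴴ) (Y * Matrix.diagonal (fun i ↦ (l i : ℂ)) * Yᴴ) =
      Y * Matrix.diagonal (fun i ↦ ((∑ j, l j - l i : ℝ) : ℂ)) * Yᴴ := by
  have h2 := mul_eq_one_comm.1 h1
  have : Matrix.diagonal (fun i ↦ ((∑ j, l j - l i : ℝ) : ℂ)) =
      ((∑ j, l j : ℝ) : ℂ) • (1 : Matrix (Fin n) (Fin n) ℂ) - Matrix.diagonal (fun i ↦ (l i : ℂ)) := by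
    rw [← Matrix.diagonal_one, ← Matrix.diagonal_smul, Matrix.diagonal_sub]
    congr 1
    ext i
    simp
  rw [this, Matrix.mul_sub, Matrix.sub_mul, Matrix.mul_smul, Matrix.mul_one, Matrix.smul_mul,
    traceSub, inv_eq_of_factor_one h1]
  congr 2
  have := trace_factor_mul h2 (D := Matrix.diagonal (fun i ↦ (l i : ℂ))) (E := 1)
  rw [Matrix.mul_one, Matrix.mul_one] at this
  rw [this, Matrix.trace_diagonal]
  simp

theorem posDef_diagonal_ofReal {d : Fin n → ℝ} (hd : ∀ i, 0 < d i) :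
    (Matrix.diagonal fun i ↦ (d i : ℂ)).PosDef :=
  Matrix.PosDef.diagonal fun i ↦ by exact_mod_cast hd i

/-- In a common diagonalising basis `tr(G) W - G` has the eigenvalues `tr - λ_i`. Thus `ℳ` is the
determinant of this form relative to `W`, and admissibility is its positivity. -/
theorem posDef_traceSub (hn : 1 ≤ n) (hW : W.PosDef) (hG : G.IsHermitian)
    (hpos : ∀ s ∈ pSums (n - 1) (relEigenvalues W G), 0 < s) :
    (traceSub W G).PosDef ∧
      (traceSub W G).det = W.det * ((pSums (n - 1) (relEigenvalues W G)).prod : ℝ) := by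
  obtain ⟨Y, Z, l, h1, h2, rfl, rfl⟩ := exists_simultaneous_diagonal hW hG
  rw [relEigenvalues_factor h1, pSums_pred hn] at hpos ⊢
  have hμ : ∀ i, 0 < ∑ j, l j - l i := fun i ↦
    hpos _ (Multiset.mem_map_of_mem _ (Finset.mem_univ_val i))
  rw [traceSub_factor h1]
  refine ⟨posDef_factor h1 (posDef_diagonal_ofReal hμ), ?_⟩
  rw [Matrix.det_mul, Matrix.det_mul, Matrix.det_mul, Matrix.det_diagonal]
  change _ = _ * ((∏ i, (∑ j, l j - l i) : ℝ) : ℂ)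
  rw [Complex.ofReal_prod]
  ring

/-- The eigenvalues in the diagonalising basis are the sums of `1/μ_j` over `j ≠ i`, where `μ_j` are
the factors of `ℳ`. For `n ≥ 2` these sums are nonempty, hence positive: the linearised operator is
elliptic. -/
theorem posDef_linearizedCoeff (hn : 2 ≤ n) (hW : W.PosDef) (hG : G.IsHermitian)
    (hpos : ∀ s ∈ pSums (n - 1) (relEigenvalues W G), 0 < s) : (linearizedCoeff W G).PosDef := by
  obtain ⟨Y, Z, l, h1, h2, rfl, rfl⟩ := exists_simultaneous_diagonal hW hG
  rw [relEigenvalues_factor h1, pSums_pred (by omega)] at hpos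
  have hμ : ∀ i, 0 < ∑ j, l j - l i := fun i ↦
    hpos _ (Multiset.mem_map_of_mem _ (Finset.mem_univ_val i))
  set μ : Fin n → ℝ := fun i ↦ ∑ j, l j - l i with hμdef
  have hD : Matrix.diagonal (fun i ↦ (μ i : ℂ)) * Matrix.diagonal (fun i ↦ (((μ i)⁻¹ : ℝ) : ℂ)) = 1 := by
    rw [Matrix.diagonal_mul_diagonal, ← Matrix.diagonal_one]
    congr 1
    ext i
    rw [← Complex.ofReal_mul, mul_inv_cancel₀ (hμ i).ne', Complex.ofReal_one]
  rw [linearizedCoeff, traceSub_factor h1, inv_eq_of_factor h1 hD, inv_eq_of_factor_one h1]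
  have htr : (Zᴴ * Matrix.diagonal (fun i ↦ (((μ i)⁻¹ : ℝ) : ℂ)) * Z * (Y * Yᴴ)).trace =
      ((∑ j, (μ j)⁻¹ : ℝ) : ℂ) := by
    have := trace_factor_mul h2 (D := 1) (E := Matrix.diagonal (fun i ↦ (((μ i)⁻¹ : ℝ) : ℂ)))
    rw [Matrix.mul_one, Matrix.one_mul] at this
    rw [Matrix.trace_mul_comm, this, Matrix.trace_diagonal, Complex.ofReal_sum]
  rw [htr]
  have : ((∑ j, (μ j)⁻¹ : ℝ) : ℂ) • (Zᴴ * Z) - Zᴴ * Matrix.diagonal (fun i ↦ (((μ i)⁻¹ : ℝ) : ℂ)) * Z =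
      Zᴴ * Matrix.diagonal (fun i ↦ ((∑ j, (μ j)⁻¹ - (μ i)⁻¹ : ℝ) : ℂ)) * Z := by
    have : Matrix.diagonal (fun i ↦ ((∑ j, (μ j)⁻¹ - (μ i)⁻¹ : ℝ) : ℂ)) =
        ((∑ j, (μ j)⁻¹ : ℝ) : ℂ) • (1 : Matrix (Fin n) (Fin n) ℂ) -
          Matrix.diagonal (fun i ↦ (((μ i)⁻¹ : ℝ) : ℂ)) := by
      rw [← Matrix.diagonal_one, ← Matrix.diagonal_smul, Matrix.diagonal_sub]
      congr 1
      ext i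
      simp
    rw [this, Matrix.mul_sub, Matrix.sub_mul, Matrix.mul_smul, Matrix.mul_one, Matrix.smul_mul]
  rw [this]
  have h3 : Zᴴ * Yᴴ = 1 := by rw [← Matrix.conjTranspose_mul, h1, Matrix.conjTranspose_one]
  have key := posDef_factor h3 (posDef_diagonal_ofReal (d := fun i ↦ ∑ j, (μ j)⁻¹ - (μ i)⁻¹) fun i ↦ ?_)
  · rwa [Matrix.conjTranspose_conjTranspose] at key
  · obtain ⟨k, hk⟩ : ∃ k : Fin n, k ≠ i := by
      have : Nontrivial (Fin n) := Fin.nontrivial_iff_two_le.2 hn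
      exact exists_ne i
    rw [← Finset.add_sum_erase _ _ (Finset.mem_univ i), add_sub_cancel_left]
    exact Finset.sum_pos (fun j _ ↦ inv_pos.2 (hμ j)) ⟨k, Finset.mem_erase.2 ⟨hk, Finset.mem_univ k⟩⟩

/-- The arithmetic–geometric mean inequality, from `log t ≤ t - 1`. -/
theorem card_le_sum_of_one_le_prod {m : Fin n → ℝ} (hm : ∀ i, 0 < m i) (h : 1 ≤ ∏ i, m i) :
    (n : ℝ) ≤ ∑ i, m i := by
  have h1 : 0 ≤ ∑ i, Real.log (m i) := by
    rw [← Real.log_prod (fun i _ ↦ (hm i).ne')]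
    exact Real.log_nonneg h
  have h2 : ∑ i, Real.log (m i) ≤ ∑ i, (m i - 1) :=
    Finset.sum_le_sum fun i _ ↦ Real.log_le_sub_one_of_pos (hm i)
  rw [Finset.sum_sub_distrib] at h2
  simp at h2
  linarith

/-- The linearised operator at `G` is nonnegative on `G' - G` if `ℳ(G) ≤ ℳ(G')`. -/
theorem linearized_nonneg (hn : 1 ≤ n) (hW : W.PosDef) (hG : G.IsHermitian) (hG' : G'.IsHermitian)
    (hpos : ∀ s ∈ pSums (n - 1) (relEigenvalues W G), 0 < s)
    (hpos' : ∀ s ∈ pSums (n - 1) (relEigenvalues W G'), 0 < s)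
    (hle : (pSums (n - 1) (relEigenvalues W G)).prod ≤ (pSums (n - 1) (relEigenvalues W G')).prod) :
    0 ≤ ((G' - G) * linearizedCoeff W G).trace.re := by
  obtain ⟨hQ, hdQ⟩ := posDef_traceSub hn hW hG hpos
  obtain ⟨hQ', hdQ'⟩ := posDef_traceSub hn hW hG' hpos'
  have hpr : 0 < (pSums (n - 1) (relEigenvalues W G)).prod := by
    refine Multiset.prod_pos ?_
    exact hpos
  -- With `Q = traceSub W G` and `Q' = traceSub W G'`, the pairing is `tr((Q' - Q)Q⁻¹)`, the
  -- differential of `log det` at `Q` applied to `Q' - Q`.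
  have hlin : ((G' - G) * linearizedCoeff W G).trace =
      ((traceSub W G' - traceSub W G) * (traceSub W G)⁻¹).trace := by
    have : traceSub W G' - traceSub W G = ((G' - G) * W⁻¹).trace • W - (G' - G) := by
      rw [traceSub, traceSub, Matrix.sub_mul, Matrix.trace_sub, sub_smul]
      abel
    rw [this, linearizedCoeff, Matrix.mul_sub (G' - G), Matrix.sub_mul (_ • W), Matrix.trace_sub,
      Matrix.trace_sub, Matrix.mul_smul, Matrix.smul_mul, Matrix.trace_smul, Matrix.trace_smul,
      Matrix.trace_mul_comm W, smul_eq_mul, smul_eq_mul, mul_comm]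
  have htr : ((traceSub W G' - traceSub W G) * (traceSub W G)⁻¹).trace =
      (traceSub W G' * (traceSub W G)⁻¹).trace - n := by
    rw [Matrix.sub_mul, Matrix.trace_sub,
      Matrix.mul_nonsing_inv _ ((Matrix.isUnit_iff_isUnit_det _).1 hQ.isUnit), Matrix.trace_one,
      Fintype.card_fin]
  -- The eigenvalues `m` of `Q'` relative to `Q` have product `ℳ(G')/ℳ(G) ≥ 1`, so their sum is at
  -- least `n`. This is the concavity of `log det`.
  obtain ⟨Y, Z, m, h1, h2, hQY, hQ'Y⟩ := exists_simultaneous_diagonal hQ hQ'.isHermitian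
  have h4 : Zᴴ * Yᴴ = 1 := by rw [← Matrix.conjTranspose_mul, h1, Matrix.conjTranspose_one]
  have hm : ∀ i, 0 < m i := by
    intro i
    have : (Matrix.diagonal fun i ↦ (m i : ℂ)).PosDef := by
      have hu : IsUnit Y := IsUnit.of_mul_eq_one Z h1
      rw [hQ'Y] at hQ'
      exact (Matrix.IsUnit.posDef_star_right_conjugate_iff hu).1 hQ'
    exact_mod_cast Matrix.posDef_diagonal_iff.1 this i
  have hdm : (traceSub W G').det = (traceSub W G).det * ((∏ i, m i : ℝ) : ℂ) := by
    conv_lhs => rw [hQ'Y]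
    conv_rhs => rw [hQY]
    rw [Matrix.det_mul, Matrix.det_mul, Matrix.det_mul, Matrix.det_diagonal, Complex.ofReal_prod]
    ring
  have hprod : 1 ≤ ∏ i, m i := by
    rw [hdQ, hdQ', mul_assoc, ← Complex.ofReal_mul] at hdm
    have hWd : W.det ≠ 0 := hW.det_pos.ne'
    have := Complex.ofReal_injective (mul_left_cancel₀ hWd hdm)
    rw [this] at hle
    exact le_of_mul_le_mul_left (by linarith) hpr
  have hs : (traceSub W G' * (traceSub W G)⁻¹).trace = ((∑ i, m i : ℝ) : ℂ) := by
    conv_lhs => rw [hQ'Y, hQY]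
    rw [inv_eq_of_factor_one h1]
    have := trace_factor_mul h2 (D := Matrix.diagonal (fun i ↦ (m i : ℂ))) (E := 1)
    rw [Matrix.mul_one, Matrix.mul_one] at this
    rw [this, Matrix.trace_diagonal, Complex.ofReal_sum]
  rw [hlin, htr, hs]
  have := card_le_sum_of_one_le_prod hm hprod
  simp only [Complex.sub_re, Complex.ofReal_re, Complex.natCast_re]
  linarith

theorem sum_relEigenvalues {m : ℕ} (W G : Matrix (Fin m) (Fin m) ℂ) :
    (relEigenvalues W G).sum = (G * W⁻¹).trace.re := by
  rw [relEigenvalues, Matrix.trace_eq_sum_roots_charpoly]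
  exact (map_multiset_sum Complex.reAddGroupHom _).symm

/-- For a basis (the rows of `Ξ`) of the hyperplane defined by `a`. -/
theorem conjTranspose_mul_inv_mul_eq_tangentInv (hn : 1 ≤ n) (hW : W.PosDef) {a : Fin n → ℂ}
    (ha : a ≠ 0)
    {Ξ : Matrix (Fin (n - 1)) (Fin n) ℂ} (hΞ : LinearIndependent ℂ (fun i ↦ Ξ i)) (hΞa : Ξ *ᵥ a = 0) :
    Ξᴴ * (Ξ * W * Ξᴴ)⁻¹ * Ξ = tangentInv W a := by
  have hdet := (Matrix.isUnit_iff_isUnit_det _).1 hW.isUnit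
  have hinj : Function.Injective Ξ.vecMul := Matrix.vecMul_injective_iff.2 hΞ
  have hK : (Ξ * W * Ξᴴ).PosDef := hW.mul_mul_conjTranspose_same hinj
  have hKdet := (Matrix.isUnit_iff_isUnit_det _).1 hK.isUnit
  have haΞ : star a ᵥ* Ξᴴ = 0 := by rw [← Matrix.star_mulVec, hΞa, star_zero]
  set T := Ξᴴ * (Ξ * W * Ξᴴ)⁻¹ * Ξ with hT
  set c := (Matrix.vecMulVec a (star a) * W⁻¹).trace with hc
  have hc0 : c ≠ 0 := trace_vecMulVec_inv_ne_zero hW ha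
  have hcv : c = star a ⬝ᵥ (W⁻¹ *ᵥ a) := by rw [hc, trace_vecMulVec_mul]
  -- The difference kills `W y` for `y` in the range of `Ξᴴ`, and kills `a = W(W⁻¹a)`. That range is
  -- the orthogonal complement of `a`, and `W⁻¹a` is transverse to it, so the difference is zero.
  have hE1 : (T - tangentInv W a) * W * Ξᴴ = 0 := by
    have k1 : T * W * Ξᴴ = Ξᴴ := by
      calc T * W * Ξᴴ = Ξᴴ * ((Ξ * W * Ξᴴ)⁻¹ * (Ξ * W * Ξᴴ)) := by
            rw [hT]; simp only [Matrix.mul_assoc]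
        _ = Ξᴴ := by rw [Matrix.nonsing_inv_mul _ hKdet, Matrix.mul_one]
    have k2 : tangentInv W a * W * Ξᴴ = Ξᴴ := by
      rw [tangentInv, Matrix.sub_mul, Matrix.nonsing_inv_mul _ hdet, Matrix.smul_mul,
        Matrix.mul_assoc _ W⁻¹ W, Matrix.nonsing_inv_mul _ hdet, Matrix.mul_one, Matrix.sub_mul,
        Matrix.one_mul, Matrix.smul_mul, Matrix.mul_assoc W⁻¹, Matrix.vecMulVec_mul _ _ Ξᴴ, haΞ,
        show Matrix.vecMulVec a (0 : Fin (n - 1) → ℂ) = 0 by ext; simp [Matrix.vecMulVec_apply],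
        Matrix.mul_zero, smul_zero, sub_zero]
    rw [Matrix.sub_mul, Matrix.sub_mul, k1, k2, sub_self]
  have hE2 : (T - tangentInv W a) *ᵥ a = 0 := by
    have k1 : T *ᵥ a = 0 := by rw [hT, ← Matrix.mulVec_mulVec, hΞa, Matrix.mulVec_zero]
    have k2 : tangentInv W a *ᵥ a = 0 := by
      have := tangentInv_mul_vecMulVec hW ha (star a)
      rw [Matrix.mul_vecMulVec] at this
      have hsa : star a ≠ 0 := by simpa using ha
      simpa [Matrix.vecMulVec_eq_zero, hsa] using this
    rw [Matrix.sub_mulVec, k1, k2, sub_self]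
  have hrange : ∀ y : Fin n → ℂ, star a ⬝ᵥ y = 0 → ∃ x, Ξᴴ *ᵥ x = y := by
    let f := Ξᴴ.mulVecLin
    let φ := dotProductBilin ℂ ℂ (star a)
    have hfinj : Function.Injective f := by
      rw [← LinearMap.ker_eq_bot, LinearMap.ker_eq_bot']
      intro x hx
      have hx' : star x ᵥ* Ξ = 0 ᵥ* Ξ := by
        rw [Matrix.zero_vecMul, ← star_eq_zero, Matrix.star_vecMul, star_star]
        exact hx
      simpa using hinj hx'
    have hle : LinearMap.range f ≤ LinearMap.ker φ := by
      rintro _ ⟨x, rfl⟩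
      change star a ⬝ᵥ (Ξᴴ *ᵥ x) = 0
      rw [Matrix.dotProduct_mulVec, haΞ, zero_dotProduct]
    have hφ : φ ≠ 0 := by
      intro h0
      have : star a ⬝ᵥ a = 0 := LinearMap.congr_fun h0 a
      exact ha (dotProduct_star_self_eq_zero.1 this)
    have hfr : Module.finrank ℂ (LinearMap.range f) = Module.finrank ℂ (LinearMap.ker φ) := by
      rw [LinearMap.finrank_range_of_inj hfinj]
      have h1 := LinearMap.finrank_range_add_finrank_ker φ
      rw [LinearMap.range_eq_top.2 (LinearMap.surjective hφ), finrank_top] at h1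
      simp at h1 ⊢
      omega
    intro y hy
    have : y ∈ LinearMap.range f := by
      rw [Submodule.eq_of_le_of_finrank_eq hle hfr]
      exact hy
    exact this
  have hall : ∀ x, (T - tangentInv W a) *ᵥ (W *ᵥ x) = 0 := by
    intro x
    obtain ⟨y, hy⟩ := hrange (x - (c⁻¹ * (star a ⬝ᵥ x)) • (W⁻¹ *ᵥ a)) (by
      rw [dotProduct_sub, dotProduct_smul, ← hcv, smul_eq_mul]
      field_simp
      ring)
    have hx : x = Ξᴴ *ᵥ y + (c⁻¹ * (star a ⬝ᵥ x)) • (W⁻¹ *ᵥ a) := by rw [hy]; abel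
    rw [hx, Matrix.mulVec_add, Matrix.mulVec_add, Matrix.mulVec_mulVec, Matrix.mulVec_mulVec, hE1, Matrix.zero_mulVec, zero_add, Matrix.mulVec_smul, Matrix.mulVec_smul,
      Matrix.mulVec_mulVec, Matrix.mulVec_mulVec, Matrix.mul_assoc, Matrix.mul_nonsing_inv _ hdet, Matrix.mul_one, hE2,
      smul_zero]
  have hzero : (T - tangentInv W a) * W = 0 := by
    ext1 i j
    have := congrFun (hall (Pi.single j 1)) i
    rw [Matrix.mulVec_mulVec] at this
    simpa using this
  have : T - tangentInv W a = 0 := by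
    calc T - tangentInv W a = (T - tangentInv W a) * W * W⁻¹ := by
          rw [Matrix.mul_assoc, Matrix.mul_nonsing_inv _ hdet, Matrix.mul_one]
      _ = 0 := by rw [hzero, Matrix.zero_mul]
  exact sub_eq_zero.1 this

/-- Cyclicity of the trace and the previous formula remove the frame. The restricted trace becomes
an expression in `W` and `a = ∂ρ` that is defined at interior points too, where the barrier argument
takes place. -/
theorem sum_relEigenvalues_restrict (hn : 1 ≤ n) (hW : W.PosDef) {a : Fin n → ℂ} (ha : a ≠ 0)
    {Ξ : Matrix (Fin (n - 1)) (Fin n) ℂ} (hΞ : LinearIndependent ℂ (fun i ↦ Ξ i)) (hΞa : Ξ *ᵥ a = 0) :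
    (relEigenvalues (Ξ * W * Ξᴴ) (Ξ * G * Ξᴴ)).sum = tangentTrace W a G := by
  rw [sum_relEigenvalues, tangentTrace, ← conjTranspose_mul_inv_mul_eq_tangentInv hn hW ha hΞ hΞa,
    Matrix.mul_assoc, Matrix.mul_assoc, Matrix.trace_mul_comm]
  simp only [Matrix.mul_assoc]

end Comparison

/-! ### Coordinate balls, and the components that meet the boundary -/

section Basic

variable {n : ℕ} {M : Type*}

theorem sqDist_nonneg (z : M → (Fin n → ℂ)) (y : Fin n → ℂ) (x : M) : 0 ≤ sqDist z y x :=
  Finset.sum_nonneg fun _ _ ↦ Complex.normSq_nonneg _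

theorem sqDist_self (z : M → (Fin n → ℂ)) (x : M) : sqDist z (z x) x = 0 := by
  simp [sqDist]

theorem sqDist_le_two_mul (z : M → (Fin n → ℂ)) (w y : Fin n → ℂ) (p x : M) (hy : y = z p) :
    sqDist z w x ≤ 2 * sqDist z y x + 2 * sqDist z w p := by
  subst hy
  unfold sqDist
  rw [Finset.mul_sum, Finset.mul_sum, ← Finset.sum_add_distrib]
  refine Finset.sum_le_sum fun j _ ↦ ?_
  simp only [Complex.normSq_apply, Complex.sub_re, Complex.sub_im]
  nlinarith [sq_nonneg ((z x j).re - (z p j).re - ((z p j).re - (w j).re)),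
    sq_nonneg ((z x j).im - (z p j).im - ((z p j).im - (w j).im))]

variable [NeZero n] [TopologicalSpace M] [ChartedSpace (EuclideanHalfSpace (2 * n)) M]
  {J : ∀ p : M, TangentSpace (𝓡∂ (2 * n)) p →L[ℝ] TangentSpace (𝓡∂ (2 * n)) p}
  {U : Set M} {z : M → (Fin n → ℂ)}

theorem IsHolomorphicChart.continuousOn_sqDist (h : IsHolomorphicChart J U z) (y : Fin n → ℂ) :
    ContinuousOn (sqDist z y) U :=
  (h.contMDiffOn_sqDist y (k := 1)).continuousOn

theorem IsHolomorphicChart.continuousOn (h : IsHolomorphicChart J U z) : ContinuousOn z U :=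
  h.contMDiffOn.continuousOn

theorem IsHolomorphicChart.sqDist_lt_mem_nhds (h : IsHolomorphicChart J U z) {q : M} (hq : q ∈ U)
    {y : Fin n → ℂ} {r : ℝ} (hr : sqDist z y q < r) : {x | x ∈ U ∧ sqDist z y x < r} ∈ 𝓝 q := by
  have h1 := ((h.continuousOn_sqDist y).continuousAt (h.isOpen.mem_nhds hq)).eventually
    (gt_mem_nhds hr)
  exact Filter.inter_mem (h.isOpen.mem_nhds hq) h1

/-- Near a boundary point the image of the chart is not open in `ℂⁿ`, so compactness comes from `M`
itself: the chart is an embedding, and a small coordinate ball lies inside a compact neighbourhood.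
-/
theorem IsHolomorphicChart.exists_isCompact_ball [T2Space M] [CompactSpace M]
    (h : IsHolomorphicChart J U z) {p : M} (hp : p ∈ U) {N : Set M} (hN : N ∈ 𝓝 p) :
    ∃ R > 0, IsCompact {x | x ∈ U ∧ sqDist z (z p) x ≤ R} ∧
      {x | x ∈ U ∧ sqDist z (z p) x ≤ R} ⊆ N := by
  obtain ⟨K, hK, hKU, hKc⟩ := local_compact_nhds (Filter.inter_mem (h.isOpen.mem_nhds hp) hN)
  have h1 : (Subtype.val ⁻¹' K : Set U) ∈ 𝓝 (⟨p, hp⟩ : U) :=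
    continuous_subtype_val.continuousAt.preimage_mem_nhds hK
  rw [h.isEmbedding.nhds_eq_comap, Filter.mem_comap] at h1
  obtain ⟨V, hV, hVK⟩ := h1
  obtain ⟨ε, hε, hεV⟩ := Metric.mem_nhds_iff.1 hV
  have hsub : {x | x ∈ U ∧ sqDist z (z p) x ≤ ε ^ 2 / 2} ⊆ K := by
    rintro x ⟨hxU, hx⟩
    refine @hVK ⟨x, hxU⟩ (hεV ?_)
    rw [Metric.mem_ball, dist_pi_lt_iff hε]
    intro j
    have h2 : Complex.normSq (z x j - z p j) ≤ ε ^ 2 / 2 :=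
      (Finset.single_le_sum (f := fun j ↦ Complex.normSq (z x j - z p j))
        (fun i _ ↦ Complex.normSq_nonneg _) (Finset.mem_univ j)).trans hx
    rw [Complex.normSq_eq_norm_sq] at h2
    change dist (z x j) (z p j) < ε
    rw [dist_eq_norm]
    nlinarith [sq_nonneg (‖z x j - z p j‖ - ε), norm_nonneg (z x j - z p j), sq_nonneg ε]
  refine ⟨ε ^ 2 / 2, by positivity, ?_, fun x hx ↦ (hKU (hsub hx)).2⟩
  have heq : {x | x ∈ U ∧ sqDist z (z p) x ≤ ε ^ 2 / 2} =
      K ∩ sqDist z (z p) ⁻¹' Iic (ε ^ 2 / 2) := by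
    ext x
    exact ⟨fun hx ↦ ⟨hsub hx, hx.2⟩, fun hx ↦ ⟨(hKU hx.1).1, hx.2⟩⟩
  rw [heq]
  refine hKc.of_isClosed_subset ?_ inter_subset_left
  exact ((h.continuousOn_sqDist _).mono fun x hx ↦ (hKU hx).1).preimage_isClosed_of_isClosed
    hKc.isClosed isClosed_Iic

/-- The union of the connected components that meet the boundary. -/
def boundaryComponents (n : ℕ) [NeZero n] (M : Type*) [TopologicalSpace M]
    [ChartedSpace (EuclideanHalfSpace (2 * n)) M] : Set M :=
  {x | ∃ b ∈ (𝓡∂ (2 * n)).boundary M, b ∈ connectedComponent x}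

/-- Components are open because `M` is locally connected. The global estimates are made on this
compact open set; boundary values give no control on a component without boundary. -/
theorem isClopen_boundaryComponents : IsClopen (boundaryComponents n M) := by
  have : LocallyConnectedSpace M :=
    ChartedSpace.locallyConnectedSpace (EuclideanHalfSpace (2 * n)) M
  have key : ∀ x y : M, y ∈ connectedComponent x →
      (x ∈ boundaryComponents n M ↔ y ∈ boundaryComponents n M) := by
    intro x y hy
    unfold boundaryComponents
    rw [mem_ofPred_eq, mem_ofPred_eq, connectedComponent_eq hy]
  constructor
  · rw [← isOpen_compl_iff, isOpen_iff_mem_nhds]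
    intro x hx
    filter_upwards [isOpen_connectedComponent.mem_nhds (mem_connectedComponent (x := x))] with y hy
    exact fun h' ↦ hx ((key x y hy).2 h')
  · rw [isOpen_iff_mem_nhds]
    intro x hx
    filter_upwards [isOpen_connectedComponent.mem_nhds (mem_connectedComponent (x := x))] with y hy
    exact (key x y hy).1 hx

theorem boundary_subset_boundaryComponents :
    (𝓡∂ (2 * n)).boundary M ⊆ boundaryComponents n M :=
  fun b hb ↦ ⟨b, hb, mem_connectedComponent⟩

end Basic

/-! ### The strong minimum principle, uniform along a family -/

section MinPrinciple

variable {n : ℕ} [NeZero n] {M : Type*} [TopologicalSpace M]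
  [ChartedSpace (EuclideanHalfSpace (2 * n)) M] [IsManifold (𝓡∂ (2 * n)) ∞ M]
  {J : ∀ p : M, TangentSpace (𝓡∂ (2 * n)) p →L[ℝ] TangentSpace (𝓡∂ (2 * n)) p}
  {U : Set M} {z : M → (Fin n → ℂ)}

/-- A negative minimum over the compact set `A` would be an interior local minimum, and the complex
Hessian is nonnegative there. -/
theorem nonneg_of_not_posSemidef (h : IsHolomorphicChart J U z) {A : Set M} (hA : IsCompact A)
    (hAU : A ⊆ U) {f : M → ℝ} (hf : ContMDiffOn (𝓡∂ (2 * n)) 𝓘(ℝ, ℝ) 2 f U)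
    (H : ∀ q ∈ A, f q < 0 → A ∈ 𝓝 q ∧ (𝓡∂ (2 * n)).IsInteriorPoint q ∧
      ¬ (complexHessian z f q).PosSemidef) :
    ∀ q ∈ A, 0 ≤ f q := by
  intro q hq
  obtain ⟨p, hp, hmin⟩ := hA.exists_isMinOn ⟨q, hq⟩ (hf.continuousOn.mono hAU)
  by_contra hneg
  push Not at hneg
  obtain ⟨h1, h2, h3⟩ := H p hp ((hmin hq).trans_lt hneg)
  exact h3 (posSemidef_complexHessian_of_isLocalMin h hf (hAU hp) h2 (hmin.isLocalMin h1))

theorem IsCompact.inter_preimage_isClosed [T2Space M] {B : Set M} (hB : IsCompact B) {f : M → ℝ}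
    (hf : ContinuousOn f B) {t : Set ℝ} (ht : IsClosed t) : IsCompact (B ∩ f ⁻¹' t) :=
  hB.of_isClosed_subset (hf.preimage_isClosed_of_isClosed hB.isClosed ht) inter_subset_left

/-- Along the filter `l`, the functions `v i` are bounded below by a positive constant near `x`. -/
def EventuallyPosNear {ι : Type*} (l : Filter ι) (v : ι → M → ℝ) (x : M) : Prop :=
  ∃ θ > 0, ∃ N ∈ 𝓝 x, ∀ᶠ i in l, ∀ q ∈ N, θ ≤ v i q

theorem isOpen_eventuallyPosNear {ι : Type*} (l : Filter ι) (v : ι → M → ℝ) :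
    IsOpen {x | EventuallyPosNear l v x} := by
  rw [isOpen_iff_mem_nhds]
  rintro x ⟨θ, hθ, N, hN, hv⟩
  filter_upwards [eventually_mem_nhds_iff.2 hN] with y hy
  exact ⟨θ, hθ, N, hy, hv⟩

theorem ContinuousOn.matrix_mul' {X : Type*} [TopologicalSpace X] {m : ℕ} {S : Set X}
    {F G : X → Matrix (Fin m) (Fin m) ℂ} (hF : ContinuousOn F S) (hG : ContinuousOn G S) :
    ContinuousOn (fun q ↦ F q * G q) S :=
  (continuous_fst.matrix_mul continuous_snd : Continuous fun A : Matrix (Fin m) (Fin m) ℂ ×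
    Matrix (Fin m) (Fin m) ℂ ↦ A.1 * A.2).comp_continuousOn (hF.prodMk hG)

theorem ContinuousOn.matrix_vecMulVec' {X : Type*} [TopologicalSpace X] {m : ℕ} {S : Set X}
    {a b : X → Fin m → ℂ} (ha : ContinuousOn a S) (hb : ContinuousOn b S) :
    ContinuousOn (fun q ↦ Matrix.vecMulVec (a q) (b q)) S :=
  (continuous_fst.matrix_vecMulVec continuous_snd : Continuous fun A : (Fin m → ℂ) × (Fin m → ℂ) ↦
    Matrix.vecMulVec A.1 A.2).comp_continuousOn (ha.prodMk hb)

theorem continuousOn_trace_re {X : Type*} [TopologicalSpace X] {m : ℕ} {S : Set X} {F : X → Matrix (Fin m) (Fin m) ℂ}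
    (hF : ContinuousOn F S) : ContinuousOn (fun q ↦ (F q).trace.re) S :=
  Complex.continuous_re.comp_continuousOn
    ((continuous_id.matrix_trace : Continuous fun A : Matrix (Fin m) (Fin m) ℂ ↦ A.trace).comp_continuousOn hF)

theorem exp_barrier_deriv (m α c : ℝ) :
    deriv (fun t ↦ m * (Real.exp (-α * t) - c)) = (fun t ↦ -(m * α) * Real.exp (-α * t)) ∧
    deriv (deriv (fun t ↦ m * (Real.exp (-α * t) - c))) =
      fun t ↦ m * α ^ 2 * Real.exp (-α * t) := by
  have h0 : ∀ t, HasDerivAt (fun t ↦ Real.exp (-α * t)) (Real.exp (-α * t) * (-α)) t := fun t ↦ by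
    simpa using ((hasDerivAt_id t).const_mul (-α)).exp
  have h1 : deriv (fun t ↦ m * (Real.exp (-α * t) - c)) =
      fun t ↦ -(m * α) * Real.exp (-α * t) := by
    ext t
    rw [(((h0 t).sub_const c).const_mul m).deriv]; ring
  refine ⟨h1, ?_⟩
  rw [h1]
  ext t
  rw [((h0 t).const_mul _).deriv]; ring

/-- Hopf's argument. Take a point `y` close to `x` at which `v ≥ θ > 0` is known, and compare `v` on
an annulus around `y` with `θ(exp(-αr) - c)`, `r` being the squared distance to `y`. For large `α`
the barrier is a strict subsolution, it is at most `θ` on the inner sphere and zero on the outer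
one, and it is positive near `x`. Strictness leaves room for the error `e` of an approximate
supersolution. -/
theorem eventuallyPosNear_of_mem_closure [T2Space M] [CompactSpace M] {ι : Type*} {l : Filter ι}
    {v : ι → M → ℝ} (h : IsHolomorphicChart J U z)
    (hv : ∀ i, ContMDiffOn (𝓡∂ (2 * n)) 𝓘(ℝ, ℝ) 2 (v i) U) {x : M} (hx : x ∈ U)
    (hxi : (𝓡∂ (2 * n)).IsInteriorPoint x)
    {C : M → Matrix (Fin n) (Fin n) ℂ} (hC : ContinuousOn C U) (hCpos : ∀ q ∈ U, (C q).PosDef)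
    {N : Set M} (hN : N ∈ 𝓝 x) (hv0 : ∀ᶠ i in l, ∀ q ∈ N, 0 ≤ v i q)
    (hve : ∀ e > 0, ∀ᶠ i in l, ∀ q ∈ N, (complexHessian z (v i) q * C q).trace.re ≤ e)
    (hcl : x ∈ closure {y | EventuallyPosNear l v y}) : EventuallyPosNear l v x := by
  have hint : {q | (𝓡∂ (2 * n)).IsInteriorPoint q} ∈ 𝓝 x :=
    ((𝓡∂ (2 * n)).isOpen_interior (M := M) (n := ∞) (by simp)).mem_nhds hxi
  obtain ⟨R, hR, hBc, hBN⟩ := h.exists_isCompact_ball hx (Filter.inter_mem hN hint)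
  set B := {q | q ∈ U ∧ sqDist z (z x) q ≤ R} with hB
  -- Distances are squared. With `y` within `R/16` of `x`, the ball `r ≤ R/4` about `y` stays in the
  -- ball of radius `R` about `x`, since `2·R/4 + 2·R/16 < R`; and `x` lies in `r < R/8`.
  obtain ⟨y, hyN, hygood⟩ := mem_closure_iff_nhds.1 hcl _
    (h.sqDist_lt_mem_nhds hx (y := z x) (r := R / 16) (by rw [sqDist_self]; positivity))
  obtain ⟨hyU, hyx⟩ := hyN
  obtain ⟨θ, hθ, N', hN', hvθ⟩ := hygood
  obtain ⟨s, hs, -, hsN'⟩ := h.exists_isCompact_ball hyU hN'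
  set r := sqDist z (z y) with hr
  have hsub : ∀ q ∈ U, r q ≤ R / 4 → sqDist z (z x) q < R := fun q _ hq ↦ by
    have := sqDist_le_two_mul z (z x) (z y) y q rfl
    rw [← hr] at this
    linarith
  have hrU : ContinuousOn r U := h.continuousOn_sqDist _
  set A := B ∩ r ⁻¹' Icc s (R / 4) with hA
  have hBU : B ⊆ U := fun q hq ↦ hq.1
  have hAU : A ⊆ U := fun q hq ↦ hq.1.1
  have hAc : IsCompact A := hBc.inter_preimage_isClosed (hrU.mono hBU) isClosed_Icc
  have hgrad : ContinuousOn (fun q ↦ star (z q - z y)) U :=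
    (h.continuousOn.sub continuousOn_const).star
  have hgc : ContinuousOn (fun q ↦ (Matrix.vecMulVec (star (z q - z y)) (star (star (z q - z y))) *
      C q).trace.re) A := by
    refine continuousOn_trace_re (ContinuousOn.matrix_mul' ?_ (hC.mono hAU))
    exact (hgrad.matrix_vecMulVec' hgrad.star).mono hAU
  have hgpos : ∀ q ∈ A, 0 < (Matrix.vecMulVec (star (z q - z y)) (star (star (z q - z y))) *
      C q).trace.re := by
    intro q hq
    have hne : star (z q - z y) ≠ 0 := by
      intro h0
      rw [star_eq_zero, sub_eq_zero] at h0
      have : r q = 0 := by rw [hr, ← h0, sqDist_self]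
      have := hq.2.1
      linarith
    rw [trace_vecMulVec_mul]
    exact (Complex.lt_def.1 ((hCpos q (hAU hq)).dotProduct_mulVec_pos hne)).1
  obtain ⟨lam, hlam, hlamA⟩ := hAc.exists_forall_le' hgc hgpos
  obtain ⟨Λ, hΛ⟩ := hAc.bddAbove_image (continuousOn_trace_re (hC.mono hAU))
  have hΛA : ∀ q ∈ A, (C q).trace.re ≤ Λ := fun q hq ↦ hΛ (mem_image_of_mem _ hq)
  -- Since `r` has complex Hessian `1`, this gives `α C(∂r, ∂̄r) - tr C ≥ 1` on the annulus, where
  -- `∂r` is bounded away from zero.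
  obtain ⟨α, hα, hαl⟩ : ∃ α > 0, Λ + 1 ≤ α * lam := by
    refine ⟨max 1 ((Λ + 1) / lam), by positivity, ?_⟩
    rw [← div_le_iff₀ hlam]
    exact le_max_right _ _
  set c := Real.exp (-α * (R / 4)) with hc
  have hcpos : 0 < c := Real.exp_pos _
  set φ : ℝ → ℝ := fun t ↦ θ * (Real.exp (-α * t) - c) with hφ
  have hφC : ContDiff ℝ 2 φ := by fun_prop
  obtain ⟨hφ1, hφ2⟩ := exp_barrier_deriv θ α c
  have hrC : ContMDiffOn (𝓡∂ (2 * n)) 𝓘(ℝ, ℝ) 2 r U := h.contMDiffOn_sqDist (z y) (k := 2)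
  have hφr : ContMDiffOn (𝓡∂ (2 * n)) 𝓘(ℝ, ℝ) 2 (fun q ↦ φ (r q)) U :=
    hφC.contMDiff.comp_contMDiffOn hrC
  have hHφ : ∀ q ∈ A, θ * α * c ≤ (complexHessian z (fun q ↦ φ (r q)) q * C q).trace.re := by
    intro q hq
    rw [complexHessian_comp h hφC hrC (hAU hq), complexHessian_sqDist h (hAU hq),
      complexGrad_sqDist h (hAU hq), hφ2, hφ1, Matrix.add_mul, Matrix.smul_mul, Matrix.smul_mul,
      Matrix.one_mul, Matrix.trace_add, Matrix.trace_smul, Matrix.trace_smul, smul_eq_mul, smul_eq_mul,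
      Complex.add_re, Complex.re_ofReal_mul, Complex.re_ofReal_mul]
    have h1 := hlamA q hq
    have h2 := hΛA q hq
    have h3 : c ≤ Real.exp (-α * r q) := by
      rw [hc, Real.exp_le_exp]
      have := hq.2.2
      nlinarith
    have h4 : α * lam ≤ α * (Matrix.vecMulVec (star (z q - z y)) (star (star (z q - z y))) *
      C q).trace.re := mul_le_mul_of_nonneg_left h1 hα.le
    have h5 : 0 ≤ θ * α := by positivity
    have h6 : 1 ≤ α * (Matrix.vecMulVec (star (z q - z y)) (star (star (z q - z y))) *
      C q).trace.re - (C q).trace.re := by linarith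
    calc θ * α * c ≤ θ * α * Real.exp (-α * r q) := mul_le_mul_of_nonneg_left h3 h5
      _ ≤ θ * α * Real.exp (-α * r q) * (α * (Matrix.vecMulVec (star (z q - z y))
          (star (star (z q - z y))) * C q).trace.re - (C q).trace.re) :=
        le_mul_of_one_le_right (by positivity) h6
      _ = _ := by ring
  have hφθ : ∀ t, 0 ≤ t → φ t ≤ θ := by
    intro t ht
    have : Real.exp (-α * t) ≤ 1 := Real.exp_le_one_iff.2 (by nlinarith)
    calc φ t ≤ θ * 1 := mul_le_mul_of_nonneg_left (by linarith) hθ.le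
      _ = θ := mul_one θ
  have hφanti : ∀ t t', t ≤ t' → φ t' ≤ φ t := by
    intro t t' htt
    refine mul_le_mul_of_nonneg_left (sub_le_sub_right ?_ _) hθ.le
    rw [Real.exp_le_exp]
    nlinarith
  have hφ0 : φ (R / 4) = 0 := by simp [hφ, hc]
  have hφpos : 0 < φ (R / 8) := by
    refine mul_pos hθ (sub_pos.2 ?_)
    rw [hc, Real.exp_lt_exp]
    nlinarith
  refine ⟨φ (R / 8), hφpos, {q | q ∈ U ∧ r q < R / 8}, h.sqDist_lt_mem_nhds hx ?_, ?_⟩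
  · have : sqDist z (z y) x = sqDist z (z x) y := by
      unfold sqDist
      refine Finset.sum_congr rfl fun j _ ↦ ?_
      rw [← Complex.normSq_neg, neg_sub]
    rw [this]
    linarith
  · filter_upwards [hvθ, hv0, hve (θ * α * c / 2) (by positivity)] with i hi1 hi2 hi3
    have hmin : ∀ q ∈ A, 0 ≤ v i q - φ (r q) := by
      have hsubC : ContMDiffOn (𝓡∂ (2 * n)) 𝓘(ℝ, ℝ) 2 (fun q ↦ v i q - φ (r q)) U :=
        (hv i).sub hφr
      refine nonneg_of_not_posSemidef h hAc hAU hsubC fun q hq hneg ↦ ?_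
      have hqs : s < r q := by
        by_contra hle
        push Not at hle
        have h1 := hi1 q (hsN' ⟨hAU hq, hle⟩)
        have h2 := hφθ (r q) (sqDist_nonneg _ _ _)
        linarith
      have hqR : r q < R / 4 := by
        by_contra hle
        push Not at hle
        have h1 := hi2 q (hBN hq.1).1
        have h2 := hφanti _ _ hle
        linarith
      refine ⟨?_, (hBN hq.1).2, fun hpsd ↦ ?_⟩
      · have h1 : {x | x ∈ U ∧ r x < R / 4} ∈ 𝓝 q := h.sqDist_lt_mem_nhds (hAU hq) hqR
        have h2 : ∀ᶠ x in 𝓝 q, s < r x :=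
          (hrU.continuousAt (h.isOpen.mem_nhds (hAU hq))).eventually (lt_mem_nhds hqs)
        filter_upwards [h1, h2] with x hx1 hx2
        exact ⟨⟨hx1.1, (hsub x hx1.1 hx1.2.le).le⟩, hx2.le, hx1.2.le⟩
      · have h1 := hpsd.re_trace_mul_nonneg (hCpos q (hAU hq)).posSemidef
        rw [complexHessian_sub h (hv i) hφr (hAU hq), Matrix.sub_mul, Matrix.trace_sub,
          Complex.sub_re] at h1
        have h2 := hi3 q (hBN hq.1).1
        have h3 := hHφ q hq
        have h4 : 0 < θ * α * c := by positivity
        linarith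
    rintro q ⟨hqU, hq⟩
    rcases le_total (r q) s with hqs | hqs
    · exact (hφθ _ (by positivity)).trans (hi1 q (hsN' ⟨hqU, hqs⟩))
    · have h1 := hmin q ⟨⟨hqU, (hsub q hqU (by linarith)).le⟩, hqs, by linarith⟩
      have h2 := hφanti _ _ hq.le
      linarith

/-- Propagation of positivity from the boundary, for approximate supersolutions. -/
theorem eventuallyPosNear_of_boundary [T2Space M] [CompactSpace M] {ι : Type*} {l : Filter ι}
    {v : ι → M → ℝ} (hv : ∀ i, ContMDiff (𝓡∂ (2 * n)) 𝓘(ℝ, ℝ) 2 (v i))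
    (hv0 : ∀ᶠ i in l, ∀ q ∈ boundaryComponents n M, 0 ≤ v i q)
    (hb : ∀ b ∈ (𝓡∂ (2 * n)).boundary M, EventuallyPosNear l v b)
    (hC : ∀ x : M, ∃ (U : Set M) (z : M → (Fin n → ℂ)) (C : M → Matrix (Fin n) (Fin n) ℂ),
      x ∈ U ∧ IsHolomorphicChart J U z ∧ ContinuousOn C U ∧ (∀ q ∈ U, (C q).PosDef) ∧
      ∃ N ∈ 𝓝 x, ∀ e > 0, ∀ᶠ i in l, ∀ q ∈ N, (complexHessian z (v i) q * C q).trace.re ≤ e) :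
    ∀ x ∈ boundaryComponents n M, EventuallyPosNear l v x := by
  rintro x ⟨b, hbb, hbx⟩
  -- The good set is open, meets the connected component, and will be shown to contain its limit
  -- points there.
  have hsub := isPreconnected_connectedComponent (x := x) |>.subset_of_closure_inter_subset
    (isOpen_eventuallyPosNear l v) ⟨b, hbx, hb b hbb⟩ ?_
  · exact hsub mem_connectedComponent
  · rintro y ⟨hy, hyx⟩
    by_cases hyi : (𝓡∂ (2 * n)).IsInteriorPoint y
    · obtain ⟨U, z, C, hyU, h, hCc, hCp, N, hN, hNe⟩ := hC y
      have hyK : y ∈ boundaryComponents n M := ⟨b, hbb, by rwa [← connectedComponent_eq hyx]⟩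
      refine eventuallyPosNear_of_mem_closure h (fun i ↦ (hv i).contMDiffOn) hyU hyi hCc hCp
        (Filter.inter_mem hN (isClopen_boundaryComponents.isOpen.mem_nhds hyK)) ?_ ?_ hy
      · filter_upwards [hv0] with i hi q hq using hi q hq.2
      · intro e he
        filter_upwards [hNe e he] with i hi q hq using hi q hq.1
    · refine hb y ?_
      rw [← (𝓡∂ (2 * n)).compl_interior]
      exact hyi

end MinPrinciple

/-! ### Defining functions, normal derivatives, and the holomorphic tangent space -/

section BoundaryChart

variable {n : ℕ} [NeZero n] {M : Type*} [TopologicalSpace M]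
  [ChartedSpace (EuclideanHalfSpace (2 * n)) M]
  {J : ∀ p : M, TangentSpace (𝓡∂ (2 * n)) p →L[ℝ] TangentSpace (𝓡∂ (2 * n)) p}
  {U : Set M} {z : M → (Fin n → ℂ)} {f g ρ : M → ℝ} {q : M}

/-- Shows that `v` is annihilated by `∂f` exactly when `v` and `√-1 v` are annihilated by `df`. This
links tangential frames with the hyperplane `ker ∂ρ`. -/
theorem dotProduct_complexGrad (z : M → (Fin n → ℂ)) (f : M → ℝ) (q : M) (v : Fin n → ℂ) :
    v ⬝ᵥ complexGrad z f q =
      ((realDeriv z v f q : ℂ) - Complex.I * (realDeriv z (Complex.I • v) f q : ℂ)) / 2 := by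
  let l : (Fin n → ℂ) →ₗ[ℝ] ℝ :=
    { toFun := fun v ↦ realDeriv z v f q
      map_add' := fun v w ↦ realDeriv_add_vec z q v w f
      map_smul' := fun c v ↦ realDeriv_smul_vec z q c v f }
  have hs : ∀ (j : Fin n) (w : ℂ), l (Pi.single j w) =
      w.re * l (Pi.single j 1) + w.im * l (Pi.single j Complex.I) := by
    intro j w
    have : (Pi.single j w : Fin n → ℂ) =
        w.re • (Pi.single j 1 : Fin n → ℂ) + w.im • (Pi.single j Complex.I : Fin n → ℂ) := by
      rw [← Pi.single_smul', ← Pi.single_smul', ← Pi.single_add]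
      congr 1
      simp [Complex.re_add_im]
    rw [this, map_add, map_smul, map_smul, smul_eq_mul, smul_eq_mul]
  have hl : ∀ v, l v = ∑ j, ((v j).re * l (Pi.single j 1) + (v j).im * l (Pi.single j Complex.I)) := by
    intro v
    conv_lhs => rw [← Finset.univ_sum_single v]
    rw [map_sum]
    exact Finset.sum_congr rfl fun j _ ↦ hs j (v j)
  change _ = ((l v : ℂ) - Complex.I * (l (Complex.I • v) : ℂ)) / 2
  rw [hl v, hl (Complex.I • v), dotProduct]
  push_cast
  rw [Finset.mul_sum, ← Finset.sum_sub_distrib, Finset.sum_div]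
  refine Finset.sum_congr rfl fun j _ ↦ ?_
  change v j * (((l (Pi.single j 1) : ℂ) - Complex.I * (l (Pi.single j Complex.I) : ℂ)) / 2) = _
  conv_lhs => rw [← Complex.re_add_im (v j)]
  simp only [Pi.smul_apply, smul_eq_mul, Complex.mul_re, Complex.mul_im, Complex.I_re, Complex.I_im]
  push_cast
  linear_combination (-(1 / 2 : ℂ) * (v j).im * l (Pi.single j Complex.I)) * Complex.I_mul_I

theorem complexGrad_eq_zero_iff : complexGrad z f q = 0 ↔ ∀ v, realDeriv z v f q = 0 := by
  constructor
  · intro h v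
    have := dotProduct_complexGrad z f q v
    rw [h, dotProduct_zero] at this
    have := congrArg Complex.re this
    simpa using this.symm
  · intro h
    ext j
    simp [complexGrad, h]

/-- A holomorphic chart with a smooth defining function `ρ` of the boundary. -/
structure IsBoundaryChart {n : ℕ} [NeZero n] {M : Type*} [TopologicalSpace M]
    [ChartedSpace (EuclideanHalfSpace (2 * n)) M]
    (J : ∀ p : M, TangentSpace (𝓡∂ (2 * n)) p →L[ℝ] TangentSpace (𝓡∂ (2 * n)) p)
    (U : Set M) (z : M → (Fin n → ℂ)) (ρ : M → ℝ) : Prop extends IsHolomorphicChart J U z where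
  contMDiffOn_rho : ContMDiffOn (𝓡∂ (2 * n)) 𝓘(ℝ, ℝ) ∞ ρ U
  rho_nonneg : ∀ q ∈ U, 0 ≤ ρ q
  mem_boundary_iff : ∀ q ∈ U, q ∈ (𝓡∂ (2 * n)).boundary M ↔ ρ q = 0
  complexGrad_ne_zero : ∀ q ∈ U, complexGrad z ρ q ≠ 0

theorem IsBoundaryChart.mono (h : IsBoundaryChart J U z ρ) {V : Set M} (hV : IsOpen V)
    (hVU : V ⊆ U) : IsBoundaryChart J V z ρ where
  toIsHolomorphicChart := h.toIsHolomorphicChart.mono hV hVU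
  contMDiffOn_rho := h.contMDiffOn_rho.mono hVU
  rho_nonneg q hq := h.rho_nonneg q (hVU hq)
  mem_boundary_iff q hq := h.mem_boundary_iff q (hVU hq)
  complexGrad_ne_zero q hq := h.complexGrad_ne_zero q (hVU hq)

theorem IsBoundaryChart.eventually_boundary (h : IsBoundaryChart J U z ρ) (hq : q ∈ U)
    (hf : ∀ x ∈ U, x ∈ (𝓡∂ (2 * n)).boundary M → f x = 0) :
    ∀ᶠ x in 𝓝 q, x ∈ (𝓡∂ (2 * n)).boundary M → f x = 0 := by
  filter_upwards [h.isOpen.mem_nhds hq] with x hx using hf x hx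

theorem IsBoundaryChart.contMDiffOn_rho_two (h : IsBoundaryChart J U z ρ) :
    ContMDiffOn (𝓡∂ (2 * n)) 𝓘(ℝ, ℝ) 2 ρ U := h.contMDiffOn_rho.of_le (by norm_cast)

variable [IsManifold (𝓡∂ (2 * n)) ∞ M]

/-- `v₀` represents the unit vector of index `0` of the half space. It points into the half space,
so derivatives along it are nonnegative at a local minimum, and it complements the boundary
hyperplane. -/
theorem exists_inward (h : IsHolomorphicChart J U z) (hq : q ∈ U) :
    ∃ v₀ : Fin n → ℂ, ¬ IsBoundaryTangent q (coordVec z q v₀) ∧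
      (∀ v, ∃ c : ℝ, IsBoundaryTangent q (coordVec z q (v - c • v₀))) ∧
      ∀ f : M → ℝ, ContMDiffOn (𝓡∂ (2 * n)) 𝓘(ℝ, ℝ) 2 f U → (∀ᶠ x in 𝓝 q, f q ≤ f x) →
        0 ≤ realDeriv z v₀ f q := by
  set φ := extChartAt (𝓡∂ (2 * n)) q with hφ
  set L := fderivWithin ℝ (z ∘ φ.symm) (range (𝓡∂ (2 * n))) (φ q) with hL
  have hLi : L.IsInvertible := by
    rw [hL, ← h.mfderiv_eq_fderivWithin hq]
    exact h.isInvertible q hq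
  set e₀ : EuclideanSpace ℝ (Fin (2 * n)) := EuclideanSpace.single 0 1 with he₀
  have hinv : L.inverse (L e₀) = e₀ := by
    obtain ⟨L', hL'⟩ := hLi
    rw [← hL', ContinuousLinearMap.inverse_equiv]
    exact L'.symm_apply_apply e₀
  refine ⟨L e₀, ?_, fun v ↦ ⟨L.inverse v 0, ?_⟩, fun f hf hmin ↦ ?_⟩
  · rw [isBoundaryTangent_coordVec_iff h hq, ← hφ, ← hL, hinv]
    simp [he₀]
  · rw [isBoundaryTangent_coordVec_iff h hq, ← hφ, ← hL, map_sub, map_smul, hinv]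
    simp [he₀]
  · rw [realDeriv_eq_fderivWithin_self h hq (h.mdifferentiableAt hf (by simp) hq), ← hφ, ← hL, hinv]
    have hfq := (hf q hq).contMDiffAt (h.isOpen.mem_nhds hq)
    have hd : HasFDerivWithinAt (f ∘ φ.symm) (fderivWithin ℝ (f ∘ φ.symm) (range (𝓡∂ (2 * n))) (φ q))
        (range (𝓡∂ (2 * n))) (φ q) :=
      (hfq.contDiffWithinAt_comp_extChartAt_symm.differentiableWithinAt
        (by simp)).hasFDerivWithinAt
    have hm : IsLocalMinOn (f ∘ φ.symm) (range (𝓡∂ (2 * n))) (φ q) := by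
      have h1 := (continuousAt_extChartAt_symm (I := 𝓡∂ (2 * n)) q).tendsto
      rw [extChartAt_to_inv] at h1
      have := h1.eventually hmin
      refine Filter.Eventually.filter_mono nhdsWithin_le_nhds ?_
      filter_upwards [this] with x hx
      change f (φ.symm (φ q)) ≤ _
      rw [extChartAt_to_inv]
      exact hx
    refine hm.hasFDerivWithinAt_nonneg hd (mem_posTangentConeAt_of_segment_subset ?_)
    intro x hx
    rw [range_modelWithCornersEuclideanHalfSpace]
    obtain ⟨t, ht, rfl⟩ := (segment_eq_image_lineMap ℝ (φ q) (φ q + e₀) ▸ hx)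
    have h0 := zero_le_extChartAt (n := n) q q
    have : AffineMap.lineMap (φ q) (φ q + e₀) t = φ q + t • e₀ := by
      rw [AffineMap.lineMap_apply]; simp [add_comm]
    rw [this]
    change 0 ≤ φ q 0 + t * e₀ 0
    have h1 : e₀ 0 = 1 := by simp [he₀]
    rw [h1, mul_one]
    exact add_nonneg h0 ht.1

/-- `ρ` is the half-space coordinate of the preferred chart at `p`; the holomorphic chart is shrunk
to the set where `∂ρ ≠ 0`. -/
theorem exists_isBoundaryChart (X : ComplexStructure n M) (p : M) :
    ∃ (U : Set M) (z : M → (Fin n → ℂ)) (ρ : M → ℝ), p ∈ U ∧ IsBoundaryChart X.J U z ρ := by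
  obtain ⟨U₀, z, hpU₀, h₀⟩ := X.exists_chart p
  set S := (chartAt (EuclideanHalfSpace (2 * n)) p).source with hS
  have hSo : IsOpen S := (chartAt (EuclideanHalfSpace (2 * n)) p).open_source
  have h := h₀.mono (h₀.isOpen.inter hSo) inter_subset_left
  set ρ : M → ℝ := fun q ↦ extChartAt (𝓡∂ (2 * n)) p q 0 with hρ
  have hpS : p ∈ S := mem_chart_source _ p
  have hρS : ContMDiffOn (𝓡∂ (2 * n)) 𝓘(ℝ, ℝ) ∞ ρ S :=
    (EuclideanSpace.proj (𝕜 := ℝ) (0 : Fin (2 * n))).contDiff.contMDiff.comp_contMDiffOn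
      (contMDiffOn_extChartAt (I := 𝓡∂ (2 * n)) (x := p))
  have hρU := hρS.mono (inter_subset_right : U₀ ∩ S ⊆ S)
  have hsrc : ∀ q ∈ S, q ∈ (extChartAt (𝓡∂ (2 * n)) p).source := fun q hq ↦ by simpa using hq
  have hgp : complexGrad z ρ p ≠ 0 := by
    rw [Ne, complexGrad_eq_zero_iff]
    intro hall
    obtain ⟨v₀, hv₀, -⟩ := exists_inward h ⟨hpU₀, hpS⟩
    apply hv₀
    have hdm : MDifferentiableAt (𝓡∂ (2 * n)) 𝓘(ℝ, EuclideanSpace ℝ (Fin (2 * n)))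
        (extChartAt (𝓡∂ (2 * n)) p) p :=
      (contMDiffAt_extChartAt (I := 𝓡∂ (2 * n)) (n := ∞) (x := p)).mdifferentiableAt (by simp)
    have h1 := HasMFDerivAt.comp p
      ((EuclideanSpace.proj (𝕜 := ℝ) (0 : Fin (2 * n))).hasFDerivAt
        (x := extChartAt (𝓡∂ (2 * n)) p p)).hasMFDerivAt hdm.hasMFDerivAt
    have h2 := hall v₀
    unfold realDeriv at h2
    rw [show ρ = EuclideanSpace.proj (𝕜 := ℝ) (0 : Fin (2 * n)) ∘ extChartAt (𝓡∂ (2 * n)) p from rfl,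
      h1.mfderiv] at h2
    exact h2
  have hgc : ContinuousOn (fun q ↦ complexGrad z ρ q) (U₀ ∩ S) :=
    continuousOn_pi.2 fun j ↦ (contMDiffOn_complexGrad h (hρU.of_le (by norm_cast)) j).continuousOn
  have hVo := hgc.isOpen_inter_preimage h.isOpen (isOpen_compl_singleton (x := (0 : Fin n → ℂ)))
  have hch : IsBoundaryChart X.J ((U₀ ∩ S) ∩ (fun q ↦ complexGrad z ρ q) ⁻¹' {0}ᶜ) z ρ :=
    { toIsHolomorphicChart := h.mono hVo inter_subset_left
      contMDiffOn_rho := hρU.mono inter_subset_left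
      rho_nonneg := fun q _ ↦ zero_le_extChartAt p q
      mem_boundary_iff := fun q hq ↦ mem_boundary_iff_extChartAt (hsrc q hq.1.2)
      complexGrad_ne_zero := fun q hq ↦ hq.2 }
  exact ⟨(U₀ ∩ S) ∩ (fun q ↦ complexGrad z ρ q) ⁻¹' {0}ᶜ, z, ρ, ⟨⟨hpU₀, hpS⟩, hgp⟩, hch⟩

/-- The normal derivative of `f`, measured by that of `ρ`. -/
theorem IsBoundaryChart.exists_normalDeriv (h : IsBoundaryChart J U z ρ) (hq : q ∈ U)
    (hqb : q ∈ (𝓡∂ (2 * n)).boundary M) (hf : ContMDiffOn (𝓡∂ (2 * n)) 𝓘(ℝ, ℝ) 2 f U)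
    (hf0 : ∀ x ∈ U, x ∈ (𝓡∂ (2 * n)).boundary M → f x = 0) :
    ∃ t : ℝ, ∀ v, realDeriv z v f q = t * realDeriv z v ρ q := by
  obtain ⟨v₀, hv₀, hv, hpos⟩ := exists_inward h.toIsHolomorphicChart hq
  have key : ∀ {g : M → ℝ}, ContMDiffOn (𝓡∂ (2 * n)) 𝓘(ℝ, ℝ) 2 g U →
      (∀ x ∈ U, x ∈ (𝓡∂ (2 * n)).boundary M → g x = 0) → ∀ (v : Fin n → ℂ) (c : ℝ),
      IsBoundaryTangent q (coordVec z q (v - c • v₀)) →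
      realDeriv z v g q = c * realDeriv z v₀ g q := by
    intro g hg hg0 v c hc
    have h1 := (realDeriv_eq_zero_of_boundary h.toIsHolomorphicChart hg hq hqb
      (h.eventually_boundary hq hg0) hc).1
    have h2 := realDeriv_add_vec z q (v - c • v₀) (c • v₀) g
    rw [sub_add_cancel, h1, zero_add, realDeriv_smul_vec] at h2
    exact h2
  have hρ0 : ∀ x ∈ U, x ∈ (𝓡∂ (2 * n)).boundary M → ρ x = 0 := fun x hx hxb ↦
    (h.mem_boundary_iff x hx).1 hxb
  have hne : realDeriv z v₀ ρ q ≠ 0 := by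
    intro h0
    refine h.complexGrad_ne_zero q hq (complexGrad_eq_zero_iff.2 fun v ↦ ?_)
    obtain ⟨c, hc⟩ := hv v
    rw [key h.contMDiffOn_rho_two hρ0 v c hc, h0, mul_zero]
  refine ⟨realDeriv z v₀ f q / realDeriv z v₀ ρ q, fun v ↦ ?_⟩
  obtain ⟨c, hc⟩ := hv v
  rw [key hf hf0 v c hc, key h.contMDiffOn_rho_two hρ0 v c hc]
  field_simp

/-- Compare `f` and `ρ` along the inward vector: both derivatives are nonnegative, and that of `ρ`
is not zero because `dρ ≠ 0` vanishes on tangential vectors. A barrier touching a function from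
above at a boundary point thus bounds its normal derivative. -/
theorem IsBoundaryChart.normalDeriv_nonneg (h : IsBoundaryChart J U z ρ) (hq : q ∈ U)
    (hqb : q ∈ (𝓡∂ (2 * n)).boundary M) (hf : ContMDiffOn (𝓡∂ (2 * n)) 𝓘(ℝ, ℝ) 2 f U)
    (hmin : ∀ᶠ x in 𝓝 q, f q ≤ f x) {t : ℝ} (ht : ∀ v, realDeriv z v f q = t * realDeriv z v ρ q) :
    0 ≤ t := by
  obtain ⟨v₀, hv₀, hv, hpos⟩ := exists_inward h.toIsHolomorphicChart hq
  have hρ0 : ∀ x ∈ U, x ∈ (𝓡∂ (2 * n)).boundary M → ρ x = 0 := fun x hx hxb ↦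
    (h.mem_boundary_iff x hx).1 hxb
  have h1 := hpos f hf hmin
  have h2 := hpos ρ h.contMDiffOn_rho_two (by
    filter_upwards [h.isOpen.mem_nhds hq] with x hx
    rw [hρ0 q hq hqb]
    exact h.rho_nonneg x hx)
  rw [ht] at h1
  have hne : realDeriv z v₀ ρ q ≠ 0 := by
    intro h0
    refine h.complexGrad_ne_zero q hq (complexGrad_eq_zero_iff.2 fun v ↦ ?_)
    obtain ⟨c, hc⟩ := hv v
    have h3 := (realDeriv_eq_zero_of_boundary h.toIsHolomorphicChart h.contMDiffOn_rho_two hq hqb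
      (h.eventually_boundary hq hρ0) hc).1
    have h4 := realDeriv_add_vec z q (v - c • v₀) (c • v₀) ρ
    rw [sub_add_cancel, h3, zero_add, realDeriv_smul_vec, h0, mul_zero] at h4
    exact h4
  exact nonneg_of_mul_nonneg_left h1 (lt_of_le_of_ne h2 hne.symm)

theorem IsBoundaryChart.isBoundaryTangent_iff (h : IsBoundaryChart J U z ρ) (hq : q ∈ U)
    (hqb : q ∈ (𝓡∂ (2 * n)).boundary M) (v : Fin n → ℂ) :
    IsBoundaryTangent q (coordVec z q v) ↔ realDeriv z v ρ q = 0 := by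
  have hρ0 : ∀ x ∈ U, x ∈ (𝓡∂ (2 * n)).boundary M → ρ x = 0 := fun x hx hxb ↦
    (h.mem_boundary_iff x hx).1 hxb
  have key : ∀ v, IsBoundaryTangent q (coordVec z q v) → realDeriv z v ρ q = 0 := fun v hv ↦
    (realDeriv_eq_zero_of_boundary h.toIsHolomorphicChart h.contMDiffOn_rho_two hq hqb
      (h.eventually_boundary hq hρ0) hv).1
  refine ⟨key v, fun h0 ↦ ?_⟩
  obtain ⟨v₀, hv₀, hv, -⟩ := exists_inward h.toIsHolomorphicChart hq
  have hadd : ∀ v c, IsBoundaryTangent q (coordVec z q (v - c • v₀)) →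
      realDeriv z v ρ q = c * realDeriv z v₀ ρ q := by
    intro v c hc
    have h4 := realDeriv_add_vec z q (v - c • v₀) (c • v₀) ρ
    rw [sub_add_cancel, key _ hc, zero_add, realDeriv_smul_vec] at h4
    exact h4
  have hne : realDeriv z v₀ ρ q ≠ 0 := by
    intro h0
    refine h.complexGrad_ne_zero q hq (complexGrad_eq_zero_iff.2 fun v ↦ ?_)
    obtain ⟨c, hc⟩ := hv v
    rw [hadd v c hc, h0, mul_zero]
  obtain ⟨c, hc⟩ := hv v
  have := hadd v c hc
  rw [h0, eq_comm, mul_eq_zero, or_iff_left hne] at this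
  rwa [this, zero_smul, sub_zero] at hc

/-- The rows of a tangential frame annihilate `∂ρ`. -/
theorem IsBoundaryChart.mulVec_complexGrad {X : ComplexStructure n M} (h : IsBoundaryChart X.J U z ρ)
    (hq : q ∈ U) (hqb : q ∈ (𝓡∂ (2 * n)).boundary M) {Ξ : Matrix (Fin (n - 1)) (Fin n) ℂ}
    (hΞ : IsTangentialFrame X z q Ξ) : Ξ *ᵥ complexGrad z ρ q = 0 := by
  ext a
  obtain ⟨h1, h2⟩ := hΞ.2 a
  rw [h.isBoundaryTangent_iff hq hqb] at h1
  rw [← h.coordVec_I hq, h.isBoundaryTangent_iff hq hqb] at h2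
  change Ξ a ⬝ᵥ complexGrad z ρ q = 0
  rw [dotProduct_complexGrad, h1, h2]
  simp

/-- If `f` vanishes on the boundary and `df = 0` at `q`, then `√-1∂∂̄f` vanishes on the holomorphic
tangent space of the boundary. -/
theorem IsBoundaryChart.conj_complexHessian_eq_zero {X : ComplexStructure n M}
    (h : IsBoundaryChart X.J U z ρ)
    (hq : q ∈ U) (hqb : q ∈ (𝓡∂ (2 * n)).boundary M) (hf : ContMDiffOn (𝓡∂ (2 * n)) 𝓘(ℝ, ℝ) 2 f U)
    (hf0 : ∀ x ∈ U, x ∈ (𝓡∂ (2 * n)).boundary M → f x = 0) (hdf : ∀ v, realDeriv z v f q = 0)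
    {Ξ : Matrix (Fin (n - 1)) (Fin n) ℂ} (hΞ : IsTangentialFrame X z q Ξ) :
    Ξ * complexHessian z f q * Ξᴴ = 0 := by
  refine Matrix.ext_of_quadForm fun v ↦ ?_
  have hva : (v ᵥ* Ξ) ⬝ᵥ complexGrad z ρ q = 0 := by
    rw [← Matrix.dotProduct_mulVec, h.mulVec_complexGrad hq hqb hΞ, dotProduct_zero]
  rw [dotProduct_complexGrad] at hva
  have hre := congrArg Complex.re hva
  have him := congrArg Complex.im hva
  simp at hre him
  have hsec : ∀ w, realDeriv z w ρ q = 0 → realHess z f w w q = 0 := fun w hw ↦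
    (realDeriv_eq_zero_of_boundary h.toIsHolomorphicChart hf hq hqb
      (h.eventually_boundary hq hf0) ((h.isBoundaryTangent_iff hq hqb w).2 hw)).2 hdf
  have h1 := quadForm_complexHessian h.toIsHolomorphicChart hf hq (v ᵥ* Ξ)
  rw [hsec _ hre, hsec _ him] at h1
  rw [Matrix.zero_mulVec, dotProduct_zero, ← Matrix.mulVec_mulVec, ← Matrix.mulVec_mulVec,
    Matrix.dotProduct_mulVec, ← Matrix.star_vecMul]
  simpa using h1

end BoundaryChart

/-! ### The comparison principle, and minima on coordinate balls -/

section Domination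

variable {n : ℕ} [NeZero n] {M : Type*} [TopologicalSpace M]
  [ChartedSpace (EuclideanHalfSpace (2 * n)) M]

theorem IsC2Matrix.continuousOn {U : Set M} {m : ℕ} {F : M → Matrix (Fin m) (Fin m) ℂ}
    (hF : IsC2Matrix n U F) : ContinuousOn F U :=
  continuousOn_pi.2 fun i ↦ continuousOn_pi.2 fun j ↦ (hF i j).continuousOn

theorem isC2Matrix_linearizedCoeff {U : Set M} {W G : M → Matrix (Fin n) (Fin n) ℂ} (hW : IsC2Matrix n U W)
    (hG : IsC2Matrix n U G) (hWd : ∀ q ∈ U, (W q).det ≠ 0)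
    (hQd : ∀ q ∈ U, (traceSub (W q) (G q)).det ≠ 0) :
    IsC2Matrix n U fun q ↦ linearizedCoeff (W q) (G q) := by
  have hWi := hW.inv hWd
  have hQ : IsC2Matrix n U fun q ↦ traceSub (W q) (G q) :=
    (IsC2Matrix.smul (hG.mul hWi).trace hW).sub hG
  have hQi := hQ.inv hQd
  exact (IsC2Matrix.smul (hQi.mul hW).trace hWi).sub hQi

variable [IsManifold (𝓡∂ (2 * n)) ∞ M] {X : ComplexStructure n M}

/-- An admissible function `u` with the boundary values of `uSub` and `σ ≤ ℳ(u) ≤ ℳ(uSub)`. -/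
structure IsDominatedSolution (metric : HermitianMetric X) (χ : RealOneOneForm X) (uSub : M → ℝ)
    (σ : ℝ) (u : M → ℝ) : Prop where
  contMDiff : ContMDiff (𝓡∂ (2 * n)) 𝓘(ℝ, ℝ) 4 u
  admissible : IsAdmissible (n - 1) metric χ u
  le_maOperator : ∀ (U : Set M) (z : M → (Fin n → ℂ)), IsHolomorphicChart X.J U z → ∀ q ∈ U,
    σ ≤ maOperator (n - 1) metric χ u z q
  maOperator_le : ∀ (U : Set M) (z : M → (Fin n → ℂ)), IsHolomorphicChart X.J U z → ∀ q ∈ U,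
    maOperator (n - 1) metric χ u z q ≤ maOperator (n - 1) metric χ uSub z q
  boundary_eq : ∀ q ∈ (𝓡∂ (2 * n)).boundary M, u q = uSub q

variable {metric : HermitianMetric X} {χ : RealOneOneForm X} {uSub u : M → ℝ} {σ : ℝ}
  {U : Set M} {z : M → (Fin n → ℂ)} {q : M}

theorem gCoeff_sub_gCoeff (h : IsHolomorphicChart X.J U z) (hq : q ∈ U) (χ : RealOneOneForm X)
    {f g : M → ℝ} (hf : ContMDiffOn (𝓡∂ (2 * n)) 𝓘(ℝ, ℝ) 2 f U)
    (hg : ContMDiffOn (𝓡∂ (2 * n)) 𝓘(ℝ, ℝ) 2 g U) :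
    gCoeff z χ f q - gCoeff z χ g q = complexHessian z (fun x ↦ f x - g x) q := by
  rw [complexHessian_sub h hf hg hq, gCoeff, gCoeff, add_sub_add_left_eq_sub]

theorem complexHessian_const (h : IsHolomorphicChart X.J U z) (hq : q ∈ U) (c : ℝ) :
    complexHessian z (fun _ ↦ c) q = 0 := by
  ext j k
  have hc : ∀ v, realDeriv z v (fun _ : M ↦ c) = fun _ ↦ 0 := fun v ↦
    funext fun q ↦ realDeriv_const c v
  rw [complexHessian_apply h contMDiffOn_const hq]
  simp [realHess, hc, realDeriv_const]

theorem IsDominatedSolution.contMDiff_sub (hu : IsDominatedSolution metric χ uSub σ u)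
    (huSub : ContMDiff (𝓡∂ (2 * n)) 𝓘(ℝ, ℝ) ∞ uSub) :
    ContMDiff (𝓡∂ (2 * n)) 𝓘(ℝ, ℝ) 4 (fun x ↦ u x - uSub x) :=
  hu.contMDiff.sub (huSub.of_le (by norm_cast))

/-- Comparison principle. -/
theorem IsDominatedSolution.le_of_mem [T2Space M] [CompactSpace M] (hn : 2 ≤ n)
    (huSub : ContMDiff (𝓡∂ (2 * n)) 𝓘(ℝ, ℝ) ∞ uSub)
    (hadm : IsAdmissible (n - 1) metric χ uSub)
    (hu : IsDominatedSolution metric χ uSub σ u) :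
    ∀ q ∈ boundaryComponents n M, 0 ≤ u q - uSub q := by
  intro q hq
  set w : M → ℝ := fun x ↦ u x - uSub x with hw
  have hwC := hu.contMDiff_sub huSub
  have hK : IsCompact (boundaryComponents n M) := isClopen_boundaryComponents.isClosed.isCompact
  obtain ⟨p, hp, hmin⟩ := hK.exists_isMinOn ⟨q, hq⟩ hwC.continuous.continuousOn
  suffices h0 : 0 ≤ w p from h0.trans (hmin hq)
  by_contra hneg
  push Not at hneg
  have h4 : ContMDiff (𝓡∂ (2 * n)) 𝓘(ℝ, ℝ) 2 w := hwC.of_le (by norm_num)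
  -- A constant family over a one-point index: `w - min w` is nonnegative and equals `-min w > 0` on
  -- the boundary, so it would be positive also at the minimum point `p`.
  have key := eventuallyPosNear_of_boundary (J := X.J) (ι := Unit) (l := ⊤)
    (v := fun _ x ↦ w x - w p) (fun _ ↦ h4.sub contMDiff_const)
    (Eventually.of_forall fun _ x hx ↦ sub_nonneg.2 (hmin hx)) ?_ ?_ p hp
  · obtain ⟨θ, hθ, N, hN, hv⟩ := key
    have := hv.exists.choose_spec p (mem_of_mem_nhds hN)
    simp at this
    linarith
  · intro b hb
    have hwb : w b = 0 := sub_eq_zero.2 (hu.boundary_eq b hb)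
    refine ⟨- w p / 2, by linarith, {x | w p / 2 < w x}, ?_, Eventually.of_forall fun _ x hx ↦ ?_⟩
    · exact (hwC.continuous.continuousAt).eventually (lt_mem_nhds (show w p / 2 < w b by rw [hwb]; linarith))
    · change w p / 2 < w x at hx
      linarith
  · intro x
    obtain ⟨U, z, hxU, h⟩ := X.exists_chart x
    have huU : ContMDiffOn (𝓡∂ (2 * n)) 𝓘(ℝ, ℝ) 2 u U :=
      (hu.contMDiff.of_le (by norm_num)).contMDiffOn
    have hsU : ContMDiffOn (𝓡∂ (2 * n)) 𝓘(ℝ, ℝ) 2 uSub U :=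
      (huSub.of_le (by norm_cast)).contMDiffOn
    have hWp := fun y (hy : y ∈ U) ↦ posDef_coeff h hy metric
    have hGh := fun y (hy : y ∈ U) ↦ isHermitian_gCoeff h hy χ huU
    have hQ := fun y (hy : y ∈ U) ↦ posDef_traceSub (by omega) (hWp y hy) (hGh y hy)
      (hu.admissible U z h y hy)
    refine ⟨U, z, fun y ↦ linearizedCoeff (coeff z metric.toRealOneOneForm y) (gCoeff z χ u y), hxU,
      h, (isC2Matrix_linearizedCoeff (isC2Matrix_coeff h _)
        (isC2Matrix_gCoeff h χ hu.contMDiff.contMDiffOn) (fun y hy ↦ (hWp y hy).det_pos.ne')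
        (fun y hy ↦ (hQ y hy).1.det_pos.ne')).continuousOn,
      fun y hy ↦ posDef_linearizedCoeff hn (hWp y hy) (hGh y hy) (hu.admissible U z h y hy), U,
      h.isOpen.mem_nhds hxU, fun e he ↦ Eventually.of_forall fun _ y hy ↦ ?_⟩
    -- By concavity the linearised operator at `u`, applied to `uSub - u`, is nonnegative; so `w` is
    -- an exact supersolution.
    have h1 := linearized_nonneg (by omega) (hWp y hy) (hGh y hy) (isHermitian_gCoeff h hy χ hsU)
      (hu.admissible U z h y hy) (hadm U z h y hy) (hu.maOperator_le U z h y hy)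
    rw [complexHessian_sub h h4.contMDiffOn contMDiffOn_const hy, complexHessian_const h hy, sub_zero,
      hw, ← gCoeff_sub_gCoeff h hy χ huU hsU]
    rw [← neg_sub, Matrix.neg_mul, Matrix.trace_neg, Complex.neg_re] at h1
    linarith

/-- Minimum principle on the part of a small ball around `p` which lies in `M`. -/
theorem nonneg_of_ball [T2Space M] (h : IsHolomorphicChart X.J U z) {p₀ p : M} {R : ℝ}
    (hB : IsCompact {x | x ∈ U ∧ sqDist z (z p₀) x ≤ R})
    (hpR : sqDist z (z p₀) p < R / 8) {f : M → ℝ} (hf : ContMDiffOn (𝓡∂ (2 * n)) 𝓘(ℝ, ℝ) 2 f U)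
    (H : ∀ q ∈ U, sqDist z (z p₀) q ≤ R → sqDist z (z p) q ≤ R / 4 → f q < 0 →
      sqDist z (z p) q ≠ R / 4 ∧ q ∉ (𝓡∂ (2 * n)).boundary M ∧
        ¬ (complexHessian z f q).PosSemidef) :
    ∀ q ∈ U, sqDist z (z p) q < R / 4 → 0 ≤ f q := by
  have hR : 0 < R := by linarith [sqDist_nonneg z (z p₀) p]
  set A := {x | x ∈ U ∧ sqDist z (z p₀) x ≤ R} ∩ sqDist z (z p) ⁻¹' Iic (R / 4) with hA
  have hAc : IsCompact A :=
    hB.inter_preimage_isClosed ((h.continuousOn_sqDist _).mono fun x hx ↦ hx.1) isClosed_Iic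
  have hnhds : ∀ q ∈ U, sqDist z (z p) q < R / 4 → A ∈ 𝓝 q := by
    intro q hq hqR
    filter_upwards [h.sqDist_lt_mem_nhds hq hqR] with x hx
    have := sqDist_le_two_mul z (z p₀) (z p) p x rfl
    exact ⟨⟨hx.1, by linarith [hx.2]⟩, hx.2.le⟩
  have := nonneg_of_not_posSemidef h hAc (fun x hx ↦ hx.1.1) hf fun q hq hneg ↦ by
    obtain ⟨h1, h2, h3⟩ := H q hq.1.1 hq.1.2 hq.2 hneg
    refine ⟨hnhds q hq.1.1 (lt_of_le_of_ne hq.2 h1), ?_, h3⟩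
    rw [← (𝓡∂ (2 * n)).compl_interior, mem_compl_iff, not_not] at h2
    exact h2
  exact fun q hq hqR ↦ this q (mem_of_mem_nhds (hnhds q hq hqR))

end Domination

/-! ### A linear barrier near a boundary point -/

section Barrier

variable {n : ℕ} [NeZero n] {M : Type*} [TopologicalSpace M]
  [ChartedSpace (EuclideanHalfSpace (2 * n)) M] {U : Set M}

theorem isC2Matrix_vecMulVec {a b : M → Fin n → ℂ}
    (ha : ∀ j, ContMDiffOn (𝓡∂ (2 * n)) 𝓘(ℝ, ℂ) 2 (fun q ↦ a q j) U)
    (hb : ∀ j, ContMDiffOn (𝓡∂ (2 * n)) 𝓘(ℝ, ℂ) 2 (fun q ↦ b q j) U) :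
    IsC2Matrix n U fun q ↦ Matrix.vecMulVec (a q) (b q) :=
  fun i j ↦ (ha i).complex_mul (hb j)

theorem isC2Matrix_tangentInv {W : M → Matrix (Fin n) (Fin n) ℂ} {a : M → Fin n → ℂ}
    (hW : IsC2Matrix n U W) (hWp : ∀ q ∈ U, (W q).PosDef)
    (ha : ∀ j, ContMDiffOn (𝓡∂ (2 * n)) 𝓘(ℝ, ℂ) 2 (fun q ↦ a q j) U) (ha0 : ∀ q ∈ U, a q ≠ 0) :
    IsC2Matrix n U fun q ↦ tangentInv (W q) (a q) := by
  have hWi := hW.inv fun q hq ↦ (hWp q hq).det_pos.ne'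
  have hR : IsC2Matrix n U fun q ↦ Matrix.vecMulVec (a q) (star (a q)) :=
    isC2Matrix_vecMulVec ha fun j ↦ (ha j).complex_star
  exact hWi.sub (IsC2Matrix.smul ((hR.mul hWi).trace.complex_inv fun q hq ↦
    trace_vecMulVec_inv_ne_zero (hWp q hq) (ha0 q hq)) ((hWi.mul hR).mul hWi))

variable [IsManifold (𝓡∂ (2 * n)) ∞ M] {X : ComplexStructure n M}
  {metric : HermitianMetric X} {χ : RealOneOneForm X} {uSub u ρ : M → ℝ} {σ : ℝ}
  {z : M → (Fin n → ℂ)} {p₀ q : M}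

theorem continuousOn_relTrace (h : IsHolomorphicChart X.J U z) (metric : HermitianMetric X)
    {F : M → Matrix (Fin n) (Fin n) ℂ} (hF : ContinuousOn F U) :
    ContinuousOn (fun q ↦ relTrace (coeff z metric.toRealOneOneForm q) (F q)) U :=
  continuousOn_trace_re (hF.matrix_mul' ((isC2Matrix_coeff h metric.toRealOneOneForm).inv
    fun _ hq ↦ (posDef_coeff h hq metric).det_pos.ne').continuousOn)

theorem IsBoundaryChart.isC2Matrix_tangentInv (h : IsBoundaryChart X.J U z ρ)
    (metric : HermitianMetric X) : IsC2Matrix n U fun q ↦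
      tangentInv (coeff z metric.toRealOneOneForm q) (complexGrad z ρ q) :=
  _root_.isC2Matrix_tangentInv (isC2Matrix_coeff h.toIsHolomorphicChart _)
    (fun _ hq ↦ posDef_coeff h.toIsHolomorphicChart hq metric)
    (contMDiffOn_complexGrad h.toIsHolomorphicChart (h.contMDiffOn_rho.of_le (by norm_cast)))
    h.complexGrad_ne_zero

theorem IsBoundaryChart.continuousOn_tangentTrace (h : IsBoundaryChart X.J U z ρ)
    (metric : HermitianMetric X) {F : M → Matrix (Fin n) (Fin n) ℂ} (hF : ContinuousOn F U) :
    ContinuousOn (fun q ↦ tangentTrace (coeff z metric.toRealOneOneForm q) (complexGrad z ρ q)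
      (F q)) U :=
  continuousOn_trace_re (hF.matrix_mul' (h.isC2Matrix_tangentInv metric).continuousOn)

theorem IsBoundaryChart.contMDiffOn_tangentTrace (h : IsBoundaryChart X.J U z ρ)
    (metric : HermitianMetric X) {F : M → Matrix (Fin n) (Fin n) ℂ} (hF : IsC2Matrix n U F) :
    ContMDiffOn (𝓡∂ (2 * n)) 𝓘(ℝ, ℝ) 2 (fun q ↦ tangentTrace (coeff z metric.toRealOneOneForm q)
      (complexGrad z ρ q) (F q)) U :=
  (hF.mul (h.isC2Matrix_tangentInv metric)).trace.complex_re

theorem continuousOn_complexHessian (h : IsHolomorphicChart X.J U z) {f : M → ℝ}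
    (hf : ContMDiffOn (𝓡∂ (2 * n)) 𝓘(ℝ, ℝ) 2 f U) : ContinuousOn (complexHessian z f) U := by
  have h1 : ∀ v w, ContinuousOn (fun q ↦ (realHess z f v w q : ℂ)) U := fun v w ↦
    Complex.continuous_ofReal.comp_continuousOn
      (h.contMDiffOn_realDeriv (k := 0) (m := 1)
        (h.contMDiffOn_realDeriv (k := 1) (m := 2) hf (by norm_num) w) (by norm_num) v).continuousOn
  refine continuousOn_pi.2 fun j ↦ continuousOn_pi.2 fun k ↦ ?_
  have h2 := ((((h1 (Pi.single j 1) (Pi.single k 1)).add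
    (h1 (Pi.single j Complex.I) (Pi.single k Complex.I)))).add
    (continuousOn_const (c := Complex.I) |>.mul
      ((h1 (Pi.single j 1) (Pi.single k Complex.I)).sub
        (h1 (Pi.single j Complex.I) (Pi.single k 1))))).mul (continuousOn_const (c := (4 : ℂ)⁻¹))
  refine h2.congr fun q hq ↦ ?_
  rw [complexHessian_apply h hf hq]
  simp [div_eq_mul_inv]

theorem continuousOn_complexGrad (h : IsHolomorphicChart X.J U z) {f : M → ℝ}
    (hf : ContMDiffOn (𝓡∂ (2 * n)) 𝓘(ℝ, ℝ) 2 f U) : ContinuousOn (complexGrad z f) U := by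
  have h1 : ∀ v, ContinuousOn (fun q ↦ (realDeriv z v f q : ℂ)) U := fun v ↦
    Complex.continuous_ofReal.comp_continuousOn
      (h.contMDiffOn_realDeriv (k := 1) (m := 2) hf (by norm_num) v).continuousOn
  exact continuousOn_pi.2 fun j ↦ ((h1 _).sub (continuousOn_const.mul (h1 _))).div_const 2

theorem IsCompact.exists_abs_le {B : Set M} (hB : IsCompact B) {f : M → ℝ} (hf : ContinuousOn f B) :
    ∃ k : ℝ, 0 ≤ k ∧ ∀ q ∈ B, |f q| ≤ k := by
  obtain ⟨k, hk⟩ := hB.exists_bound_of_continuousOn hf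
  exact ⟨max k 0, le_max_right _ _, fun q hq ↦ (hk q hq).trans (le_max_left _ _)⟩

/-- A strict supersolution near a boundary point which vanishes there. -/
theorem IsBoundaryChart.exists_barrier [T2Space M] [CompactSpace M]
    (h : IsBoundaryChart X.J U z ρ) (metric : HermitianMetric X) (hp : p₀ ∈ U)
    (hpb : p₀ ∈ (𝓡∂ (2 * n)).boundary M) {N : Set M} (hN : N ∈ 𝓝 p₀) :
    ∃ R > 0, ∃ A D : ℝ, 0 ≤ A ∧ IsCompact {x | x ∈ U ∧ sqDist z (z p₀) x ≤ R} ∧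
      {x | x ∈ U ∧ sqDist z (z p₀) x ≤ R} ⊆ N ∧
      ∀ q ∈ U, sqDist z (z p₀) q ≤ R → 0 ≤ ρ q - D * (ρ q * ρ q) ∧
        ∀ y, relTrace (coeff z metric.toRealOneOneForm q)
          (complexHessian z (fun x ↦ A * (ρ x - D * (ρ x * ρ x)) + 4 / R * sqDist z y x) q) ≤ -1 := by
  have hc := h.toIsHolomorphicChart
  obtain ⟨R₁, hR₁, hB₁, -⟩ := hc.exists_isCompact_ball hp hN
  have hsub₁ : {x | x ∈ U ∧ sqDist z (z p₀) x ≤ R₁} ⊆ U := fun x hx ↦ hx.1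
  obtain ⟨k, hk0, hk⟩ := hB₁.exists_abs_le ((continuousOn_relTrace hc metric
    (continuousOn_complexHessian hc h.contMDiffOn_rho_two)).mono hsub₁)
  obtain ⟨k', hk'0, hk'⟩ := hB₁.exists_abs_le ((continuousOn_relTrace hc metric
    (continuousOn_const (c := (1 : Matrix (Fin n) (Fin n) ℂ)))).mono hsub₁)
  have hg := continuousOn_complexGrad hc h.contMDiffOn_rho_two
  obtain ⟨α, hα, hαB⟩ := hB₁.exists_forall_le' ((continuousOn_relTrace hc metric
    (hg.matrix_vecMulVec' hg.star)).mono hsub₁) (a := 0) fun q hq ↦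
      relTrace_vecMulVec_pos (posDef_coeff hc hq.1 metric) (h.complexGrad_ne_zero q hq.1)
  -- The term `-2D|∂ρ|² ≤ -(k + 1)` outweighs the trace `k` of the Hessian of `ρ`, so `ρ - Dρ²` has
  -- trace at most `-1` where `2Dρ < 1`.
  set D := (k + 1) / (2 * α) with hD
  have hD0 : 0 < D := by positivity
  have hDα : 2 * D * α = k + 1 := by rw [hD]; field_simp
  have hρ0 : ρ p₀ = 0 := (h.mem_boundary_iff p₀ hp).1 hpb
  have hN₂ : {x | 2 * D * ρ x < 1} ∈ 𝓝 p₀ := by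
    have h1 : ContinuousAt (fun x ↦ 2 * D * ρ x) p₀ :=
      (h.contMDiffOn_rho.continuousOn.continuousAt (hc.isOpen.mem_nhds hp)).const_mul _
    exact h1.eventually (gt_mem_nhds (show 2 * D * ρ p₀ < 1 by rw [hρ0]; norm_num))
  obtain ⟨R, hR, hB, hBN⟩ := hc.exists_isCompact_ball hp (Filter.inter_mem hN (Filter.inter_mem hN₂
    (hc.sqDist_lt_mem_nhds hp (y := z p₀) (r := R₁) (by rwa [sqDist_self]))))
  -- The factor `A = 1 + 4k'/R` absorbs the trace of `4/R` times the squared distance and still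
  -- leaves `-1`.
  refine ⟨R, hR, 1 + 4 / R * k', D, by positivity, hB, fun x hx ↦ (hBN hx).1, fun q hq hqR ↦ ?_⟩
  obtain ⟨-, hq2, hq3⟩ := hBN ⟨hq, hqR⟩
  change 2 * D * ρ q < 1 at hq2
  have hρq := h.rho_nonneg q hq
  have hDρ : 0 ≤ D * ρ q := by positivity
  refine ⟨by nlinarith, fun y ↦ ?_⟩
  have hρC := h.contMDiffOn_rho_two
  have hρ2 : ContMDiffOn (𝓡∂ (2 * n)) 𝓘(ℝ, ℝ) 2 (fun x ↦ ρ x * ρ x) U := hρC.mul hρC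
  have hDρ2 : ContMDiffOn (𝓡∂ (2 * n)) 𝓘(ℝ, ℝ) 2 (fun x ↦ D * (ρ x * ρ x)) U :=
    contMDiffOn_const.mul hρ2
  have h1 : ContMDiffOn (𝓡∂ (2 * n)) 𝓘(ℝ, ℝ) 2 (fun x ↦ ρ x - D * (ρ x * ρ x)) U := hρC.sub hDρ2
  have h2 : ContMDiffOn (𝓡∂ (2 * n)) 𝓘(ℝ, ℝ) 2
    (fun x ↦ (1 + 4 / R * k') * (ρ x - D * (ρ x * ρ x))) U := contMDiffOn_const.mul h1
  have h3 : ContMDiffOn (𝓡∂ (2 * n)) 𝓘(ℝ, ℝ) 2 (sqDist z y) U := hc.contMDiffOn_sqDist y (k := 2)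
  have h4 : ContMDiffOn (𝓡∂ (2 * n)) 𝓘(ℝ, ℝ) 2 (fun x ↦ 4 / R * sqDist z y x) U :=
    contMDiffOn_const.mul h3
  rw [complexHessian_add hc h2 h4 hq, complexHessian_const_mul hc _ h1 hq,
    complexHessian_const_mul hc _ h3 hq, complexHessian_sqDist hc hq, complexHessian_sub hc hρC hDρ2 hq,
    complexHessian_const_mul hc _ hρ2 hq, complexHessian_mul hc hρC hρC hq]
  simp only [relTrace_add, relTrace_sub, relTrace_smul]
  have e1 := hk q ⟨hq, hq3.2.le⟩
  have e2 := hk' q ⟨hq, hq3.2.le⟩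
  have e3 := hαB q ⟨hq, hq3.2.le⟩
  set T := relTrace (coeff z metric.toRealOneOneForm q) (complexHessian z ρ q)
  set S := relTrace (coeff z metric.toRealOneOneForm q)
    (Matrix.vecMulVec (complexGrad z ρ q) (star (complexGrad z ρ q)))
  set I₁ := relTrace (coeff z metric.toRealOneOneForm q) 1
  have e4 : (1 - 2 * D * ρ q) * T ≤ k :=
    calc (1 - 2 * D * ρ q) * T ≤ (1 - 2 * D * ρ q) * k :=
          mul_le_mul_of_nonneg_left (abs_le.1 e1).2 (by linarith)
      _ ≤ 1 * k := mul_le_mul_of_nonneg_right (by linarith) hk0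
      _ = k := one_mul k
  have e5 : 2 * D * α ≤ 2 * D * S := mul_le_mul_of_nonneg_left e3 (by positivity)
  have e6 : T - D * (ρ q * T + ρ q * T + (S + S)) ≤ -1 := by
    have : T - D * (ρ q * T + ρ q * T + (S + S)) = (1 - 2 * D * ρ q) * T - 2 * D * S := by ring
    linarith
  have e7 : 4 / R * I₁ ≤ 4 / R * k' := mul_le_mul_of_nonneg_left (abs_le.1 e2).2 (by positivity)
  have e8 : (1 + 4 / R * k') * (T - D * (ρ q * T + ρ q * T + (S + S))) ≤ (1 + 4 / R * k') * (-1) :=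
    mul_le_mul_of_nonneg_left e6 (by positivity)
  linarith

end Barrier

/-! ### The bound of `u - uSub` from above -/

section UniformBound

variable {n : ℕ} [NeZero n] {M : Type*} [TopologicalSpace M]
  [ChartedSpace (EuclideanHalfSpace (2 * n)) M]
  [IsManifold (𝓡∂ (2 * n)) ∞ M] {X : ComplexStructure n M}
  {metric : HermitianMetric X} {χ : RealOneOneForm X} {uSub u ρ : M → ℝ} {σ : ℝ}
  {U : Set M} {z : M → (Fin n → ℂ)} {p₀ p q : M}

theorem IsDominatedSolution.relTrace_nonneg (hn : 1 ≤ n)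
    (hu : IsDominatedSolution metric χ uSub σ u)
    (h : IsHolomorphicChart X.J U z) (hq : q ∈ U) :
    0 ≤ relTrace (coeff z metric.toRealOneOneForm q) (gCoeff z χ u q) := by
  have huU : ContMDiffOn (𝓡∂ (2 * n)) 𝓘(ℝ, ℝ) 2 u U :=
    (hu.contMDiff.of_le (by norm_num)).contMDiffOn
  -- Any nonzero vector serves, since the conclusion on the full trace does not involve it.
  have h1 : (fun _ : Fin n ↦ (1 : ℂ)) ≠ 0 := fun h0 ↦ one_ne_zero (congrFun h0 0)
  exact (prod_pSums_le hn (posDef_coeff h hq metric) (isHermitian_gCoeff h hq χ huU) h1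
    (hu.admissible U z h q hq)).2.1

theorem IsDominatedSolution.relTrace_hessian (hu : IsDominatedSolution metric χ uSub σ u)
    (huSub : ContMDiff (𝓡∂ (2 * n)) 𝓘(ℝ, ℝ) ∞ uSub)
    (h : IsHolomorphicChart X.J U z) (hq : q ∈ U) :
    complexHessian z (fun x ↦ u x - uSub x) q = gCoeff z χ u q - gCoeff z χ uSub q :=
  (gCoeff_sub_gCoeff h hq χ (hu.contMDiff.of_le (by norm_num)).contMDiffOn
    (huSub.of_le (by norm_cast)).contMDiffOn).symm

/-- Admissibility makes `tr g_u` nonnegative, so `w` is a subsolution of the trace operator up to an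
error independent of `u`. The bound of `w` and the first bound of its normal derivative rest on this
alone. -/
theorem IsDominatedSolution.le_relTrace_hessian (hn : 1 ≤ n)
    (hu : IsDominatedSolution metric χ uSub σ u)
    (huSub : ContMDiff (𝓡∂ (2 * n)) 𝓘(ℝ, ℝ) ∞ uSub)
    (h : IsHolomorphicChart X.J U z) (hq : q ∈ U) :
    - relTrace (coeff z metric.toRealOneOneForm q) (gCoeff z χ uSub q) ≤
      relTrace (coeff z metric.toRealOneOneForm q) (complexHessian z (fun x ↦ u x - uSub x) q) := by
  rw [hu.relTrace_hessian huSub h hq, relTrace_sub]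
  linarith [hu.relTrace_nonneg hn h hq]

theorem continuousOn_gCoeff (h : IsHolomorphicChart X.J U z) (χ : RealOneOneForm X)
    (huSub : ContMDiff (𝓡∂ (2 * n)) 𝓘(ℝ, ℝ) ∞ uSub) : ContinuousOn (gCoeff z χ uSub) U :=
  (isC2Matrix_gCoeff h χ (huSub.of_le (by norm_cast)).contMDiffOn).continuousOn

/-- Comparison of the barrier with a function near a boundary point. -/
theorem IsBoundaryChart.nonneg_barrier [T2Space M]
    (h : IsBoundaryChart X.J U z ρ) {R A D : ℝ} (hA : 0 ≤ A)
    (hB : IsCompact {x | x ∈ U ∧ sqDist z (z p₀) x ≤ R})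
    (hbar : ∀ q ∈ U, sqDist z (z p₀) q ≤ R → 0 ≤ ρ q - D * (ρ q * ρ q) ∧
        ∀ y, relTrace (coeff z metric.toRealOneOneForm q)
          (complexHessian z (fun x ↦ A * (ρ x - D * (ρ x * ρ x)) + 4 / R * sqDist z y x) q) ≤ -1)
    (hpR : sqDist z (z p₀) p < R / 8) {w : M → ℝ} {T F : ℝ} (hT : F < T) (hT0 : 0 ≤ T)
    (hw : ContMDiffOn (𝓡∂ (2 * n)) 𝓘(ℝ, ℝ) 2 w U)
    (hwT : ∀ q ∈ U, sqDist z (z p₀) q ≤ R → w q ≤ T)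
    (hw0 : ∀ q ∈ U, q ∈ (𝓡∂ (2 * n)).boundary M → w q = 0)
    (hwF : ∀ q ∈ U, sqDist z (z p₀) q ≤ R →
      - F ≤ relTrace (coeff z metric.toRealOneOneForm q) (complexHessian z w q)) :
    ∀ q ∈ U, sqDist z (z p) q < R / 4 →
      0 ≤ T * (A * (ρ q - D * (ρ q * ρ q)) + 4 / R * sqDist z (z p) q) - w q := by
  have hc := h.toIsHolomorphicChart
  have hR : 0 < R := by linarith [sqDist_nonneg z (z p₀) p]
  have hρC := h.contMDiffOn_rho_two
  have hb : ContMDiffOn (𝓡∂ (2 * n)) 𝓘(ℝ, ℝ) 2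
      (fun x ↦ A * (ρ x - D * (ρ x * ρ x)) + 4 / R * sqDist z (z p) x) U :=
    (contMDiffOn_const.mul (hρC.sub (contMDiffOn_const.mul (hρC.mul hρC)))).add
      (contMDiffOn_const.mul (hc.contMDiffOn_sqDist (z p) (k := 2)))
  have hTb : ContMDiffOn (𝓡∂ (2 * n)) 𝓘(ℝ, ℝ) 2
      (fun x ↦ T * (A * (ρ x - D * (ρ x * ρ x)) + 4 / R * sqDist z (z p) x)) U :=
    contMDiffOn_const.mul hb
  refine nonneg_of_ball hc hB hpR (hTb.sub hw) fun q hq hqR hqp hneg ↦ ?_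
  obtain ⟨h1, h2⟩ := hbar q hq hqR
  have h3 : 0 ≤ A * (ρ q - D * (ρ q * ρ q)) := mul_nonneg hA h1
  refine ⟨fun heq ↦ ?_, fun hqb ↦ ?_, fun hpsd ↦ ?_⟩
  -- On the sphere the distance term alone contributes `T`, which is at least `w`.
  · have h4 : 4 / R * sqDist z (z p) q = 1 := by rw [heq]; field_simp
    have h5 : T * 1 ≤ T * (A * (ρ q - D * (ρ q * ρ q)) + 4 / R * sqDist z (z p) q) :=
      mul_le_mul_of_nonneg_left (by linarith) hT0
    have := hwT q hq hqR
    linarith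
  · have h4 : 0 ≤ 4 / R * sqDist z (z p) q := mul_nonneg (by positivity) (sqDist_nonneg _ _ _)
    have h5 : 0 ≤ T * (A * (ρ q - D * (ρ q * ρ q)) + 4 / R * sqDist z (z p) q) :=
      mul_nonneg hT0 (by linarith)
    rw [hw0 q hq hqb] at hneg
    linarith
  · have h4 := _root_.relTrace_nonneg (posDef_coeff hc hq metric) hpsd
    rw [complexHessian_sub hc hTb hw hq, complexHessian_const_mul hc T hb hq, relTrace_sub,
      relTrace_smul] at h4
    have h5 := hwF q hq hqR
    have h6 := mul_le_mul_of_nonneg_left (h2 (z p)) hT0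
    linarith

/-- Compactness replaces a global subsolution. If the maxima `S k` of `w k` tended to infinity, the
functions `1 - w k / S k` would be nonnegative and supersolutions up to errors tending to zero. By
the linear barrier they are at least `1/2` near each boundary point, so they are positive everywhere
for large `k`, yet they vanish at the maximum points. -/
theorem exists_uniform_bound [T2Space M] [CompactSpace M] (hn : 1 ≤ n)
    (metric : HermitianMetric X) (χ : RealOneOneForm X) (σ : ℝ)
    (huSub : ContMDiff (𝓡∂ (2 * n)) 𝓘(ℝ, ℝ) ∞ uSub) :
    ∃ C : ℝ, 0 < C ∧ ∀ u, IsDominatedSolution metric χ uSub σ u →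
      ∀ q ∈ boundaryComponents n M, u q - uSub q ≤ C := by
  by_contra hcon
  push Not at hcon
  have hK : IsCompact (boundaryComponents n M) := isClopen_boundaryComponents.isClosed.isCompact
  have hseq : ∀ k : ℕ, ∃ (u : M → ℝ) (p : M), IsDominatedSolution metric χ uSub σ u ∧
      p ∈ boundaryComponents n M ∧ (k : ℝ) + 1 < u p - uSub p ∧
      ∀ q ∈ boundaryComponents n M, u q - uSub q ≤ u p - uSub p := by
    intro k
    obtain ⟨u, hu, q, hq, hqk⟩ := hcon ((k : ℝ) + 1) (by positivity)
    obtain ⟨p, hp, hmax⟩ := hK.exists_isMaxOn ⟨q, hq⟩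
      (hu.contMDiff_sub huSub).continuous.continuousOn
    exact ⟨u, p, hu, hp, hqk.trans_le (hmax hq), fun q hq ↦ hmax hq⟩
  choose u p hu hp hpk hmax using hseq
  set S : ℕ → ℝ := fun k ↦ u k (p k) - uSub (p k) with hS
  have hS0 : ∀ k, 0 < S k := fun k ↦ by
    have : (0 : ℝ) ≤ k := Nat.cast_nonneg k
    linarith [hpk k]
  set v : ℕ → M → ℝ := fun k x ↦ 1 - (S k)⁻¹ * (u k x - uSub x) with hv
  have hw2 : ∀ k, ContMDiff (𝓡∂ (2 * n)) 𝓘(ℝ, ℝ) 2 (fun x ↦ u k x - uSub x) := fun k ↦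
    ((hu k).contMDiff_sub huSub).of_le (by norm_num)
  have hSw : ∀ k, ContMDiff (𝓡∂ (2 * n)) 𝓘(ℝ, ℝ) 2 (fun x ↦ (S k)⁻¹ * (u k x - uSub x)) :=
    fun k ↦ contMDiff_const.mul (hw2 k)
  have hvle : ∀ k, ∀ q ∈ boundaryComponents n M, (S k)⁻¹ * (u k q - uSub q) ≤ 1 := by
    intro k q hq
    rw [inv_mul_le_iff₀ (hS0 k), mul_one]
    exact hmax k q hq
  have hfrac : ∀ F : ℝ, ∀ e > 0, ∀ᶠ k in (atTop : Filter ℕ), (S k)⁻¹ * F ≤ e := by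
    intro F e he
    have h1 : Tendsto (fun k : ℕ ↦ (S k)⁻¹ * F) atTop (𝓝 (0 * F)) := by
      refine Tendsto.mul_const F (Tendsto.comp tendsto_inv_atTop_zero ?_)
      refine tendsto_atTop_mono (fun k ↦ ?_) (tendsto_natCast_atTop_atTop (R := ℝ))
      linarith [hpk k]
    rw [zero_mul] at h1
    filter_upwards [h1.eventually (gt_mem_nhds he)] with k hk using hk.le
  have hτ : ∀ (U : Set M) (z : M → (Fin n → ℂ)), IsHolomorphicChart X.J U z → ∀ q ∈ U, ∀ k,
      - ((S k)⁻¹ * relTrace (coeff z metric.toRealOneOneForm q) (gCoeff z χ uSub q)) ≤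
      relTrace (coeff z metric.toRealOneOneForm q)
        (complexHessian z (fun x ↦ (S k)⁻¹ * (u k x - uSub x)) q) := by
    intro U z h q hq k
    rw [complexHessian_const_mul h _ (hw2 k).contMDiffOn hq, relTrace_smul, ← mul_neg]
    exact mul_le_mul_of_nonneg_left ((hu k).le_relTrace_hessian hn huSub h hq)
      (inv_nonneg.2 (hS0 k).le)
  have key := eventuallyPosNear_of_boundary (J := X.J) (l := atTop) (v := v)
    (fun k ↦ contMDiff_const.sub (hSw k))
    (Eventually.of_forall fun k q hq ↦ sub_nonneg.2 (hvle k q hq)) ?_ ?_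
  · have hev : ∀ᶠ k in (atTop : Filter ℕ), ∀ q ∈ boundaryComponents n M, 0 < v k q := by
      -- Local positivity becomes positivity on the whole compact set, for one `k`.
      refine hK.induction_on (p := fun s ↦ ∀ᶠ k in (atTop : Filter ℕ), ∀ q ∈ s, 0 < v k q)
        (by simp) (fun s t hst ht ↦ ?_) (fun s t hs ht ↦ ?_) fun x hx ↦ ?_
      · filter_upwards [ht] with k hk q hq using hk q (hst hq)
      · filter_upwards [hs, ht] with k h1 h2 q hq using hq.elim (h1 q) (h2 q)
      · obtain ⟨θ, hθ, N, hN, hvN⟩ := key x hx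
        refine ⟨N, mem_nhdsWithin_of_mem_nhds hN, ?_⟩
        filter_upwards [hvN] with k hk q hq using hθ.trans_le (hk q hq)
    obtain ⟨k, hk⟩ := hev.exists
    have h1 := hk (p k) (hp k)
    have h2 : v k (p k) = 0 := by
      change 1 - (S k)⁻¹ * S k = 0
      rw [inv_mul_cancel₀ (hS0 k).ne', sub_self]
    linarith
  · intro b hb
    obtain ⟨U, z, ρ, hbU, h⟩ := exists_isBoundaryChart X b
    have hc := h.toIsHolomorphicChart
    obtain ⟨R, hR, A, D, hA, hB, hBN, hbar⟩ := h.exists_barrier metric hbU hb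
      (isClopen_boundaryComponents.isOpen.mem_nhds (boundary_subset_boundaryComponents hb))
    obtain ⟨F, hF0, hF⟩ := hB.exists_abs_le ((continuousOn_relTrace hc metric
      (continuousOn_gCoeff hc χ huSub)).mono fun x hx ↦ hx.1)
    have hρ0 : ρ b = 0 := (h.mem_boundary_iff b hbU).1 hb
    set β : M → ℝ := fun q ↦ A * (ρ q - D * (ρ q * ρ q)) + 4 / R * sqDist z (z b) q with hβ
    have hβb : β b = 0 := by simp [hβ, hρ0, sqDist_self]
    have hβc : ContinuousAt β b := by
      have hρc : ContinuousAt ρ b :=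
        h.contMDiffOn_rho.continuousOn.continuousAt (hc.isOpen.mem_nhds hbU)
      have hsc : ContinuousAt (sqDist z (z b)) b :=
        (hc.continuousOn_sqDist _).continuousAt (hc.isOpen.mem_nhds hbU)
      fun_prop
    -- On the part of the ball where the barrier `β` is below `1/2`, the bound `w k / S k ≤ β` gives
    -- `v k ≥ 1/2`.
    refine ⟨1 / 2, by norm_num, _, Filter.inter_mem (hc.sqDist_lt_mem_nhds hbU (y := z b) (r := R / 4)
      (by rw [sqDist_self]; positivity))
      (hβc.eventually (gt_mem_nhds (show β b < 1 / 2 by rw [hβb]; norm_num))), ?_⟩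
    filter_upwards [hfrac F (1 / 2) (by norm_num)] with k hk
    rintro q ⟨⟨hqU, hqR⟩, hqβ⟩
    have h1 := h.nonneg_barrier (metric := metric) (p₀ := b) (p := b) (T := 1) (F := 1 / 2) hA hB hbar
      (by rw [sqDist_self]; positivity) (by norm_num) zero_le_one (hSw k).contMDiffOn
      (fun q hq hqR ↦ hvle k q (hBN ⟨hq, hqR⟩))
      (fun q _ hqb ↦ by rw [(hu k).boundary_eq q hqb, sub_self, mul_zero])
      (fun q hq hqR ↦ by
        have h2 := hτ U z hc q hq k
        have h3 := mul_le_mul_of_nonneg_left (abs_le.1 (hF q ⟨hq, hqR⟩)).2 (inv_nonneg.2 (hS0 k).le)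
        linarith) q hqU hqR
    change β q < 1 / 2 at hqβ
    rw [one_mul] at h1
    change 0 ≤ β q - _ at h1
    change 1 / 2 ≤ 1 - (S k)⁻¹ * (u k q - uSub q)
    linarith
  · intro x
    obtain ⟨U, z, hxU, h⟩ := X.exists_chart x
    obtain ⟨R, hR, hB, -⟩ := h.exists_isCompact_ball hxU univ_mem
    obtain ⟨F, hF0, hF⟩ := hB.exists_abs_le ((continuousOn_relTrace h metric
      (continuousOn_gCoeff h χ huSub)).mono fun x hx ↦ hx.1)
    refine ⟨U, z, fun q ↦ (coeff z metric.toRealOneOneForm q)⁻¹, hxU, h,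
      ((isC2Matrix_coeff h metric.toRealOneOneForm).inv
        fun _ hq ↦ (posDef_coeff h hq metric).det_pos.ne').continuousOn,
      fun q hq ↦ (posDef_coeff h hq metric).inv, _,
      h.sqDist_lt_mem_nhds hxU (y := z x) (r := R) (by rwa [sqDist_self]), fun e he ↦ ?_⟩
    filter_upwards [hfrac F e he] with k hk q hq
    have h1 := hτ U z h q hq.1 k
    have h2 := (abs_le.1 (hF q ⟨hq.1, hq.2.le⟩)).2
    have h3 := mul_le_mul_of_nonneg_left h2 (inv_nonneg.2 (hS0 k).le)
    rw [complexHessian_sub h contMDiffOn_const (hSw k).contMDiffOn hq.1,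
      complexHessian_const h hq.1, zero_sub]
    change relTrace _ _ ≤ e
    rw [show -complexHessian z (fun x ↦ (S k)⁻¹ * (u k x - uSub x)) q =
      0 - complexHessian z (fun x ↦ (S k)⁻¹ * (u k x - uSub x)) q by rw [zero_sub], relTrace_sub]
    have h4 : relTrace (coeff z metric.toRealOneOneForm q) 0 = 0 := by simp [relTrace]
    linarith

end UniformBound

/-! ### The barrier for the sharp bound -/

section BarrierFunction

/-- The complex Hessian of `ρη - ερ + Bρr + Aρ² + Er²`, where `r` has complex Hessian `1`. -/
def barrierMatrix {n : ℕ} (a g b : Fin n → ℂ) (F H : Matrix (Fin n) (Fin n) ℂ)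
    (ρ η r ε B A E : ℝ) : Matrix (Fin n) (Fin n) ℂ :=
  ((ρ : ℂ) • H + (η : ℂ) • F + (Matrix.vecMulVec a (star g) + Matrix.vecMulVec g (star a))) +
    ((-ε : ℝ) : ℂ) • F +
    (B : ℂ) • ((ρ : ℂ) • (1 : Matrix (Fin n) (Fin n) ℂ) + (r : ℂ) • F +
      (Matrix.vecMulVec a (star b) + Matrix.vecMulVec b (star a))) +
    (A : ℂ) • ((ρ : ℂ) • F + (ρ : ℂ) • F +
      (Matrix.vecMulVec a (star a) + Matrix.vecMulVec a (star a))) +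
    (E : ℂ) • ((r : ℂ) • (1 : Matrix (Fin n) (Fin n) ℂ) + (r : ℂ) • (1 : Matrix (Fin n) (Fin n) ℂ) +
      (Matrix.vecMulVec b (star b) + Matrix.vecMulVec b (star b)))

variable {n : ℕ} [NeZero n] {M : Type*} [TopologicalSpace M]
  [ChartedSpace (EuclideanHalfSpace (2 * n)) M]
  {J : ∀ p : M, TangentSpace (𝓡∂ (2 * n)) p →L[ℝ] TangentSpace (𝓡∂ (2 * n)) p}
  {ρ η : M → ℝ} {U : Set M} {z : M → (Fin n → ℂ)} {q : M}

theorem realDeriv_sub {f g : M → ℝ} (h : IsHolomorphicChart J U z)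
    (hf : ContMDiffOn (𝓡∂ (2 * n)) 𝓘(ℝ, ℝ) 2 f U)
    (hg : ContMDiffOn (𝓡∂ (2 * n)) 𝓘(ℝ, ℝ) 2 g U) (hq : q ∈ U) (v : Fin n → ℂ) :
    realDeriv z v (fun x ↦ f x - g x) q = realDeriv z v f q - realDeriv z v g q := by
  have : (fun x ↦ f x - g x) = fun x ↦ f x + (-1) * g x := by ext x; ring
  have hcg : ContMDiffOn (𝓡∂ (2 * n)) 𝓘(ℝ, ℝ) 2 (fun x ↦ (-1) * g x) U := contMDiffOn_const.mul hg
  rw [this, realDeriv_add (h.mdifferentiableAt hf (by simp) hq)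
    (h.mdifferentiableAt hcg (by simp) hq), realDeriv_const_mul _ (h.mdifferentiableAt hg (by simp) hq)]
  ring

theorem realDeriv_sqDist_self
    (h : IsHolomorphicChart J U z) (hq : q ∈ U) (v : Fin n → ℂ) :
    realDeriv z v (sqDist z (z q)) q = 0 := by
  rw [realDeriv_sqDist h hq]
  simp

/-- The barrier for the sharp bound of the normal derivative. -/
def normalBarrier (z : M → (Fin n → ℂ)) (ρ η : M → ℝ) (ε B A E : ℝ) (y : Fin n → ℂ) (x : M) : ℝ :=
  ρ x * η x + (-ε) * ρ x + B * (ρ x * sqDist z y x) + A * (ρ x * ρ x) +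
    E * (sqDist z y x * sqDist z y x)

theorem contMDiffOn_normalBarrier (h : IsHolomorphicChart J U z)
    (hρ : ContMDiffOn (𝓡∂ (2 * n)) 𝓘(ℝ, ℝ) 2 ρ U) (hη : ContMDiffOn (𝓡∂ (2 * n)) 𝓘(ℝ, ℝ) 2 η U)
    (ε B A E : ℝ) (y : Fin n → ℂ) :
    ContMDiffOn (𝓡∂ (2 * n)) 𝓘(ℝ, ℝ) 2 (normalBarrier z ρ η ε B A E y) U := by
  have hr : ContMDiffOn (𝓡∂ (2 * n)) 𝓘(ℝ, ℝ) 2 (sqDist z y) U := h.contMDiffOn_sqDist y (k := 2)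
  exact ((((hρ.mul hη).add (contMDiffOn_const.mul hρ)).add (contMDiffOn_const.mul (hρ.mul hr))).add
    (contMDiffOn_const.mul (hρ.mul hρ))).add (contMDiffOn_const.mul (hr.mul hr))

/-- At the base point `ρ`, `r` and `dr` vanish, so only the terms linear in `ρ` contribute to the
normal derivative. -/
theorem realDeriv_normalBarrier (h : IsHolomorphicChart J U z)
    (hρ : ContMDiffOn (𝓡∂ (2 * n)) 𝓘(ℝ, ℝ) 2 ρ U) (hη : ContMDiffOn (𝓡∂ (2 * n)) 𝓘(ℝ, ℝ) 2 η U)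
    (ε B A E : ℝ) (hq : q ∈ U) (hρq : ρ q = 0) (v : Fin n → ℂ) :
    realDeriv z v (normalBarrier z ρ η ε B A E (z q)) q = (η q - ε) * realDeriv z v ρ q := by
  have hr : ContMDiffOn (𝓡∂ (2 * n)) 𝓘(ℝ, ℝ) 2 (sqDist z (z q)) U :=
    h.contMDiffOn_sqDist (z q) (k := 2)
  have hmd := fun {f : M → ℝ} (hf : ContMDiffOn (𝓡∂ (2 * n)) 𝓘(ℝ, ℝ) 2 f U) ↦
    h.mdifferentiableAt hf (by simp) hq
  have h1 : ContMDiffOn (𝓡∂ (2 * n)) 𝓘(ℝ, ℝ) 2 (fun x ↦ ρ x * η x) U := hρ.mul hη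
  have h2 : ContMDiffOn (𝓡∂ (2 * n)) 𝓘(ℝ, ℝ) 2 (fun x ↦ (-ε) * ρ x) U := contMDiffOn_const.mul hρ
  have h3 : ContMDiffOn (𝓡∂ (2 * n)) 𝓘(ℝ, ℝ) 2 (fun x ↦ ρ x * sqDist z (z q) x) U := hρ.mul hr
  have h4 : ContMDiffOn (𝓡∂ (2 * n)) 𝓘(ℝ, ℝ) 2 (fun x ↦ ρ x * ρ x) U := hρ.mul hρ
  have h5 : ContMDiffOn (𝓡∂ (2 * n)) 𝓘(ℝ, ℝ) 2
    (fun x ↦ sqDist z (z q) x * sqDist z (z q) x) U := hr.mul hr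
  have h3' : ContMDiffOn (𝓡∂ (2 * n)) 𝓘(ℝ, ℝ) 2 (fun x ↦ B * (ρ x * sqDist z (z q) x)) U :=
    contMDiffOn_const.mul h3
  have h4' : ContMDiffOn (𝓡∂ (2 * n)) 𝓘(ℝ, ℝ) 2 (fun x ↦ A * (ρ x * ρ x)) U :=
    contMDiffOn_const.mul h4
  have h5' : ContMDiffOn (𝓡∂ (2 * n)) 𝓘(ℝ, ℝ) 2
    (fun x ↦ E * (sqDist z (z q) x * sqDist z (z q) x)) U := contMDiffOn_const.mul h5
  have s1 : ContMDiffOn (𝓡∂ (2 * n)) 𝓘(ℝ, ℝ) 2 (fun x ↦ ρ x * η x + (-ε) * ρ x) U := h1.add h2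
  have s2 : ContMDiffOn (𝓡∂ (2 * n)) 𝓘(ℝ, ℝ) 2
    (fun x ↦ ρ x * η x + (-ε) * ρ x + B * (ρ x * sqDist z (z q) x)) U := s1.add h3'
  have s3 : ContMDiffOn (𝓡∂ (2 * n)) 𝓘(ℝ, ℝ) 2
    (fun x ↦ ρ x * η x + (-ε) * ρ x + B * (ρ x * sqDist z (z q) x) + A * (ρ x * ρ x)) U := s2.add h4'
  unfold normalBarrier
  rw [realDeriv_add (hmd s3) (hmd h5'), realDeriv_add (hmd s2) (hmd h4'),
    realDeriv_add (hmd s1) (hmd h3'), realDeriv_add (hmd h1) (hmd h2),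
    realDeriv_const_mul _ (hmd h5), realDeriv_const_mul _ (hmd h4), realDeriv_const_mul _ (hmd h3),
    realDeriv_const_mul _ (hmd hρ), realDeriv_mul (hmd hρ) (hmd hη), realDeriv_mul (hmd hρ) (hmd hρ),
    realDeriv_mul (hmd hρ) (hmd hr), realDeriv_mul (hmd hr) (hmd hr), realDeriv_sqDist_self h hq,
    sqDist_self, hρq]
  ring

end BarrierFunction

/-! ### The first bound of the normal derivative, and the Hessian of the barrier -/

section NormalDerivative

variable {n : ℕ} [NeZero n] {M : Type*} [TopologicalSpace M]
  [ChartedSpace (EuclideanHalfSpace (2 * n)) M]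
  [IsManifold (𝓡∂ (2 * n)) ∞ M] {X : ComplexStructure n M}
  {metric : HermitianMetric X} {χ : RealOneOneForm X} {uSub u ρ η : M → ℝ} {σ : ℝ}
  {U : Set M} {z : M → (Fin n → ℂ)} {p₀ p q : M}

theorem IsDominatedSolution.contMDiffOn_sub (hu : IsDominatedSolution metric χ uSub σ u)
    (huSub : ContMDiff (𝓡∂ (2 * n)) 𝓘(ℝ, ℝ) ∞ uSub) (U : Set M) :
    ContMDiffOn (𝓡∂ (2 * n)) 𝓘(ℝ, ℝ) 2 (fun x ↦ u x - uSub x) U :=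
  ((hu.contMDiff_sub huSub).of_le (by norm_num)).contMDiffOn

/-- A multiple of the linear barrier lies above `w` near `p` and equals it at `p`; there its normal
derivative is `T A`. -/
theorem IsBoundaryChart.exists_normalDeriv_le [T2Space M] [CompactSpace M] (hn : 1 ≤ n)
    (h : IsBoundaryChart X.J U z ρ) (metric : HermitianMetric X) (χ : RealOneOneForm X) (σ : ℝ)
    (huSub : ContMDiff (𝓡∂ (2 * n)) 𝓘(ℝ, ℝ) ∞ uSub)
    (hp : p₀ ∈ U) (hpb : p₀ ∈ (𝓡∂ (2 * n)).boundary M) :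
    ∃ C : ℝ, 0 ≤ C ∧ ∀ᶠ p in 𝓝 p₀, p ∈ (𝓡∂ (2 * n)).boundary M →
      ∀ u, IsDominatedSolution metric χ uSub σ u → ∀ t : ℝ,
      (∀ v, realDeriv z v (fun x ↦ u x - uSub x) p = t * realDeriv z v ρ p) → t ≤ C := by
  have hc := h.toIsHolomorphicChart
  obtain ⟨C₀, hC₀, hC⟩ := exists_uniform_bound hn metric χ σ huSub
  obtain ⟨R, hR, A, D, hA, hB, hBN, hbar⟩ := h.exists_barrier metric hp hpb
    (isClopen_boundaryComponents.isOpen.mem_nhds (boundary_subset_boundaryComponents hpb))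
  obtain ⟨F, hF0, hF⟩ := hB.exists_abs_le ((continuousOn_relTrace hc metric
    (continuousOn_gCoeff hc χ huSub)).mono fun x hx ↦ hx.1)
  -- The multiple must exceed both the maximum of `w`, for the sphere, and the error `F`, for the
  -- interior.
  set T := max C₀ (F + 1) with hT
  have hT0 : 0 ≤ T := hC₀.le.trans (le_max_left _ _)
  have hFT : F < T := (lt_add_one F).trans_le (le_max_right _ _)
  refine ⟨T * A, by positivity, ?_⟩
  filter_upwards [hc.sqDist_lt_mem_nhds hp (y := z p₀) (r := R / 8)
    (by rw [sqDist_self]; positivity)] with p hpR hpb u hu t ht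
  obtain ⟨hpU, hpR⟩ := hpR
  have hw := hu.contMDiffOn_sub huSub U
  have hnn := h.nonneg_barrier hA hB hbar hpR hFT hT0 hw
    (fun q hq hqR ↦ (hC u hu q (hBN ⟨hq, hqR⟩)).trans (le_max_left _ _))
    (fun q _ hqb ↦ sub_eq_zero.2 (hu.boundary_eq q hqb))
    (fun q hq hqR ↦ by
      have h1 := hu.le_relTrace_hessian hn huSub hc hq
      have h2 := (abs_le.1 (hF q ⟨hq, hqR⟩)).2
      linarith)
  have hρC := h.contMDiffOn_rho_two
  have hρ0 : ρ p = 0 := (h.mem_boundary_iff p hpU).1 hpb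
  have hwp : u p - uSub p = 0 := sub_eq_zero.2 (hu.boundary_eq p hpb)
  have hρ2 : ContMDiffOn (𝓡∂ (2 * n)) 𝓘(ℝ, ℝ) 2 (fun x ↦ ρ x * ρ x) U := hρC.mul hρC
  have hDρ2 : ContMDiffOn (𝓡∂ (2 * n)) 𝓘(ℝ, ℝ) 2 (fun x ↦ D * (ρ x * ρ x)) U :=
    contMDiffOn_const.mul hρ2
  have h1 : ContMDiffOn (𝓡∂ (2 * n)) 𝓘(ℝ, ℝ) 2 (fun x ↦ ρ x - D * (ρ x * ρ x)) U := hρC.sub hDρ2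
  have h2 : ContMDiffOn (𝓡∂ (2 * n)) 𝓘(ℝ, ℝ) 2
    (fun x ↦ A * (ρ x - D * (ρ x * ρ x))) U := contMDiffOn_const.mul h1
  have h3 : ContMDiffOn (𝓡∂ (2 * n)) 𝓘(ℝ, ℝ) 2 (sqDist z (z p)) U :=
    hc.contMDiffOn_sqDist (z p) (k := 2)
  have h4 : ContMDiffOn (𝓡∂ (2 * n)) 𝓘(ℝ, ℝ) 2 (fun x ↦ 4 / R * sqDist z (z p) x) U :=
    contMDiffOn_const.mul h3
  have hβ : ContMDiffOn (𝓡∂ (2 * n)) 𝓘(ℝ, ℝ) 2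
    (fun x ↦ A * (ρ x - D * (ρ x * ρ x)) + 4 / R * sqDist z (z p) x) U := h2.add h4
  have hTβ : ContMDiffOn (𝓡∂ (2 * n)) 𝓘(ℝ, ℝ) 2
    (fun x ↦ T * (A * (ρ x - D * (ρ x * ρ x)) + 4 / R * sqDist z (z p) x)) U :=
    contMDiffOn_const.mul hβ
  have hmd := fun {f : M → ℝ} (hf : ContMDiffOn (𝓡∂ (2 * n)) 𝓘(ℝ, ℝ) 2 f U) ↦
    hc.mdifferentiableAt hf (by simp) hpU
  have key := h.normalDeriv_nonneg hpU hpb (hTβ.sub hw) (t := T * A - t) ?_ ?_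
  · linarith
  · filter_upwards [hc.sqDist_lt_mem_nhds hpU (y := z p) (r := R / 4)
      (by rw [sqDist_self]; positivity)] with x hx
    have := hnn x hx.1 hx.2
    simpa [hρ0, sqDist_self, hwp] using this
  · intro v
    change realDeriv z v (fun x ↦ T * (A * (ρ x - D * (ρ x * ρ x)) + 4 / R * sqDist z (z p) x) -
      (u x - uSub x)) p = _
    rw [realDeriv_sub hc hTβ hw hpU, realDeriv_const_mul T (hmd hβ), realDeriv_add (hmd h2) (hmd h4),
      realDeriv_const_mul _ (hmd h1), realDeriv_const_mul _ (hmd h3), realDeriv_sqDist_self hc hpU,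
      realDeriv_sub hc hρC hDρ2 hpU, realDeriv_const_mul _ (hmd hρ2), realDeriv_mul (hmd hρC) (hmd hρC),
      hρ0, ht]
    ring

theorem complexHessian_normalBarrier
    {J : ∀ p : M, TangentSpace (𝓡∂ (2 * n)) p →L[ℝ] TangentSpace (𝓡∂ (2 * n)) p}
    (h : IsHolomorphicChart J U z)
    (hρ : ContMDiffOn (𝓡∂ (2 * n)) 𝓘(ℝ, ℝ) 2 ρ U) (hη : ContMDiffOn (𝓡∂ (2 * n)) 𝓘(ℝ, ℝ) 2 η U)
    (ε B A E : ℝ) (y : Fin n → ℂ) (hq : q ∈ U) :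
    complexHessian z (normalBarrier z ρ η ε B A E y) q =
      barrierMatrix (complexGrad z ρ q) (complexGrad z η q) (star (z q - y)) (complexHessian z ρ q)
        (complexHessian z η q) (ρ q) (η q) (sqDist z y q) ε B A E := by
  have hr : ContMDiffOn (𝓡∂ (2 * n)) 𝓘(ℝ, ℝ) 2 (sqDist z y) U :=
    h.contMDiffOn_sqDist y (k := 2)
  have h1 : ContMDiffOn (𝓡∂ (2 * n)) 𝓘(ℝ, ℝ) 2 (fun x ↦ ρ x * η x) U := hρ.mul hη
  have h2 : ContMDiffOn (𝓡∂ (2 * n)) 𝓘(ℝ, ℝ) 2 (fun x ↦ (-ε) * ρ x) U := contMDiffOn_const.mul hρ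
  have h3 : ContMDiffOn (𝓡∂ (2 * n)) 𝓘(ℝ, ℝ) 2 (fun x ↦ ρ x * sqDist z y x) U := hρ.mul hr
  have h4 : ContMDiffOn (𝓡∂ (2 * n)) 𝓘(ℝ, ℝ) 2 (fun x ↦ ρ x * ρ x) U := hρ.mul hρ
  have h5 : ContMDiffOn (𝓡∂ (2 * n)) 𝓘(ℝ, ℝ) 2
    (fun x ↦ sqDist z y x * sqDist z y x) U := hr.mul hr
  have h3' : ContMDiffOn (𝓡∂ (2 * n)) 𝓘(ℝ, ℝ) 2 (fun x ↦ B * (ρ x * sqDist z y x)) U :=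
    contMDiffOn_const.mul h3
  have h4' : ContMDiffOn (𝓡∂ (2 * n)) 𝓘(ℝ, ℝ) 2 (fun x ↦ A * (ρ x * ρ x)) U :=
    contMDiffOn_const.mul h4
  have h5' : ContMDiffOn (𝓡∂ (2 * n)) 𝓘(ℝ, ℝ) 2
    (fun x ↦ E * (sqDist z y x * sqDist z y x)) U := contMDiffOn_const.mul h5
  have s1 : ContMDiffOn (𝓡∂ (2 * n)) 𝓘(ℝ, ℝ) 2 (fun x ↦ ρ x * η x + (-ε) * ρ x) U := h1.add h2
  have s2 : ContMDiffOn (𝓡∂ (2 * n)) 𝓘(ℝ, ℝ) 2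
    (fun x ↦ ρ x * η x + (-ε) * ρ x + B * (ρ x * sqDist z y x)) U := s1.add h3'
  have s3 : ContMDiffOn (𝓡∂ (2 * n)) 𝓘(ℝ, ℝ) 2
    (fun x ↦ ρ x * η x + (-ε) * ρ x + B * (ρ x * sqDist z y x) + A * (ρ x * ρ x)) U := s2.add h4'
  unfold normalBarrier
  rw [complexHessian_add h s3 h5' hq, complexHessian_add h s2 h4' hq, complexHessian_add h s1 h3' hq,
    complexHessian_add h h1 h2 hq, complexHessian_const_mul h _ h5 hq,
    complexHessian_const_mul h _ h4 hq, complexHessian_const_mul h _ h3 hq,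
    complexHessian_const_mul h _ hρ hq, complexHessian_mul h hρ hη hq, complexHessian_mul h hρ hρ hq,
    complexHessian_mul h hρ hr hq, complexHessian_mul h hr hr hq, complexHessian_sqDist h hq,
    complexGrad_sqDist h hq, barrierMatrix]

end NormalDerivative

/-! ### Traces of the Hessian of the barrier -/

section BarrierTraces

variable {n : ℕ} {W : Matrix (Fin n) (Fin n) ℂ} {a g b : Fin n → ℂ}
  {F H : Matrix (Fin n) (Fin n) ℂ} {ρ η r ε B A E : ℝ}

/-- The Cauchy–Schwarz inequality: for `b ≠ 0` the matrix is `|b|²` times `tangentInv 1 b`. -/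
theorem posSemidef_smul_one_sub_vecMulVec (b : Fin n → ℂ) :
    (((star b ⬝ᵥ b) : ℂ) • (1 : Matrix (Fin n) (Fin n) ℂ) -
      Matrix.vecMulVec b (star b)).PosSemidef := by
  rcases eq_or_ne b 0 with rfl | hb
  · simp [Matrix.PosSemidef.zero]
  have h1 : (1 : Matrix (Fin n) (Fin n) ℂ).PosDef := Matrix.PosDef.one
  have h2 := trace_vecMulVec_inv_ne_zero h1 hb
  have h3 : (Matrix.vecMulVec b (star b) * (1 : Matrix (Fin n) (Fin n) ℂ)⁻¹).trace = star b ⬝ᵥ b := by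
    rw [inv_one, Matrix.mul_one, Matrix.trace_vecMulVec, dotProduct_comm]
  have h4 := (posSemidef_tangentInv h1 hb).smul (dotProduct_star_self_nonneg b)
  rw [h3] at h2
  rwa [tangentInv, h3, smul_sub, smul_smul, mul_inv_cancel₀ h2, one_smul, inv_one, Matrix.one_mul,
    Matrix.mul_one] at h4

/-- All terms with a factor `a = ∂ρ` vanish. The remaining gradient term comes from `Er²`, and `bb*
≤ |b|² = r` makes it of order `r`. What is left is sorted by `ρ`, `η - ε` and `r`, so that `A` and
`B` can be chosen to make the coefficients of `ρ` and `r` nonpositive. -/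
theorem tangentTrace_barrierMatrix_le (hW : W.PosDef) (ha : a ≠ 0) (hb : star b ⬝ᵥ b = (r : ℂ))
    (hE : 0 ≤ E) :
    tangentTrace W a (barrierMatrix a g b F H ρ η r ε B A E) ≤
      ρ * (tangentTrace W a H + B * tangentTrace W a 1 + 2 * A * tangentTrace W a F) +
      (η - ε) * tangentTrace W a F +
      r * (4 * E * tangentTrace W a 1 + B * tangentTrace W a F) := by
  have h1 := tangentTrace_nonneg hW ha (posSemidef_smul_one_sub_vecMulVec b)
  rw [hb, tangentTrace_sub, tangentTrace_smul] at h1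
  simp only [barrierMatrix, tangentTrace_add, tangentTrace_smul, tangentTrace_vecMulVec_left hW ha,
    tangentTrace_vecMulVec_right hW ha]
  have h2 := mul_nonneg hE h1
  linarith

theorem mul_le_of_abs_le {x y c d : ℝ} (hx : |x| ≤ c) (hy : |y| ≤ d) : x * y ≤ c * d :=
  (le_abs_self _).trans ((abs_mul x y).trans_le
    (mul_le_mul hx hy (abs_nonneg y) ((abs_nonneg x).trans hx)))

/-- A crude bound is enough. It depends on `ε` only through `|ε| ≤ 1`, which allows `ε` to be chosen
after it. -/
theorem relTrace_barrierMatrix_le (hW : W.PosDef) (hb : star b ⬝ᵥ b = (r : ℂ))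
    (hB : 0 ≤ B) (hA : 0 ≤ A) (hE : 0 ≤ E) {c₁ c₂ c₃ c₄ c₅ c₆ c₇ c₈ : ℝ}
    (h₁ : |ρ| ≤ c₁) (h₂ : |relTrace W H| ≤ c₂) (h₃ : |η| ≤ c₃) (h₄ : |relTrace W F| ≤ c₄)
    (h₅ : |relTrace W (Matrix.vecMulVec a (star a))| ≤ c₅)
    (h₆ : |relTrace W (Matrix.vecMulVec g (star g))| ≤ c₆)
    (h₇ : |relTrace W 1| ≤ c₇) (h₈ : |r| ≤ c₈) (hε : |ε| ≤ 1) :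
    relTrace W (barrierMatrix a g b F H ρ η r ε B A E) ≤
      c₁ * c₂ + c₃ * c₄ + (c₅ + c₆) + 1 * c₄ + B * (c₁ * c₇ + c₈ * c₄ + (c₅ + c₈ * c₇)) +
        A * (2 * (c₁ * c₄) + 2 * c₅) + E * (4 * (c₈ * c₇)) := by
  have h1 := _root_.relTrace_nonneg hW (posSemidef_smul_one_sub_vecMulVec b)
  rw [hb, relTrace_sub, relTrace_smul] at h1
  have h2 := relTrace_cross_le hW a g
  have h3 := relTrace_cross_le hW a b
  rw [relTrace_add] at h2 h3
  simp only [barrierMatrix, relTrace_add, relTrace_smul]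
  have e1 := mul_le_of_abs_le h₁ h₂
  have e2 := mul_le_of_abs_le h₃ h₄
  have e3 : -ε * relTrace W F ≤ 1 * c₄ := mul_le_of_abs_le (by rwa [abs_neg]) h₄
  have e4 := mul_le_of_abs_le h₁ h₇
  have e5 := mul_le_of_abs_le h₈ h₄
  have e6 := mul_le_of_abs_le h₈ h₇
  have e7 := mul_le_of_abs_le h₁ h₄
  have e8 := (abs_le.1 h₅).2
  have e9 := (abs_le.1 h₆).2
  have f1 := mul_le_mul_of_nonneg_left (show ρ * relTrace W 1 + r * relTrace W F +
    (relTrace W (Matrix.vecMulVec a (star b)) + relTrace W (Matrix.vecMulVec b (star a))) ≤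
      c₁ * c₇ + c₈ * c₄ + (c₅ + c₈ * c₇) by linarith) hB
  have f2 := mul_le_mul_of_nonneg_left (show ρ * relTrace W F + ρ * relTrace W F +
    (relTrace W (Matrix.vecMulVec a (star a)) + relTrace W (Matrix.vecMulVec a (star a))) ≤
      2 * (c₁ * c₄) + 2 * c₅ by linarith) hA
  have f3 := mul_le_mul_of_nonneg_left (show r * relTrace W 1 + r * relTrace W 1 +
    (relTrace W (Matrix.vecMulVec b (star b)) + relTrace W (Matrix.vecMulVec b (star b))) ≤
      4 * (c₈ * c₇) by linarith) hE
  linarith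

end BarrierTraces

theorem star_dotProduct_grad_sqDist {n : ℕ} {M : Type*} (z : M → (Fin n → ℂ)) (y : Fin n → ℂ) (q : M) :
    star (star (z q - y)) ⬝ᵥ star (z q - y) = (sqDist z y q : ℂ) := by
  rw [star_star, sqDist, Complex.ofReal_sum, dotProduct]
  refine Finset.sum_congr rfl fun j _ ↦ ?_
  exact Complex.mul_conj _

/-! ### The sharp bound of the normal derivative -/

section SharpBound

variable {n : ℕ} [NeZero n] {M : Type*} [TopologicalSpace M]
  [ChartedSpace (EuclideanHalfSpace (2 * n)) M]
  [IsManifold (𝓡∂ (2 * n)) ∞ M] {X : ComplexStructure n M}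
  {metric : HermitianMetric X} {χ : RealOneOneForm X} {uSub u ρ η : M → ℝ} {σ : ℝ}
  {U : Set M} {z : M → (Fin n → ℂ)} {p₀ p q : M}

set_option maxHeartbeats 1600000 in
/-- The sharp bound of the normal derivative of `u - uSub`, where the boundary is strictly
pseudoconcave with respect to the metric (the trace of `√-1∂∂̄ρ` is negative). -/
theorem IsBoundaryChart.exists_normalDeriv_le_sub [T2Space M] [CompactSpace M] (hn : 2 ≤ n)
    (h : IsBoundaryChart X.J U z ρ) (metric : HermitianMetric X) (χ : RealOneOneForm X)
    (hσ : 0 < σ) (huSub : ContMDiff (𝓡∂ (2 * n)) 𝓘(ℝ, ℝ) ∞ uSub)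
    (hadm : IsAdmissible (n - 1) metric χ uSub)
    (hp : p₀ ∈ U) (hpb : p₀ ∈ (𝓡∂ (2 * n)).boundary M)
    (hκ : ∀ q ∈ U, tangentTrace (coeff z metric.toRealOneOneForm q) (complexGrad z ρ q)
      (complexHessian z ρ q) < 0) :
    ∃ ε : ℝ, 0 < ε ∧ ∀ᶠ p in 𝓝 p₀, p ∈ (𝓡∂ (2 * n)).boundary M →
      ∀ u, IsDominatedSolution metric χ uSub σ u → ∀ t : ℝ,
      (∀ v, realDeriv z v (fun x ↦ u x - uSub x) p = t * realDeriv z v ρ p) →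
      ε ≤ tangentTrace (coeff z metric.toRealOneOneForm p) (complexGrad z ρ p) (gCoeff z χ uSub p) +
        t * tangentTrace (coeff z metric.toRealOneOneForm p) (complexGrad z ρ p)
          (complexHessian z ρ p) := by
  have hc := h.toIsHolomorphicChart
  have hρC := h.contMDiffOn_rho_two
  set P : M → Matrix (Fin n) (Fin n) ℂ → ℝ := fun q F ↦
    tangentTrace (coeff z metric.toRealOneOneForm q) (complexGrad z ρ q) F with hP
  set κ : M → ℝ := fun q ↦ -P q (complexHessian z ρ q) with hκdef
  set f : M → ℝ := fun q ↦ P q (gCoeff z χ uSub q) with hf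
  have hsU : ContMDiffOn (𝓡∂ (2 * n)) 𝓘(ℝ, ℝ) 2 uSub U := (huSub.of_le (by norm_cast)).contMDiffOn
  have hWp := fun q (hq : q ∈ U) ↦ posDef_coeff hc hq metric
  have hκpos : ∀ q ∈ U, 0 < κ q := fun q hq ↦ neg_pos.2 (hκ q hq)
  have hfpos : ∀ q ∈ U, 0 < f q := fun q hq ↦ (prod_pSums_le (by omega) (hWp q hq)
    (isHermitian_gCoeff hc hq χ hsU) (h.complexGrad_ne_zero q hq) (hadm U z hc q hq)).1
  have hκC : ContMDiffOn (𝓡∂ (2 * n)) 𝓘(ℝ, ℝ) 2 κ U :=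
    (h.contMDiffOn_tangentTrace metric (isC2Matrix_complexHessian hc
      (h.contMDiffOn_rho.of_le (by norm_cast)))).neg
  have hfC : ContMDiffOn (𝓡∂ (2 * n)) 𝓘(ℝ, ℝ) 2 f U :=
    h.contMDiffOn_tangentTrace metric (isC2Matrix_gCoeff hc χ (huSub.of_le (by norm_cast)).contMDiffOn)
  -- The critical slope: the quantity to be bounded is `f - tκ = (η - t)κ`, so the aim is `t ≤ η -
  -- ε` at boundary points.
  set η : M → ℝ := fun q ↦ f q / κ q with hη
  have hηC : ContMDiffOn (𝓡∂ (2 * n)) 𝓘(ℝ, ℝ) 2 η U := hfC.div₀ hκC fun q hq ↦ (hκpos q hq).ne'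
  have hηκ : ∀ q ∈ U, η q * κ q = f q := fun q hq ↦ div_mul_cancel₀ _ (hκpos q hq).ne'
  have hηpos : ∀ q ∈ U, 0 < η q := fun q hq ↦ div_pos (hfpos q hq) (hκpos q hq)
  obtain ⟨C₀, hC₀, hC⟩ := exists_uniform_bound (by omega : 1 ≤ n) metric χ σ huSub
  obtain ⟨R, hR, hBc, hBN⟩ := hc.exists_isCompact_ball hp
    (isClopen_boundaryComponents.isOpen.mem_nhds (boundary_subset_boundaryComponents hpb))
  have hsub : {x | x ∈ U ∧ sqDist z (z p₀) x ≤ R} ⊆ U := fun x hx ↦ hx.1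
  have hHη := continuousOn_complexHessian hc hηC
  have hHρ := continuousOn_complexHessian hc hρC
  have hgη := continuousOn_complexGrad hc hηC
  have hgρ := continuousOn_complexGrad hc hρC
  have hone : ContinuousOn (fun _ : M ↦ (1 : Matrix (Fin n) (Fin n) ℂ)) U := continuousOn_const
  obtain ⟨κ₀, hκ₀, hκ₀B⟩ := hBc.exists_forall_le' (hκC.continuousOn.mono hsub) (a := 0)
    fun q hq ↦ hκpos q hq.1
  obtain ⟨m₀, hm₀, hm₀B⟩ := hBc.exists_forall_le' (hηC.continuousOn.mono hsub) (a := 0)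
    fun q hq ↦ hηpos q hq.1
  obtain ⟨κ₁, hκ₁, hκ₁B⟩ := hBc.exists_abs_le (hκC.continuousOn.mono hsub)
  obtain ⟨k, hk, hkB⟩ := hBc.exists_abs_le ((h.continuousOn_tangentTrace metric hone).mono hsub)
  obtain ⟨k', hk', hk'B⟩ := hBc.exists_abs_le ((h.continuousOn_tangentTrace metric hHη).mono hsub)
  obtain ⟨c₁, hc₁, hc₁B⟩ := hBc.exists_abs_le (hρC.continuousOn.mono hsub)
  obtain ⟨c₂, hc₂, hc₂B⟩ := hBc.exists_abs_le ((continuousOn_relTrace hc metric hHη).mono hsub)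
  obtain ⟨c₃, hc₃, hc₃B⟩ := hBc.exists_abs_le (hηC.continuousOn.mono hsub)
  obtain ⟨c₄, hc₄, hc₄B⟩ := hBc.exists_abs_le ((continuousOn_relTrace hc metric hHρ).mono hsub)
  obtain ⟨c₅, hc₅, hc₅B⟩ := hBc.exists_abs_le
    ((continuousOn_relTrace hc metric (hgρ.matrix_vecMulVec' hgρ.star)).mono hsub)
  obtain ⟨c₆, hc₆, hc₆B⟩ := hBc.exists_abs_le
    ((continuousOn_relTrace hc metric (hgη.matrix_vecMulVec' hgη.star)).mono hsub)
  obtain ⟨c₇, hc₇, hc₇B⟩ := hBc.exists_abs_le ((continuousOn_relTrace hc metric hone).mono hsub)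
  obtain ⟨c₉, hc₉, hc₉B⟩ := hBc.exists_abs_le
    ((continuousOn_relTrace hc metric (continuousOn_gCoeff hc χ huSub)).mono hsub)
  -- Then `E r² = C₀` on the sphere `r = R/4`, where the barrier must dominate `w`.
  set E := 16 * C₀ / R ^ 2 with hE
  have hE0 : 0 ≤ E := by positivity
  -- Makes the coefficient of `r` in the tangential trace nonpositive: `B κ₀ = 4 E k`.
  set B := 4 * E * k / κ₀ with hB
  have hB0 : 0 ≤ B := by positivity
  -- Makes the coefficient of `ρ` in the tangential trace nonpositive: `2 A κ₀ = k' + B k`.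
  set A := (k' + B * k) / (2 * κ₀) with hA
  have hA0 : 0 ≤ A := by positivity
  -- The bound of `tr g_u` at a negative minimum: the trace of the Hessian of the barrier plus `c₉`,
  -- which bounds `tr g_uSub`.
  set K := c₁ * c₂ + c₃ * c₄ + (c₅ + c₆) + 1 * c₄ +
    B * (c₁ * c₇ + R / 4 * c₄ + (c₅ + R / 4 * c₇)) + A * (2 * (c₁ * c₄) + 2 * c₅) +
    E * (4 * (R / 4 * c₇)) + c₉ with hK
  have hK0 : 0 ≤ K := by positivity
  have hn1 : (0 : ℝ) ≤ (n : ℝ) - 1 := by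
    have : (2 : ℝ) ≤ n := by exact_mod_cast hn
    linarith
  set L := κ₁ * (((n : ℝ) - 1) * K) ^ (n - 1) with hL
  have hL0 : 0 ≤ L := by positivity
  -- Chosen last, as `L` does not depend on `ε`. Here `ε ≤ m₀` keeps the barrier above `E r² ≥ 0`,
  -- and `ε L < σ` is the contradiction.
  obtain ⟨ε, hε, hε1, hεm, hεσ⟩ : ∃ ε : ℝ, 0 < ε ∧ ε ≤ 1 ∧ ε ≤ m₀ ∧ ε * L < σ := by
    refine ⟨min 1 (min m₀ (σ / (L + 1))), by positivity, min_le_left _ _,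
      (min_le_right _ _).trans (min_le_left _ _), ?_⟩
    have h1 : min 1 (min m₀ (σ / (L + 1))) ≤ σ / (L + 1) :=
      (min_le_right _ _).trans (min_le_right _ _)
    calc _ ≤ σ / (L + 1) * L := mul_le_mul_of_nonneg_right h1 hL0
      _ < σ := by
        rw [div_mul_eq_mul_div, div_lt_iff₀ (by positivity)]
        nlinarith
  refine ⟨ε * κ₀, by positivity, ?_⟩
  filter_upwards [hc.sqDist_lt_mem_nhds hp (y := z p₀) (r := R / 8)
    (by rw [sqDist_self]; positivity)] with p hpR hpb u hu t ht
  obtain ⟨hpU, hpR⟩ := hpR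
  have hw := hu.contMDiffOn_sub huSub U
  have hbC := contMDiffOn_normalBarrier hc hρC hηC ε B A E (z p)
  have hnn := nonneg_of_ball hc hBc hpR (hbC.sub hw) ?_
  · have hρ0 : ρ p = 0 := (h.mem_boundary_iff p hpU).1 hpb
    have hwp : u p - uSub p = 0 := sub_eq_zero.2 (hu.boundary_eq p hpb)
    have key := h.normalDeriv_nonneg hpU hpb (hbC.sub hw) (t := η p - ε - t) ?_ ?_
    · have h1 : (η p - t) * κ p ≥ ε * κ p :=
        mul_le_mul_of_nonneg_right (by linarith) (hκpos p hpU).le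
      have h2 : ε * κ₀ ≤ ε * κ p := mul_le_mul_of_nonneg_left
        (hκ₀B p ⟨hpU, by linarith⟩) hε.le
      have h3 := hηκ p hpU
      change ε * κ₀ ≤ f p + t * P p (complexHessian z ρ p)
      have h4 : P p (complexHessian z ρ p) = - κ p := (neg_neg _).symm
      rw [h4]
      linarith
    · filter_upwards [hc.sqDist_lt_mem_nhds hpU (y := z p) (r := R / 4)
        (by rw [sqDist_self]; positivity)] with x hx
      have := hnn x hx.1 hx.2
      simpa [hρ0, sqDist_self, hwp, normalBarrier] using this
    · intro v
      change realDeriv z v (fun x ↦ normalBarrier z ρ η ε B A E (z p) x - (u x - uSub x)) p = _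
      rw [realDeriv_sub hc hbC hw hpU, realDeriv_normalBarrier hc hρC hηC _ _ _ _ hpU hρ0, ht]
      ring
  intro q hq hqR hqp hneg
  have hqB : q ∈ {x | x ∈ U ∧ sqDist z (z p₀) x ≤ R} := ⟨hq, hqR⟩
  have hρq := h.rho_nonneg q hq
  have hr0 := sqDist_nonneg z (z p) q
  change normalBarrier z ρ η ε B A E (z p) q - (u q - uSub q) < 0 at hneg
  have hηε : 0 ≤ η q - ε := by linarith [hm₀B q hqB]
  have hbE : E * (sqDist z (z p) q * sqDist z (z p) q) ≤ normalBarrier z ρ η ε B A E (z p) q := by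
    have h1 : 0 ≤ ρ q * (η q - ε) := mul_nonneg hρq hηε
    have h2 : 0 ≤ B * (ρ q * sqDist z (z p) q) := by positivity
    have h3 : 0 ≤ A * (ρ q * ρ q) := by positivity
    unfold normalBarrier
    linarith
  refine ⟨fun heq ↦ ?_, fun hqb ↦ ?_, fun hpsd ↦ ?_⟩
  · have h1 := hC u hu q (hBN hqB)
    have h2 : E * (sqDist z (z p) q * sqDist z (z p) q) = C₀ := by
      rw [heq, hE]; field_simp; ring
    linarith
  · rw [sub_eq_zero.2 (hu.boundary_eq q hqb)] at hneg
    have : 0 ≤ E * (sqDist z (z p) q * sqDist z (z p) q) := by positivity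
    linarith
  · change (complexHessian z (fun x ↦ normalBarrier z ρ η ε B A E (z p) x -
      (u x - uSub x)) q).PosSemidef at hpsd
    have ha := h.complexGrad_ne_zero q hq
    have hr := star_dotProduct_grad_sqDist z (z p) q
    have hP0 := tangentTrace_nonneg (hWp q hq) ha hpsd
    have hτ0 := _root_.relTrace_nonneg (hWp q hq) hpsd
    rw [complexHessian_sub hc hbC hw hq, hu.relTrace_hessian huSub hc hq,
      complexHessian_normalBarrier hc hρC hηC _ _ _ _ _ hq] at hP0 hτ0
    rw [tangentTrace_sub, tangentTrace_sub] at hP0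
    rw [relTrace_sub, relTrace_sub] at hτ0
    have hPb := tangentTrace_barrierMatrix_le (g := complexGrad z η q) (F := complexHessian z ρ q)
      (H := complexHessian z η q) (ρ := ρ q) (η := η q) (ε := ε) (B := B) (A := A) (hWp q hq) ha hr hE0
    have hτb := relTrace_barrierMatrix_le (a := complexGrad z ρ q) (g := complexGrad z η q)
      (F := complexHessian z ρ q)
      (H := complexHessian z η q) (ρ := ρ q) (η := η q) (ε := ε) (hWp q hq) hr hB0 hA0 hE0
      (hc₁B q hqB) (hc₂B q hqB) (hc₃B q hqB) (hc₄B q hqB) (hc₅B q hqB) (hc₆B q hqB) (hc₇B q hqB)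
      (c₈ := R / 4) (by rwa [abs_of_nonneg hr0]) (by rwa [abs_of_pos hε])
    have huU : ContMDiffOn (𝓡∂ (2 * n)) 𝓘(ℝ, ℝ) 2 u U :=
      (hu.contMDiff.of_le (by norm_num)).contMDiffOn
    obtain ⟨g1, g2, g3⟩ := prod_pSums_le (by omega) (hWp q hq) (isHermitian_gCoeff hc hq χ huU) ha
      (hu.admissible U z hc q hq)
    have g4 : σ ≤ _ := (hu.le_maOperator U z hc q hq).trans g3
    have hPρ : tangentTrace (coeff z metric.toRealOneOneForm q) (complexGrad z ρ q)
      (complexHessian z ρ q) = - κ q := (neg_neg _).symm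
    have hκq := hκ₀B q hqB
    have hkq := (abs_le.1 (hkB q hqB)).2
    have hk'q := (abs_le.1 (hk'B q hqB)).2
    rw [hPρ] at hPb
    have i1 : ρ q * (tangentTrace (coeff z metric.toRealOneOneForm q) (complexGrad z ρ q)
        (complexHessian z η q) + B * tangentTrace (coeff z metric.toRealOneOneForm q)
        (complexGrad z ρ q) 1 + 2 * A * -κ q) ≤ 0 := by
      refine mul_nonpos_of_nonneg_of_nonpos hρq ?_
      have j1 := mul_le_mul_of_nonneg_left hkq hB0
      have j2 := mul_le_mul_of_nonneg_left hκq hA0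
      have j3 : 2 * (A * κ₀) = k' + B * k := by rw [hA]; field_simp
      linarith
    have i2 : sqDist z (z p) q * (4 * E * tangentTrace (coeff z metric.toRealOneOneForm q)
        (complexGrad z ρ q) 1 + B * -κ q) ≤ 0 := by
      refine mul_nonpos_of_nonneg_of_nonpos hr0 ?_
      have j1 := mul_le_mul_of_nonneg_left hkq hE0
      have j2 := mul_le_mul_of_nonneg_left hκq hB0
      have j3 : B * κ₀ = 4 * E * k := by rw [hB]; field_simp
      linarith
    -- The term `(η - ε)(-κ) = -f + εκ` cancels the tangential trace `f` of `g_uSub`; this is why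
    -- `η` had to be extended into the interior as a function.
    have i3 : tangentTrace (coeff z metric.toRealOneOneForm q) (complexGrad z ρ q) (gCoeff z χ u q) ≤
        ε * κ₁ := by
      have j1 := hηκ q hq
      have j2 : ε * κ q ≤ ε * κ₁ := mul_le_mul_of_nonneg_left (abs_le.1 (hκ₁B q hqB)).2 hε.le
      have j3 : f q = tangentTrace (coeff z metric.toRealOneOneForm q) (complexGrad z ρ q)
        (gCoeff z χ uSub q) := rfl
      linarith
    have i4 : relTrace (coeff z metric.toRealOneOneForm q) (gCoeff z χ u q) ≤ K := by
      have := (abs_le.1 (hc₉B q hqB)).2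
      linarith
    have i5 : (((n : ℝ) - 1) * relTrace (coeff z metric.toRealOneOneForm q) (gCoeff z χ u q)) ^ (n - 1)
        ≤ (((n : ℝ) - 1) * K) ^ (n - 1) :=
      pow_le_pow_left₀ (mul_nonneg hn1 g2) (mul_le_mul_of_nonneg_left i4 hn1) _
    -- Now `σ ≤ ℳ(u) ≤ P(g_u) ((n - 1) tr g_u)^(n - 1) ≤ ε L < σ`.
    have i6 := mul_le_mul i3 i5 (pow_nonneg (mul_nonneg hn1 g2) _) (by positivity)
    rw [mul_assoc, ← hL] at i6
    linarith

end SharpBound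

theorem IsTangentialFrame.mul_jacobianT {n : ℕ} [NeZero n] {M : Type*} [TopologicalSpace M]
    [ChartedSpace (EuclideanHalfSpace (2 * n)) M] {X : ComplexStructure n M} {U U₀ : Set M}
    {z z₀ : M → (Fin n → ℂ)} {q : M} (h : IsHolomorphicChart X.J U z) (hq : q ∈ U)
    (h₀ : IsHolomorphicChart X.J U₀ z₀) (hq₀ : q ∈ U₀) {Ξ : Matrix (Fin (n - 1)) (Fin n) ℂ}
    (hΞ : IsTangentialFrame X z₀ q Ξ) : IsTangentialFrame X z q (Ξ * jacobianT z₀ z q) := by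
  have hrow : ∀ a, (Ξ * jacobianT z₀ z q) a = coordChange z₀ z q (Ξ a) := fun a ↦ by
    rw [Matrix.mul_apply_eq_vecMul, vecMul_jacobianT h hq h₀ hq₀]
  refine ⟨?_, fun a ↦ ?_⟩
  · have hinj : Function.Injective fun v ↦ v ᵥ* jacobianT z₀ z q := by
      refine Function.LeftInverse.injective (g := coordChange z z₀ q) fun v ↦ ?_
      rw [vecMul_jacobianT h hq h₀ hq₀, coordChange_coordChange h₀ hq₀ h hq]
    exact hΞ.1.map' (Matrix.vecMulLinear (jacobianT z₀ z q)) (LinearMap.ker_eq_bot.2 hinj)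
  · rw [hrow, coordVec_coordChange h hq]
    exact hΞ.2 a

/-! ### The lower bound on the boundary -/

section BoundaryEstimate

variable {n : ℕ} [NeZero n] {M : Type*} [TopologicalSpace M]
  [ChartedSpace (EuclideanHalfSpace (2 * n)) M]
  [IsManifold (𝓡∂ (2 * n)) ∞ M] {X : ComplexStructure n M}
  {metric : HermitianMetric X} {χ : RealOneOneForm X} {uSub u ρ f : M → ℝ} {σ : ℝ}
  {U U₀ : Set M} {z z₀ : M → (Fin n → ℂ)} {p₀ p q : M}

theorem tangentialEigenvalues_mul_jacobianT (h : IsHolomorphicChart X.J U z) (hq : q ∈ U)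
    (h₀ : IsHolomorphicChart X.J U₀ z₀) (metric : HermitianMetric X) (χ : RealOneOneForm X)
    (hq₀ : q ∈ U₀)
    (hf : ContMDiff (𝓡∂ (2 * n)) 𝓘(ℝ, ℝ) 2 f) (Ξ : Matrix (Fin (n - 1)) (Fin n) ℂ) :
    tangentialEigenvalues metric χ f z q (Ξ * jacobianT z₀ z q) =
      tangentialEigenvalues metric χ f z₀ q Ξ := by
  have h' := h.mono (h.isOpen.inter h₀.isOpen) inter_subset_left
  have h₀' := h₀.mono (h.isOpen.inter h₀.isOpen) inter_subset_right
  unfold tangentialEigenvalues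
  rw [coeff_coordChange h' ⟨hq, hq₀⟩ h₀', gCoeff_coordChange h' ⟨hq, hq₀⟩ h₀' χ hf.contMDiffOn]
  simp only [Matrix.conjTranspose_mul, Matrix.mul_assoc]

/-- `u - uSub - tρ` vanishes on the boundary and has zero differential at `p`, so its complex
Hessian is zero on the holomorphic tangent space. The unknown second derivatives of `u` enter only
through the number `t`. -/
theorem IsDominatedSolution.sum_tangentialEigenvalues (hu : IsDominatedSolution metric χ uSub σ u)
    (hn : 1 ≤ n) (huSub : ContMDiff (𝓡∂ (2 * n)) 𝓘(ℝ, ℝ) ∞ uSub)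
    (h : IsBoundaryChart X.J U z ρ) (hp : p ∈ U) (hpb : p ∈ (𝓡∂ (2 * n)).boundary M)
    {Ξ : Matrix (Fin (n - 1)) (Fin n) ℂ} (hΞ : IsTangentialFrame X z p Ξ) {t : ℝ}
    (ht : ∀ v, realDeriv z v (fun x ↦ u x - uSub x) p = t * realDeriv z v ρ p) :
    (tangentialEigenvalues metric χ u z p Ξ).sum =
      tangentTrace (coeff z metric.toRealOneOneForm p) (complexGrad z ρ p) (gCoeff z χ uSub p) +
        t * tangentTrace (coeff z metric.toRealOneOneForm p) (complexGrad z ρ p)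
          (complexHessian z ρ p) := by
  have hc := h.toIsHolomorphicChart
  have hW := posDef_coeff hc hp metric
  have ha := h.complexGrad_ne_zero p hp
  have hΞa := h.mulVec_complexGrad hp hpb hΞ
  have hρ := h.contMDiffOn_rho_two
  have hw := hu.contMDiffOn_sub huSub U
  have htρ : ContMDiffOn (𝓡∂ (2 * n)) 𝓘(ℝ, ℝ) 2 (fun x ↦ t * ρ x) U := contMDiffOn_const.mul hρ
  have h0 : Ξ * complexHessian z (fun x ↦ (u x - uSub x) - t * ρ x) p * Ξᴴ = 0 := by
    refine h.conj_complexHessian_eq_zero hp hpb (hw.sub htρ) (fun x hx hxb ↦ ?_) (fun v ↦ ?_) hΞ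
    · rw [hu.boundary_eq x hxb, (h.mem_boundary_iff x hx).1 hxb]
      ring
    · rw [realDeriv_sub hc hw htρ hp, ht, realDeriv_const_mul t (hc.mdifferentiableAt hρ (by simp) hp), sub_self]
  have h1 := sum_relEigenvalues_restrict (G := complexHessian z (fun x ↦ (u x - uSub x) - t * ρ x) p)
    hn hW ha hΞ.1 hΞa
  rw [h0, sum_relEigenvalues, Matrix.zero_mul, Matrix.trace_zero, Complex.zero_re,
    complexHessian_sub hc hw htρ hp, complexHessian_const_mul hc t hρ hp,
    hu.relTrace_hessian huSub hc hp, tangentTrace_sub, tangentTrace_sub, tangentTrace_smul] at h1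
  rw [tangentialEigenvalues, sum_relEigenvalues_restrict hn hW ha hΞ.1 hΞa]
  linarith

theorem IsDominatedSolution.normalDeriv_nonneg [T2Space M] [CompactSpace M]
    (hu : IsDominatedSolution metric χ uSub σ u) (hn : 2 ≤ n)
    (huSub : ContMDiff (𝓡∂ (2 * n)) 𝓘(ℝ, ℝ) ∞ uSub) (hadm : IsAdmissible (n - 1) metric χ uSub)
    (h : IsBoundaryChart X.J U z ρ) (hp : p ∈ U) (hpb : p ∈ (𝓡∂ (2 * n)).boundary M) {t : ℝ}
    (ht : ∀ v, realDeriv z v (fun x ↦ u x - uSub x) p = t * realDeriv z v ρ p) : 0 ≤ t := by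
  refine h.normalDeriv_nonneg hp hpb (hu.contMDiffOn_sub huSub U) ?_ ht
  filter_upwards [isClopen_boundaryComponents.isOpen.mem_nhds
    (boundary_subset_boundaryComponents hpb)] with x hx
  rw [sub_eq_zero.2 (hu.boundary_eq p hpb)]
  exact hu.le_of_mem hn huSub hadm x hx

/-- The lower bound of the tangential trace near a boundary point, with the coordinates of a boundary
chart. -/
theorem exists_isBoundaryChart_le_sum [T2Space M] [CompactSpace M] (hn : 2 ≤ n)
    (metric : HermitianMetric X) (χ : RealOneOneForm X) (hσ : 0 < σ)
    (huSub : ContMDiff (𝓡∂ (2 * n)) 𝓘(ℝ, ℝ) ∞ uSub) (hadm : IsAdmissible (n - 1) metric χ uSub)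
    (hpb : p₀ ∈ (𝓡∂ (2 * n)).boundary M) :
    ∃ (U : Set M) (z : M → (Fin n → ℂ)) (c : ℝ), p₀ ∈ U ∧ IsHolomorphicChart X.J U z ∧ 0 < c ∧
      ∀ᶠ p in 𝓝 p₀, p ∈ (𝓡∂ (2 * n)).boundary M → ∀ u, IsDominatedSolution metric χ uSub σ u →
        ∀ Ξ, IsTangentialFrame X z p Ξ → c ≤ (tangentialEigenvalues metric χ u z p Ξ).sum := by
  obtain ⟨U, z, ρ, hp, h⟩ := exists_isBoundaryChart X p₀
  have hc := h.toIsHolomorphicChart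
  have hκC := h.continuousOn_tangentTrace metric
    (continuousOn_complexHessian hc h.contMDiffOn_rho_two)
  have hfC := h.continuousOn_tangentTrace metric (continuousOn_gCoeff hc χ huSub)
  have hw0 : ∀ u, IsDominatedSolution metric χ uSub σ u →
      ∀ x ∈ U, x ∈ (𝓡∂ (2 * n)).boundary M → u x - uSub x = 0 :=
    fun u hu x _ hxb ↦ sub_eq_zero.2 (hu.boundary_eq x hxb)
  -- The sign at `p₀` decides whether a positive `t` can do harm. If the trace is nonnegative there,
  -- continuity makes its negative part small and any bound of `t` suffices; otherwise the sharp
  -- bound is needed.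
  rcases le_or_gt 0 (tangentTrace (coeff z metric.toRealOneOneForm p₀) (complexGrad z ρ p₀)
    (complexHessian z ρ p₀)) with hκ | hκ
  · obtain ⟨C, hC0, hC⟩ := h.exists_normalDeriv_le (σ := σ) (by omega) metric χ huSub hp hpb
    have hf₀ := (prod_pSums_le (by omega) (posDef_coeff hc hp metric) (isHermitian_gCoeff hc hp χ
      (huSub.of_le (by norm_cast)).contMDiffOn) (h.complexGrad_ne_zero p₀ hp)
      (hadm U z hc p₀ hp)).1
    set f₀ := tangentTrace (coeff z metric.toRealOneOneForm p₀) (complexGrad z ρ p₀)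
      (gCoeff z χ uSub p₀) with hf₀def
    have hU := h.isOpen.mem_nhds hp
    -- Near `p₀` the first term exceeds `f₀/2`, and since `0 ≤ t ≤ C` the second is at least
    -- `-f₀/4`.
    refine ⟨U, z, f₀ / 4, hp, hc, by positivity, ?_⟩
    filter_upwards [hC, hU, (hfC.continuousAt hU).eventually (lt_mem_nhds (half_lt_self hf₀)),
      (hκC.continuousAt hU).eventually (lt_mem_nhds (a := -(f₀ / (4 * (C + 1))))
        (lt_of_lt_of_le (neg_lt_zero.2 (by positivity)) hκ))]
      with p hCp hpU hfp hκp hpb u hu Ξ hΞ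
    obtain ⟨t, ht⟩ := h.exists_normalDeriv hpU hpb (hu.contMDiffOn_sub huSub U) (hw0 u hu)
    have ht0 := hu.normalDeriv_nonneg hn huSub hadm h hpU hpb ht
    have htC := hCp hpb u hu t ht
    rw [hu.sum_tangentialEigenvalues (by omega) huSub h hpU hpb hΞ ht]
    have h1 := mul_le_mul_of_nonneg_left hκp.le ht0
    have h2 : t * (f₀ / (4 * (C + 1))) ≤ f₀ / 4 := by
      rw [mul_div_assoc', div_le_div_iff₀ (by positivity) (by positivity)]
      nlinarith
    linarith
  · set V := U ∩ (fun q ↦ tangentTrace (coeff z metric.toRealOneOneForm q) (complexGrad z ρ q)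
      (complexHessian z ρ q)) ⁻¹' Iio 0 with hV
    have hVo : IsOpen V := hκC.isOpen_inter_preimage h.isOpen isOpen_Iio
    have hVU : V ⊆ U := inter_subset_left
    have h' := h.mono hVo hVU
    have hpV : p₀ ∈ V := ⟨hp, hκ⟩
    obtain ⟨ε, hε, hev⟩ := h'.exists_normalDeriv_le_sub hn metric χ hσ huSub hadm hpV hpb
      fun q hq ↦ hq.2
    refine ⟨U, z, ε, hp, hc, hε, ?_⟩
    filter_upwards [hev, h.isOpen.mem_nhds hp] with p hevp hpU hpb u hu Ξ hΞ
    obtain ⟨t, ht⟩ := h.exists_normalDeriv hpU hpb (hu.contMDiffOn_sub huSub U) (hw0 u hu)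
    rw [hu.sum_tangentialEigenvalues (by omega) huSub h hpU hpb hΞ ht]
    exact hevp hpb u hu t ht

/-- The uniform lower bound of the tangential trace on the whole boundary. -/
theorem exists_le_sum_tangentialEigenvalues [T2Space M] [CompactSpace M] (hn : 2 ≤ n)
    (metric : HermitianMetric X) (χ : RealOneOneForm X) (hσ : 0 < σ)
    (huSub : ContMDiff (𝓡∂ (2 * n)) 𝓘(ℝ, ℝ) ∞ uSub) (hadm : IsAdmissible (n - 1) metric χ uSub) :
    ∃ c : ℝ, 0 < c ∧ ∀ u, IsDominatedSolution metric χ uSub σ u →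
      ∀ p ∈ (𝓡∂ (2 * n)).boundary M, ∀ (U : Set M) (z : M → (Fin n → ℂ)),
      IsHolomorphicChart X.J U z → p ∈ U → ∀ Ξ, IsTangentialFrame X z p Ξ →
        c ≤ (tangentialEigenvalues metric χ u z p Ξ).sum := by
  have hcpt : IsCompact ((𝓡∂ (2 * n)).boundary M) :=
    ((𝓡∂ (2 * n)).isClosed_boundary (M := M) (n := ∞) (by simp)).isCompact
  suffices H : ∃ c : ℝ, 0 < c ∧ ∀ p ∈ (𝓡∂ (2 * n)).boundary M, p ∈ (𝓡∂ (2 * n)).boundary M →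
      ∀ u, IsDominatedSolution metric χ uSub σ u → ∀ (U : Set M) (z : M → (Fin n → ℂ)),
      IsHolomorphicChart X.J U z → p ∈ U → ∀ Ξ, IsTangentialFrame X z p Ξ →
        c ≤ (tangentialEigenvalues metric χ u z p Ξ).sum by
    obtain ⟨c, hc, H⟩ := H
    exact ⟨c, hc, fun u hu p hp ↦ H p hp hp u hu⟩
  -- The local constants are combined over a finite cover of the compact boundary.
  refine hcpt.induction_on (p := fun s ↦ ∃ c : ℝ, 0 < c ∧ ∀ p ∈ s,
      p ∈ (𝓡∂ (2 * n)).boundary M →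
      ∀ u, IsDominatedSolution metric χ uSub σ u → ∀ (U : Set M) (z : M → (Fin n → ℂ)),
      IsHolomorphicChart X.J U z → p ∈ U → ∀ Ξ, IsTangentialFrame X z p Ξ →
        c ≤ (tangentialEigenvalues metric χ u z p Ξ).sum)
    ⟨1, one_pos, by simp⟩ ?_ ?_ ?_
  · rintro s t hst ⟨c, hc, H⟩
    exact ⟨c, hc, fun p hp ↦ H p (hst hp)⟩
  · rintro s t ⟨c, hc, H⟩ ⟨d, hd, H'⟩
    refine ⟨min c d, lt_min hc hd, ?_⟩
    rintro p (hp | hp) hpb u hu U z h hpU Ξ hΞ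
    · exact (min_le_left _ _).trans (H p hp hpb u hu U z h hpU Ξ hΞ)
    · exact (min_le_right _ _).trans (H' p hp hpb u hu U z h hpU Ξ hΞ)
  · intro p₀ hp₀
    obtain ⟨U, z, c, hpU, h, hc, hev⟩ := exists_isBoundaryChart_le_sum hn metric χ hσ huSub hadm hp₀
    refine ⟨_, mem_nhdsWithin_of_mem_nhds (inter_mem hev (h.isOpen.mem_nhds hpU)), c, hc, ?_⟩
    rintro p ⟨hp, hpU⟩ hpb u hu U' z' h' hpU' Ξ hΞ
    -- An arbitrary chart and frame are transported to the chart of the local estimate by the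
    -- Jacobian.
    rw [← tangentialEigenvalues_mul_jacobianT h hpU h' metric χ hpU'
      (hu.contMDiff.of_le (by norm_num)) Ξ]
    exact hp hpb u hu _ (hΞ.mul_jacobianT h hpU h' hpU')

end BoundaryEstimate

end

/-- `ψ` enters only through `σ ≤ ℳ(u) ≤ ℳ(uSub)`, which gives one constant for all admissible
choices of `ψ`. -/
theorem mainTheorem4 (n : ℕ) [NeZero n] (hn : 2 ≤ n)
    {M : Type*} [TopologicalSpace M] [T2Space M] [CompactSpace M]
    [ChartedSpace (EuclideanHalfSpace (2 * n)) M] [IsManifold (𝓡∂ (2 * n)) ∞ M]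
    (X : ComplexStructure n M) (metric : HermitianMetric X) (χ : RealOneOneForm X)
    (uSub : M → ℝ) (huSub : ContMDiff (𝓡∂ (2 * n)) 𝓘(ℝ, ℝ) ∞ uSub)
    (huSub_adm : IsAdmissible (n - 1) metric χ uSub)
    (σ : ℝ) (hσ : 0 < σ) :
    ∃ c₀ : ℝ, 0 < c₀ ∧
      ∀ ψ : M → ℝ, ContMDiff (𝓡∂ (2 * n)) 𝓘(ℝ, ℝ) ∞ ψ → (∀ q, σ ≤ ψ q) →
        IsSubsolution (n - 1) metric χ ψ uSub →
      ∀ u : M → ℝ, ContMDiff (𝓡∂ (2 * n)) 𝓘(ℝ, ℝ) 4 u →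
        IsAdmissible (n - 1) metric χ u → IsSolution (n - 1) metric χ ψ u →
        (∀ q ∈ (𝓡∂ (2 * n)).boundary M, u q = uSub q) →
      ∀ p ∈ (𝓡∂ (2 * n)).boundary M,
      ∀ (U : Set M) (z : M → (Fin n → ℂ)), IsHolomorphicChart X.J U z → p ∈ U →
      ∀ Ξ : Matrix (Fin (n - 1)) (Fin n) ℂ, IsTangentialFrame X z p Ξ →
        c₀ ≤ (tangentialEigenvalues metric χ u z p Ξ).sum := by
  obtain ⟨c, hc, H⟩ := exists_le_sum_tangentialEigenvalues hn metric χ hσ huSub huSub_adm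
  refine ⟨c, hc, fun ψ _ hψ hsub u hu hadm hsol hb ↦ H u ⟨hu, hadm, ?_, ?_, hb⟩⟩
  · intro U z h q hq
    rw [hsol U z h q hq]
    exact hψ q
  · intro U z h q hq
    rw [hsol U z h q hq]
    exact hsub U z h q hq
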